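/- Let $X$ be a smooth manifold (Hausdorff, $\sigma$-compact) of dimension $n+1$ with a volume form $\eta$, by which it is oriented, and let $\pi_{XY}:Y\to X$ be a smooth fiber bundle ($Y$ Hausdorff) with $N$-dimensional fiber. Let $J^1Y\to Y$ be the first jet bundle: its fiber at $y\in Y_x$ consists of the linear maps $\gamma:T_xX\to T_yY$ with $T\pi_{XY}\circ\gamma=\mathrm{id}$. Let $Z\subset\Lambda^{n+1}Y$ be the dual jet bundle: its fiber at $y$ consists of the $(n+1)$-forms on $T_yY$ which vanish when contracted with two vertical vectors. Let $M=J^1Y\times_Y Z$ be the Pontryagin bundle, with projections $\pi_{ZM}:M\to Z$ and $\pi_{XM}:M\to X$. Let $\Theta(z)=\pi_{YZ}^*z$ be the canonical $(n+1)$-form on $Z$, let $\Omega=-\mathbf d\Theta$, and put $\Theta_M=\pi_{ZM}^*\Theta$, $\Omega_M=\pi_{ZM}^*\Omega$. Let $\mathcal L=L\eta$ be a Lagrangian density, with $L:J^1Y\to\mathbb R$ smooth and possibly degenerate. Its generalized energy density is $\mathcal E(\gamma,z)=E(\gamma,z)\,\eta=\gamma^*z-\mathcal L(\gamma)$, which is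 also viewed as an $(n+1)$-form on $M$ by pulling back along $\pi_{XM}$; the function $E:M\to\mathbb R$ is the generalized energy. Put $\Omega_{\mathcal E}=\Omega_M+\mathbf d\mathcal E$. A fibered chart gives coordinates $x^\mu$ on $X$ and $(x^\mu,y^A)$ on $Y$, and hence coordinates $(x^\mu,y^A,v^A_\mu,p,p_A^\mu)$ on $M$ by $\gamma=dx^\mu\otimes(\partial_{x^\mu}+v^A_\mu\,\partial_{y^A})$ and $z=p\,d^{n+1}x+p_A^\mu\,dy^A\wedge(\partial_{x^\mu}\lrcorner\, d^{n+1}x)$. In such a chart write $\mathcal L=L(x,y,v)\,d^{n+1}x$ (this local $L$ is the function $L$ above if $\eta=d^{n+1}x$ in the chart). A vertical variation of a smooth section $\psi$ of $\pi_{XM}$ is a smooth one-parameter family of sections $\psi_\lambda$ ($|\lambda|<\varepsilon$) with $\psi_0=\psi$ which agree with $\psi$ outside a compact set $U\subset X$. The section $\psi$ is a critical point of the Hamilton–Pontryagin action $S(\psi)=\int_X\psi^*(\Theta_M-\mathcal E)$ if $\frac{d}{d\lambda}\big|_{\lambda=0}\int_U\psi_\lambda^*(\Theta_M-\mathcal E)=0$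 for all its vertical variations. **Theorem.** Let $\psi:X\to M$ be a smooth section of $\pi_{XM}$ with $E(\psi)=0$. The following are equivalent: 1. $\psi$ is a critical point of the Hamilton–Pontryagin action. 2. $\psi^*(\mathcal V\lrcorner\,\Omega_{\mathcal E})=0$ for all smooth $\pi_{XM}$-vertical vector fields $\mathcal V$ on $M$. 3. In every fibered chart, $\psi$ satisfies the implicit Euler–Lagrange equations $$\frac{\partial y^A}{\partial x^\mu}=v^A_\mu,\qquad \frac{\partial p_A^\mu}{\partial x^\mu}=\frac{\partial L}{\partial y^A},\qquad p_A^\mu=\frac{\partial L}{\partial v^A_\mu}$$ together with the covariant Legendre transformation $$p_A^\mu=\frac{\partial L}{\partial v^A_\mu},\qquad p=L-\frac{\partial L}{\partial v^A_\mu}v^A_\mu .$$ 4. Each point of the image of $\psi$ lies in some fibered chart in which $\psi$ satisfies the equations of (3). -/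

import Mathlib

open Set Topology
open scoped Manifold ContDiff

set_option linter.unusedSectionVars false

noncomputable section

namespace HamiltonPontryagin

/-- The model space `ℝ^{n+1}` of the base manifold `X`. -/
abbrev Base (n : ℕ) := EuclideanSpace ℝ (Fin (n + 1))

/-- The model space `ℝ^N` of the fibre of `Y → X`. -/
abbrev Fib (N : ℕ) := EuclideanSpace ℝ (Fin N)

/-- The coordinate vector `∂/∂x^μ` of the base model space. -/
abbrev eX {n : ℕ} (μ : Fin (n + 1)) : Base n := EuclideanSpace.single μ 1

/-- The coordinate vector `∂/∂y^A` of the fibre model space. -/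
abbrev eF {N : ℕ} (A : Fin N) : Fib N := EuclideanSpace.single A 1

/-! ### Linear algebra of semibasic forms -/

/-- The form `d^{n+1}x = dx^1 ∧ ⋯ ∧ dx^{n+1}` on `ℝ^{n+1}`. -/
def stdVol (n : ℕ) : Base n [⋀^Fin (n + 1)]→L[ℝ] ℝ :=
  { (EuclideanSpace.basisFun (Fin (n + 1)) ℝ).toBasis.det with
    cont := by
      have h : Continuous fun w : Fin (n + 1) → Base n =>
          (Matrix.of fun i j => (w j) i).det := by
        refine Continuous.matrix_det ?_
        refine continuous_matrix fun i j => ?_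
        simp only [Matrix.of_apply]
        fun_prop
      convert h using 1
      funext w
      change (EuclideanSpace.basisFun (Fin (n + 1)) ℝ).toBasis.det w = _
      rw [Module.Basis.det_apply]
      congr 1 }

theorem stdVol_apply {n : ℕ} (w : Fin (n + 1) → Base n) :
    stdVol n w = (Matrix.of fun i j => (w j) i).det := rfl

theorem stdVol_eX (n : ℕ) : stdVol n (fun μ => eX μ) = 1 := by
  rw [stdVol_apply]
  convert Matrix.det_one (n := Fin (n + 1)) (R := ℝ)
  ext i j
  simp [Matrix.one_apply]

/-- An alternating `(n+1)`-form on `ℝ^{n+1} × ℝ^N` is semibasic if it vanishes as soon as two of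
its arguments are vertical. -/
def Semibasic {n N : ℕ} (z : (Base n × Fib N) [⋀^Fin (n + 1)]→L[ℝ] ℝ) : Prop :=
  ∀ w : Fin (n + 1) → Base n × Fib N, ∀ i j, i ≠ j → (w i).1 = 0 → (w j).1 = 0 → z w = 0

/-- The linear map `(x, y) ↦ x + (y^A - x^μ) ∂_μ`, which replaces the coordinate `x^μ` by `y^A`. -/
def replaceCoord {n N : ℕ} (A : Fin N) (μ : Fin (n + 1)) : (Base n × Fib N) →L[ℝ] Base n :=
  ContinuousLinearMap.fst ℝ _ _ +
    ((EuclideanSpace.proj A).comp (ContinuousLinearMap.snd ℝ (Base n) (Fib N)) -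
      (EuclideanSpace.proj μ).comp (ContinuousLinearMap.fst ℝ (Base n) (Fib N))).smulRight (eX μ)

theorem replaceCoord_apply {n N : ℕ} (A : Fin N) (μ : Fin (n + 1)) (w : Base n × Fib N) :
    replaceCoord A μ w = w.1 + (w.2 A - w.1 μ) • eX μ := rfl

/-- The form `dy^A ∧ (∂_μ ⌟ d^{n+1}x)`; it is `dx^1 ∧ ⋯ ∧ dx^{n+1}` with the factor `dx^μ` replaced
by `dy^A`. -/
def dyVol {n N : ℕ} (A : Fin N) (μ : Fin (n + 1)) : (Base n × Fib N) [⋀^Fin (n + 1)]→L[ℝ] ℝ :=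
  (stdVol n).compContinuousLinearMap (replaceCoord A μ)

/-- The form `p d^{n+1}x + p_A^μ dy^A ∧ (∂_μ ⌟ d^{n+1}x)`. -/
def semibasicOf {n N : ℕ} (q : ℝ × (Fin N → Fin (n + 1) → ℝ)) :
    (Base n × Fib N) [⋀^Fin (n + 1)]→L[ℝ] ℝ :=
  q.1 • (stdVol n).compContinuousLinearMap (ContinuousLinearMap.fst ℝ _ _) +
    ∑ A, ∑ μ, q.2 A μ • dyVol A μ

/-- The coefficients `(p, p_A^μ)` of an `(n+1)`-form on `ℝ^{n+1} × ℝ^N`. -/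
def semibasicCoeff {n N : ℕ} (z : (Base n × Fib N) [⋀^Fin (n + 1)]→L[ℝ] ℝ) :
    ℝ × (Fin N → Fin (n + 1) → ℝ) :=
  (z fun ν => (eX ν, 0), fun A μ => z (Function.update (fun ν => (eX ν, 0)) μ (0, eF A)))

theorem stdVol_eq_zero_of_smul {n : ℕ} (w : Fin (n + 1) → Base n) {i j : Fin (n + 1)} (hij : i ≠ j)
    (v : Base n) (a b : ℝ) (hi : w i = a • v) (hj : w j = b • v) : stdVol n w = 0 := by
  have h1 : w = Function.update (Function.update w i (a • v)) j (b • v) := by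
    rw [← hi, Function.update_eq_self, ← hj, Function.update_eq_self]
  rw [h1, ContinuousAlternatingMap.map_update_smul, Function.update_comm hij,
    ContinuousAlternatingMap.map_update_smul,
    ContinuousAlternatingMap.map_eq_zero_of_eq _ _ (i := i) (j := j) _ hij]
  · simp
  · rw [Function.update_self, Function.update_of_ne hij.symm, Function.update_self]

theorem semibasic_semibasicOf {n N : ℕ} (q : ℝ × (Fin N → Fin (n + 1) → ℝ)) :
    Semibasic (semibasicOf q) := by
  intro w i j hij hi hj
  have h0 : stdVol n (fun k => (w k).1) = 0 :=
    ContinuousAlternatingMap.map_eq_zero_of_eq _ _ (i := i) (j := j) (by simp [hi, hj]) hij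
  have h1 : ∀ A μ, dyVol A μ w = 0 := fun A μ =>
    stdVol_eq_zero_of_smul (fun k => replaceCoord A μ (w k)) hij (eX μ) ((w i).2 A) ((w j).2 A)
      (by simp [replaceCoord_apply, hi]) (by simp [replaceCoord_apply, hj])
  have h0' : (stdVol n) ((fun a => a.1) ∘ w) = 0 := h0
  simp [semibasicOf, ContinuousAlternatingMap.sum_apply, h1, h0']

theorem dyVol_eX {n N : ℕ} (A : Fin N) (μ : Fin (n + 1)) :
    dyVol A μ (fun ν => (eX ν, 0)) = 0 := by
  refine (stdVol n).toAlternatingMap.map_coord_zero (m := fun ν => replaceCoord A μ (eX ν, 0)) μ ?_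
  simp [replaceCoord_apply]

theorem dyVol_update {n N : ℕ} (A B : Fin N) (μ ν : Fin (n + 1)) :
    dyVol A μ (Function.update (fun κ => (eX κ, 0)) ν (0, eF B)) =
      if A = B ∧ μ = ν then 1 else 0 := by
  change stdVol n (fun κ => replaceCoord A μ
    (Function.update (fun κ => ((eX κ, 0) : Base n × Fib N)) ν (0, eF B) κ)) = _
  by_cases hμ : μ = ν
  · subst hμ
    by_cases hA : A = B
    · subst hA
      rw [← stdVol_eX n, if_pos ⟨rfl, rfl⟩]
      congr 1
      funext κ
      by_cases hκ : κ = μ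
      · subst hκ; simp [replaceCoord_apply]
      · have h' : μ ≠ κ := fun h => hκ h.symm
        simp [replaceCoord_apply, hκ, h']
    · rw [if_neg (fun h => hA h.1)]
      refine (stdVol n).toAlternatingMap.map_coord_zero μ ?_
      simp [replaceCoord_apply, hA]
  · rw [if_neg (fun h => hμ h.2)]
    refine (stdVol n).toAlternatingMap.map_coord_zero μ ?_
    simp [replaceCoord_apply, hμ]

theorem semibasicCoeff_semibasicOf {n N : ℕ} (q : ℝ × (Fin N → Fin (n + 1) → ℝ)) :
    semibasicCoeff (semibasicOf q) = q := by
  refine Prod.ext ?_ (funext fun B => funext fun ν => ?_)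
  · have h : stdVol n ((fun a => a.1) ∘ fun ν => ((eX ν, 0) : Base n × Fib N)) = 1 := stdVol_eX n
    simp [semibasicCoeff, semibasicOf, ContinuousAlternatingMap.sum_apply, dyVol_eX, h]
  · have h : stdVol n ((fun a => a.1) ∘
        Function.update (fun κ => ((eX κ, 0) : Base n × Fib N)) ν (0, eF B)) = 0 := by
      refine (stdVol n).toAlternatingMap.map_coord_zero ν ?_
      simp
    simp [semibasicCoeff, semibasicOf, ContinuousAlternatingMap.sum_apply, dyVol_update, h,
      ite_and]

theorem semibasic_ext {n N : ℕ} {z z' : (Base n × Fib N) [⋀^Fin (n + 1)]→L[ℝ] ℝ}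
    (hz : Semibasic z) (hz' : Semibasic z') (h : semibasicCoeff z = semibasicCoeff z') : z = z' := by
  classical
  have hp : z (fun ν => (eX ν, 0)) = z' (fun ν => (eX ν, 0)) := congrArg Prod.fst h
  have hq : ∀ A μ, z (Function.update (fun ν => (eX ν, 0)) μ (0, eF A)) =
      z' (Function.update (fun ν => (eX ν, 0)) μ (0, eF A)) := fun A μ =>
    congrFun (congrFun (congrArg Prod.snd h) A) μ
  have hperm : ∀ (w : Fin (n + 1) → Base n × Fib N) (σ : Fin (n + 1) → Fin (n + 1)),
      Function.Injective σ → z w = z' w → z (w ∘ σ) = z' (w ∘ σ) := by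
    intro w σ hσ hw
    have e1 := z.toAlternatingMap.map_perm w (Equiv.ofBijective σ (Finite.injective_iff_bijective.1 hσ))
    have e2 := z'.toAlternatingMap.map_perm w (Equiv.ofBijective σ (Finite.injective_iff_bijective.1 hσ))
    exact e1.trans ((congrArg _ hw).trans e2.symm)
  apply ContinuousAlternatingMap.toAlternatingMap_injective
  refine Module.Basis.ext_alternating ((EuclideanSpace.basisFun (Fin (n + 1)) ℝ).toBasis.prod
    (EuclideanSpace.basisFun (Fin N) ℝ).toBasis) fun v hv => ?_
  set b := (EuclideanSpace.basisFun (Fin (n + 1)) ℝ).toBasis.prod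
    (EuclideanSpace.basisFun (Fin N) ℝ).toBasis with hb
  have hbl : ∀ ν, b (Sum.inl ν) = (eX ν, 0) := fun ν => by
    simp [hb, Module.Basis.prod_apply]
  have hbr : ∀ A, b (Sum.inr A) = (0, eF A) := fun A => by
    simp [hb, Module.Basis.prod_apply]
  change z (fun i => b (v i)) = z' (fun i => b (v i))
  by_cases h2 : ∃ i j A B, i ≠ j ∧ v i = Sum.inr A ∧ v j = Sum.inr B
  · obtain ⟨i, j, A, B, hij, hi, hj⟩ := h2
    rw [hz _ i j hij (by rw [hi, hbr]) (by rw [hj, hbr]),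
      hz' _ i j hij (by rw [hi, hbr]) (by rw [hj, hbr])]
  by_cases h1 : ∃ i A, v i = Sum.inr A
  · obtain ⟨i, A, hi⟩ := h1
    have hoth : ∀ j, j ≠ i → ∃ ν, v j = Sum.inl ν := by
      intro j hj
      rcases hvj : v j with ν | B
      · exact ⟨ν, rfl⟩
      · exact absurd ⟨i, j, A, B, hj.symm, hi, hvj⟩ h2
    choose! s hs using hoth
    have hinj : ∀ j k, j ≠ i → k ≠ i → s j = s k → j = k := fun j k hj hk hjk =>
      hv (by rw [hs j hj, hs k hk, hjk])
    obtain ⟨μ, hμ⟩ : ∃ μ, ∀ j, j ≠ i → s j ≠ μ := by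
      by_contra hcon
      push Not at hcon
      have hsurj : Finset.univ ⊆ (Finset.univ.erase i).image s := by
        intro μ _
        obtain ⟨j, hj, hjs⟩ := hcon μ
        exact Finset.mem_image.2 ⟨j, Finset.mem_erase.2 ⟨hj, Finset.mem_univ _⟩, hjs⟩
      have hc := (Finset.card_le_card hsurj).trans Finset.card_image_le
      rw [Finset.card_erase_of_mem (Finset.mem_univ _)] at hc
      simp at hc
    have hw : (fun j => b (v j)) =
        (Function.update (fun ν => ((eX ν, 0) : Base n × Fib N)) μ (0, eF A)) ∘
          (Function.update s i μ) := by
      funext j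
      by_cases hj : j = i
      · subst hj; simp [hi, hbr]
      · simp [hs j hj, hbl, hj, hμ j hj]
    rw [hw]
    refine hperm _ _ ?_ (hq A μ)
    intro j k hjk
    by_cases hj : j = i <;> by_cases hk : k = i
    · rw [hj, hk]
    · subst hj; simp [hk] at hjk; exact absurd hjk.symm (hμ k hk)
    · subst hk; simp [hj] at hjk; exact absurd hjk (hμ j hj)
    · simp [hj, hk] at hjk; exact hinj j k hj hk hjk
  · have hoth : ∀ j, ∃ ν, v j = Sum.inl ν := by
      intro j
      rcases hvj : v j with ν | B
      · exact ⟨ν, rfl⟩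
      · exact absurd ⟨j, B, hvj⟩ h1
    choose s hs using hoth
    have hw : (fun j => b (v j)) = (fun ν => ((eX ν, 0) : Base n × Fib N)) ∘ s := by
      funext j; simp [hs, hbl]
    rw [hw]
    refine hperm _ _ ?_ hp
    intro j k hjk
    exact hv (by rw [hs, hs, hjk])

/-- The linear coordinates `(p, p_A^μ)` on the space of semibasic forms. -/
def semibasicEquiv (n N : ℕ) :
    {z : (Base n × Fib N) [⋀^Fin (n + 1)]→L[ℝ] ℝ // Semibasic z} ≃
      ℝ × (Fin N → Fin (n + 1) → ℝ) where
  toFun z := semibasicCoeff z.1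
  invFun q := ⟨semibasicOf q, semibasic_semibasicOf q⟩
  left_inv z := Subtype.ext
    (semibasic_ext (semibasic_semibasicOf _) z.2 (semibasicCoeff_semibasicOf _))
  right_inv q := semibasicCoeff_semibasicOf q

/-! ### Fibre bundles and fibred charts -/

/-- The model with corners of the base manifold. -/
abbrev baseModel (n : ℕ) : ModelWithCorners ℝ (Base n) (Base n) := 𝓡 (n + 1)

/-- The model with corners of the total space of a fibre bundle. -/
abbrev totalModel (n N : ℕ) :
    ModelWithCorners ℝ (Base n × Fib N) (ModelProd (Base n) (Fib N)) :=
  (𝓡 (n + 1)).prod (𝓡 N)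

/-- A smooth fibre bundle `Y → X` with typical fibre `F`, where `dim X = n + 1` and `dim F = N`:
a map which is locally, over `X`, diffeomorphic to the projection `X × F → X`. -/
structure SmoothFiberBundle (n N : ℕ) (X Y F : Type*)
    [TopologicalSpace X] [ChartedSpace (Base n) X]
    [TopologicalSpace Y] [ChartedSpace (ModelProd (Base n) (Fib N)) Y]
    [TopologicalSpace F] [ChartedSpace (Fib N) F] where
  proj : Y → X
  exists_trivialization : ∀ x : X, ∃ e : Bundle.Trivialization F proj, x ∈ e.baseSet ∧
    ContMDiffOn (totalModel n N) ((𝓡 (n + 1)).prod (𝓡 N)) ∞ e e.source ∧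
    ContMDiffOn ((𝓡 (n + 1)).prod (𝓡 N)) (totalModel n N) ∞
      e.toOpenPartialHomeomorph.symm e.target

variable {n N : ℕ} {X Y F : Type*}
  [TopologicalSpace X] [ChartedSpace (Base n) X]
  [TopologicalSpace Y] [ChartedSpace (ModelProd (Base n) (Fib N)) Y]
  [TopologicalSpace F] [ChartedSpace (Fib N) F]

/-- A fibred chart of `Y → X`: local coordinates `(x^μ, y^A)` on `Y` and `x^μ` on `X` which are
compatible with the projection. -/
structure FiberedChart (B : SmoothFiberBundle n N X Y F) where
  base : OpenPartialHomeomorph X (Base n)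
  total : OpenPartialHomeomorph Y (Base n × Fib N)
  smooth_base : ContMDiffOn (baseModel n) 𝓘(ℝ, Base n) ∞ base base.source
  smooth_base_symm : ContMDiffOn 𝓘(ℝ, Base n) (baseModel n) ∞ base.symm base.target
  smooth_total : ContMDiffOn (totalModel n N) 𝓘(ℝ, Base n × Fib N) ∞ total total.source
  smooth_total_symm : ContMDiffOn 𝓘(ℝ, Base n × Fib N) (totalModel n N) ∞ total.symm total.target
  proj_mem : ∀ y ∈ total.source, B.proj y ∈ base.source
  fst_total : ∀ y ∈ total.source, (total y).1 = base (B.proj y)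

theorem SmoothFiberBundle.exists_fiberedChart [IsManifold (baseModel n) ∞ X]
    [IsManifold (𝓡 N) ∞ F] (B : SmoothFiberBundle n N X Y F) (y : Y) :
    ∃ c : FiberedChart B, y ∈ c.total.source := by
  obtain ⟨e, hx, he, he'⟩ := B.exists_trivialization (B.proj y)
  have hy : y ∈ e.source := e.mem_source.2 hx
  set φ : OpenPartialHomeomorph X (Base n) := chartAt (Base n) (B.proj y)
  set χ : OpenPartialHomeomorph F (Fib N) := chartAt (Fib N) (e y).2
  have hφ : ContMDiffOn (baseModel n) 𝓘(ℝ, Base n) ∞ φ φ.source := contMDiffOn_chart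
  have hφ' : ContMDiffOn 𝓘(ℝ, Base n) (baseModel n) ∞ φ.symm φ.target := contMDiffOn_chart_symm
  have hχ : ContMDiffOn (𝓡 N) 𝓘(ℝ, Fib N) ∞ χ χ.source := contMDiffOn_chart
  have hχ' : ContMDiffOn 𝓘(ℝ, Fib N) (𝓡 N) ∞ χ.symm χ.target := contMDiffOn_chart_symm
  refine ⟨⟨φ, e.toOpenPartialHomeomorph.trans (φ.prod χ), hφ, hφ', ?_, ?_, ?_, ?_⟩, ?_⟩
  · have h : ContMDiffOn ((𝓡 (n + 1)).prod (𝓡 N)) 𝓘(ℝ, Base n × Fib N) ∞ (φ.prod χ)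
        (φ.prod χ).source :=
      (hφ.comp contMDiffOn_fst fun p hp => hp.1).prodMk_space
        (hχ.comp contMDiffOn_snd fun p hp => hp.2)
    exact h.comp (he.mono fun p hp => hp.1) fun p hp => hp.2
  · have h : ContMDiffOn 𝓘(ℝ, Base n × Fib N) ((𝓡 (n + 1)).prod (𝓡 N)) ∞ (φ.prod χ).symm
        (φ.prod χ).target :=
      (hφ'.comp contDiff_fst.contMDiff.contMDiffOn fun p hp => hp.1).prodMk
        (hχ'.comp contDiff_snd.contMDiff.contMDiffOn fun p hp => hp.2)
    exact he'.comp (h.mono fun p hp => hp.1) fun p hp => hp.2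
  · intro y' hy'
    have h := hy'.2.1
    have h' : (e y').1 = B.proj y' := e.proj_toFun y' hy'.1
    rw [← h']
    exact h
  · intro y' hy'
    exact congrArg φ (e.proj_toFun y' hy'.1)
  · refine ⟨hy, ?_, mem_chart_source _ _⟩
    change (e y).1 ∈ φ.source
    rw [show (e y).1 = B.proj y from e.proj_toFun y hy]
    exact mem_chart_source _ _

/-- A chosen fibred chart around a point of `Y`. -/
def SmoothFiberBundle.chart [IsManifold (baseModel n) ∞ X]
    [IsManifold (𝓡 N) ∞ F] (B : SmoothFiberBundle n N X Y F) (y : Y) : FiberedChart B :=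
  (B.exists_fiberedChart y).choose

theorem SmoothFiberBundle.mem_chart [IsManifold (baseModel n) ∞ X]
    [IsManifold (𝓡 N) ∞ F] (B : SmoothFiberBundle n N X Y F) (y : Y) :
    y ∈ (B.chart y).total.source :=
  (B.exists_fiberedChart y).choose_spec

/-- The tangent map of the projection `Y → X`. -/
def SmoothFiberBundle.dproj (B : SmoothFiberBundle n N X Y F) (y : Y) :
    TangentSpace (totalModel n N) y →L[ℝ] TangentSpace (baseModel n) (B.proj y) :=
  mfderiv (totalModel n N) (baseModel n) B.proj y

namespace FiberedChart

variable {B : SmoothFiberBundle n N X Y F} (c : FiberedChart B)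

/-- The tangent map of the coordinates `x^μ` at a point of `X`. -/
def dBase (x : X) : TangentSpace (baseModel n) x →L[ℝ] Base n :=
  mfderiv (baseModel n) 𝓘(ℝ, Base n) c.base x

/-- The tangent map of the inverse coordinates; it sends `e_μ` to `∂/∂x^μ` at `x`. -/
def dBaseInv (x : X) : Base n →L[ℝ] TangentSpace (baseModel n) x :=
  mfderiv 𝓘(ℝ, Base n) (baseModel n) c.base.symm (c.base x)

/-- The tangent map of the coordinates `(x^μ, y^A)` at a point of `Y`. -/
def dTotal (y : Y) : TangentSpace (totalModel n N) y →L[ℝ] Base n × Fib N :=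
  mfderiv (totalModel n N) 𝓘(ℝ, Base n × Fib N) c.total y

/-- The tangent map of the inverse coordinates; it sends `(e_μ, 0)` to `∂/∂x^μ` and `(0, e_A)` to
`∂/∂y^A` at `y`. -/
def dTotalInv (y : Y) : Base n × Fib N →L[ℝ] TangentSpace (totalModel n N) y :=
  mfderiv 𝓘(ℝ, Base n × Fib N) (totalModel n N) c.total.symm (c.total y)

theorem mdiff_base : c.base.MDifferentiable (baseModel n) 𝓘(ℝ, Base n) :=
  ⟨c.smooth_base.mdifferentiableOn (by simp), c.smooth_base_symm.mdifferentiableOn (by simp)⟩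

theorem mdiff_total : c.total.MDifferentiable (totalModel n N) 𝓘(ℝ, Base n × Fib N) :=
  ⟨c.smooth_total.mdifferentiableOn (by simp), c.smooth_total_symm.mdifferentiableOn (by simp)⟩

theorem dBase_dBaseInv {x : X} (hx : x ∈ c.base.source) (v : Base n) :
    c.dBase x (c.dBaseInv x v) = v := by
  have h := c.mdiff_base.comp_symm_deriv (c.base.map_source hx)
  rw [c.base.left_inv hx] at h
  exact DFunLike.congr_fun h v

theorem dBaseInv_dBase {x : X} (hx : x ∈ c.base.source) (v : TangentSpace (baseModel n) x) :
    c.dBaseInv x (c.dBase x v) = v :=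
  DFunLike.congr_fun (c.mdiff_base.symm_comp_deriv hx) v

theorem dTotal_dTotalInv {y : Y} (hy : y ∈ c.total.source) (v : Base n × Fib N) :
    c.dTotal y (c.dTotalInv y v) = v := by
  have h := c.mdiff_total.comp_symm_deriv (c.total.map_source hy)
  rw [c.total.left_inv hy] at h
  exact DFunLike.congr_fun h v

theorem dTotalInv_dTotal {y : Y} (hy : y ∈ c.total.source) (v : TangentSpace (totalModel n N) y) :
    c.dTotalInv y (c.dTotal y v) = v :=
  DFunLike.congr_fun (c.mdiff_total.symm_comp_deriv hy) v

theorem proj_eventuallyEq {y : Y} (hy : y ∈ c.total.source) :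
    B.proj =ᶠ[𝓝 y] fun y' => c.base.symm (c.total y').1 := by
  filter_upwards [c.total.open_source.mem_nhds hy] with y' hy'
  rw [c.fst_total y' hy', c.base.left_inv (c.proj_mem y' hy')]

theorem mdiffAt_proj {y : Y} (hy : y ∈ c.total.source) :
    MDifferentiableAt (totalModel n N) (baseModel n) B.proj y := by
  refine MDifferentiableAt.congr_of_eventuallyEq ?_ (c.proj_eventuallyEq hy)
  have h1 : MDifferentiableAt (totalModel n N) 𝓘(ℝ, Base n) (fun y' => (c.total y').1) y :=
    MDifferentiableAt.comp (I' := 𝓘(ℝ, Base n × Fib N)) y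
      differentiableAt_fst.mdifferentiableAt (c.mdiff_total.mdifferentiableAt hy)
  refine MDifferentiableAt.comp (I' := 𝓘(ℝ, Base n)) y ?_ h1
  refine c.mdiff_base.mdifferentiableAt_symm ?_
  rw [c.fst_total y hy]
  exact c.base.map_source (c.proj_mem y hy)

theorem fst_dTotal {y : Y} (hy : y ∈ c.total.source) (v : TangentSpace (totalModel n N) y) :
    (c.dTotal y v).1 = c.dBase (B.proj y) (B.dproj y v) := by
  have h : (fun y' => (c.total y').1) =ᶠ[𝓝 y] c.base ∘ B.proj := by
    filter_upwards [c.total.open_source.mem_nhds hy] with y' hy' using c.fst_total y' hy'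
  have h1 := h.mfderiv_eq (I := totalModel n N) (I' := 𝓘(ℝ, Base n))
  rw [mfderiv_comp y (c.mdiff_base.mdifferentiableAt (c.proj_mem y hy)) (c.mdiffAt_proj hy)] at h1
  have h2 : mfderiv (totalModel n N) 𝓘(ℝ, Base n) (Prod.fst ∘ c.total) y =
      (ContinuousLinearMap.fst ℝ (Base n) (Fib N)).comp (c.dTotal y) := by
    rw [mfderiv_comp (I' := 𝓘(ℝ, Base n × Fib N)) y differentiableAt_fst.mdifferentiableAt
      (c.mdiff_total.mdifferentiableAt hy), mfderiv_eq_fderiv, fderiv_fst]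
    rfl
  have h3 := h2.symm.trans h1
  exact DFunLike.congr_fun h3 v

theorem dproj_dTotalInv {y : Y} (hy : y ∈ c.total.source) (v : Base n × Fib N) :
    B.dproj y (c.dTotalInv y v) = c.dBaseInv (B.proj y) v.1 := by
  rw [← c.dBaseInv_dBase (c.proj_mem y hy) (B.dproj y _), ← c.fst_dTotal hy,
    c.dTotal_dTotalInv hy]

/-- The change of fibred coordinates. -/
def change (c c' : FiberedChart B) (u : Base n × Fib N) : Base n × Fib N :=
  c'.total (c.total.symm u)

/-- The set on which the change of fibred coordinates is defined. -/
def overlap (c c' : FiberedChart B) : Set (Base n × Fib N) :=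
  c.total.target ∩ c.total.symm ⁻¹' c'.total.source

theorem isOpen_overlap (c c' : FiberedChart B) : IsOpen (c.overlap c') :=
  c.total.isOpen_inter_preimage_symm c'.total.open_source

theorem contDiffOn_change (c c' : FiberedChart B) : ContDiffOn ℝ ∞ (c.change c') (c.overlap c') :=
  (c'.smooth_total.comp (c.smooth_total_symm.mono inter_subset_left)
    fun _ hu => hu.2).contDiffOn

theorem change_mem_overlap (c c' : FiberedChart B) {u : Base n × Fib N} (hu : u ∈ c.overlap c') :
    c.change c' u ∈ c'.overlap c := by
  refine ⟨c'.total.map_source hu.2, ?_⟩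
  change c'.total.symm (c'.total (c.total.symm u)) ∈ c.total.source
  rw [c'.total.left_inv hu.2]
  exact c.total.map_target hu.1

theorem dTotal_comp_dTotalInv (c c' : FiberedChart B) {y : Y} (hy : y ∈ c.total.source)
    (hy' : y ∈ c'.total.source) (v : Base n × Fib N) :
    c'.dTotal y (c.dTotalInv y v) = fderiv ℝ (c.change c') (c.total y) v := by
  have h : mfderiv 𝓘(ℝ, Base n × Fib N) 𝓘(ℝ, Base n × Fib N) (c'.total ∘ c.total.symm)
      (c.total y) = (mfderiv (totalModel n N) 𝓘(ℝ, Base n × Fib N) c'.total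
        (c.total.symm (c.total y))).comp (c.dTotalInv y) :=
    mfderiv_comp (I' := totalModel n N) _
      (c'.mdiff_total.mdifferentiableAt (by rwa [c.total.left_inv hy]))
      (c.mdiff_total.mdifferentiableAt_symm (c.total.map_source hy))
  rw [mfderiv_eq_fderiv, c.total.left_inv hy] at h
  exact (DFunLike.congr_fun h v).symm

theorem dBase_comp_dBaseInv (c c' : FiberedChart B) {y : Y} (hy : y ∈ c.total.source)
    (hy' : y ∈ c'.total.source) (v : Base n) :
    c'.dBase (B.proj y) (c.dBaseInv (B.proj y) v) =
      (fderiv ℝ (c.change c') (c.total y) (v, 0)).1 := by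
  rw [← c.dTotal_comp_dTotalInv c' hy hy', c'.fst_dTotal hy', c.dproj_dTotalInv hy]

end FiberedChart

/-! ### Smooth bundles over `Y` described by fibred charts -/

/-- A bundle over `Y` whose fibres receive coordinates in the vector space `V` from each fibred
chart of `Y → X`, with smooth changes of coordinates. -/
structure FiberData (B : SmoothFiberBundle n N X Y F) (V : Type)
    [NormedAddCommGroup V] [NormedSpace ℝ V] where
  Fiber : Y → Type
  coord : ∀ (c : FiberedChart B) (y : Y), y ∈ c.total.source → Fiber y ≃ V
  exists_transition : ∀ c c' : FiberedChart B, ∃ G : (Base n × Fib N) × V → V,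
    ContDiffOn ℝ ∞ G (c.overlap c' ×ˢ univ) ∧
    ∀ y (hy : y ∈ c.total.source) (hy' : y ∈ c'.total.source) (f : Fiber y),
      coord c' y hy' f = G (c.total y, coord c y hy f)

namespace FiberData

variable {B : SmoothFiberBundle n N X Y F} {V V' : Type}
  [NormedAddCommGroup V] [NormedSpace ℝ V] [NormedAddCommGroup V'] [NormedSpace ℝ V']

/-- The total space of the bundle. -/
structure Total (D : FiberData B V) where
  /-- the base point in `Y` -/
  pt : Y
  /-- the element of the fibre -/
  val : D.Fiber pt

/-- The projection of the total space to `Y`. -/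
def toY (D : FiberData B V) (m : D.Total) : Y := m.pt

/-- The projection of the total space to `X`. -/
def toX (D : FiberData B V) (m : D.Total) : X := B.proj m.pt

/-- The fibre product over `Y` of two bundles. -/
def prod (D : FiberData B V) (D' : FiberData B V') : FiberData B (V × V') where
  Fiber y := D.Fiber y × D'.Fiber y
  coord c y hy := (D.coord c y hy).prodCongr (D'.coord c y hy)
  exists_transition c c' := by
    obtain ⟨G, hG, h⟩ := D.exists_transition c c'
    obtain ⟨G', hG', h'⟩ := D'.exists_transition c c'
    refine ⟨fun w => (G (w.1, w.2.1), G' (w.1, w.2.2)), ?_, ?_⟩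
    · refine (hG.comp (f := fun w : (Base n × Fib N) × V × V' => (w.1, w.2.1)) ?_ ?_).prodMk
        (hG'.comp (f := fun w : (Base n × Fib N) × V × V' => (w.1, w.2.2)) ?_ ?_)
      · fun_prop
      · exact fun w hw => ⟨hw.1, mem_univ _⟩
      · fun_prop
      · exact fun w hw => ⟨hw.1, mem_univ _⟩
    · rintro y hy hy' ⟨f, f'⟩
      exact Prod.ext (h y hy hy' f) (h' y hy hy' f')

/-- The projection of a fibre product to its first factor. -/
abbrev prodFst (D : FiberData B V) (D' : FiberData B V') (m : (D.prod D').Total) : D.Total :=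
  ⟨m.pt, m.val.1⟩

/-- The projection of a fibre product to its second factor. -/
abbrev prodSnd (D : FiberData B V) (D' : FiberData B V') (m : (D.prod D').Total) : D'.Total :=
  ⟨m.pt, m.val.2⟩

variable [IsManifold (baseModel n) ∞ X] [IsManifold (𝓡 N) ∞ F]

open Classical in
/-- The chart of the total space induced by a fibred chart of `Y`. -/
def chartOf (D : FiberData B V) (c : FiberedChart B) :
    PartialEquiv D.Total ((Base n × Fib N) × V) where
  toFun m := (c.total m.pt, if h : m.pt ∈ c.total.source then D.coord c m.pt h m.val else 0)
  invFun w := ⟨c.total.symm w.1,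
    if h : c.total.symm w.1 ∈ c.total.source then (D.coord c _ h).symm w.2
    else (D.coord (B.chart _) _ (B.mem_chart _)).symm 0⟩
  source := {m | m.pt ∈ c.total.source}
  target := c.total.target ×ˢ univ
  map_source' m hm := ⟨c.total.map_source hm, mem_univ _⟩
  map_target' w hw := c.total.map_target hw.1
  left_inv' := by
    rintro ⟨y, f⟩ (hy : y ∈ c.total.source)
    have key : ∀ y', y' = y → ∀ h' : y' ∈ c.total.source,
        (⟨y', (D.coord c y' h').symm (D.coord c y hy f)⟩ : D.Total) = ⟨y, f⟩ := by
      rintro _ rfl h'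
      simp
    have h' : c.total.symm (c.total y) ∈ c.total.source := by rwa [c.total.left_inv hy]
    simp only [dif_pos hy, dif_pos h']
    exact key _ (c.total.left_inv hy) h'
  right_inv' := by
    rintro ⟨u, v⟩ ⟨hu, -⟩
    have h' : c.total.symm u ∈ c.total.source := c.total.map_target hu
    simp only [dif_pos h', Equiv.apply_symm_apply, c.total.right_inv hu]

theorem chartOf_transition (D : FiberData B V) (c c' : FiberedChart B) :
    ((D.chartOf c).symm.trans (D.chartOf c')).source = c.overlap c' ×ˢ univ ∧
    ContDiffOn ℝ ∞ ((D.chartOf c).symm.trans (D.chartOf c')) (c.overlap c' ×ˢ univ) := by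
  refine ⟨?_, ?_⟩
  · ext w
    change ((w.1 ∈ c.total.target ∧ w.2 ∈ univ) ∧ c.total.symm w.1 ∈ c'.total.source) ↔
      (w.1 ∈ c.overlap c' ∧ w.2 ∈ univ)
    simp only [FiberedChart.overlap, mem_inter_iff, mem_preimage, mem_univ, and_true]
  · obtain ⟨G, hG, hcoord⟩ := D.exists_transition c c'
    have h1 : ContDiffOn ℝ ∞ (fun w : (Base n × Fib N) × V => c.change c' w.1)
        (c.overlap c' ×ˢ univ) :=
      (c.contDiffOn_change c').comp contDiff_fst.contDiffOn fun w hw => hw.1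
    refine (h1.prodMk hG).congr ?_
    rintro ⟨u, v⟩ ⟨hu, -⟩
    have h : c.total.symm u ∈ c.total.source := c.total.map_target hu.1
    have h' : c.total.symm u ∈ c'.total.source := hu.2
    refine Prod.ext rfl ?_
    classical
    change (if h : c.total.symm u ∈ c'.total.source then
      D.coord c' _ h ((D.chartOf c).symm (u, v)).val else 0) = G (u, v)
    have h2 : ((D.chartOf c).symm (u, v)).val = (D.coord c _ h).symm v := dif_pos h
    rw [dif_pos h', h2]
    refine (hcoord _ h h' _).trans ?_
    rw [Equiv.apply_symm_apply, c.total.right_inv hu.1]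

/-- The atlas of the total space given by all fibred charts of `Y`. -/
def chartedSpaceCore (D : FiberData B V) :
    ChartedSpaceCore ((Base n × Fib N) × V) D.Total where
  atlas := range D.chartOf
  chartAt m := D.chartOf (B.chart m.pt)
  mem_chart_source m := B.mem_chart m.pt
  chart_mem_atlas m := mem_range_self _
  open_source := by
    rintro _ _ ⟨c, rfl⟩ ⟨c', rfl⟩
    rw [(D.chartOf_transition c c').1]
    exact (c.isOpen_overlap c').prod isOpen_univ
  continuousOn_toFun := by
    rintro _ _ ⟨c, rfl⟩ ⟨c', rfl⟩
    rw [(D.chartOf_transition c c').1]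
    exact (D.chartOf_transition c c').2.continuousOn

instance (D : FiberData B V) : TopologicalSpace D.Total := D.chartedSpaceCore.toTopologicalSpace

instance (D : FiberData B V) : ChartedSpace ((Base n × Fib N) × V) D.Total :=
  D.chartedSpaceCore.toChartedSpace

/-- The chart of the total space induced by a fibred chart, as a local homeomorphism. -/
def homeoOf (D : FiberData B V) (c : FiberedChart B) :
    OpenPartialHomeomorph D.Total ((Base n × Fib N) × V) :=
  D.chartedSpaceCore.openPartialHomeomorph (D.chartOf c) (mem_range_self c)

theorem mem_atlas (D : FiberData B V) {e : OpenPartialHomeomorph D.Total ((Base n × Fib N) × V)}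
    (he : e ∈ atlas ((Base n × Fib N) × V) D.Total) : ∃ c, e = D.homeoOf c := by
  obtain ⟨_, ⟨_, rfl⟩, hf⟩ := he
  obtain ⟨_, ⟨⟨c, rfl⟩, rfl⟩, hc⟩ := hf
  exact ⟨c, hc⟩

instance (D : FiberData B V) : IsManifold 𝓘(ℝ, (Base n × Fib N) × V) ∞ D.Total := by
  refine isManifold_of_contDiffOn _ _ _ ?_
  intro e e' he he'
  obtain ⟨c, rfl⟩ := D.mem_atlas he
  obtain ⟨c', rfl⟩ := D.mem_atlas he'
  have h := D.chartOf_transition c c'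
  simp only [modelWithCornersSelf_coe, modelWithCornersSelf_coe_symm, Function.comp_id,
    Function.id_comp, preimage_id, range_id, inter_univ]
  rw [← h.1] at h
  exact h.2

end FiberData

/-! ### The jet bundle, the dual jet bundle and the Pontryagin bundle -/

/-- The fibre at `y` of the first jet bundle: linear maps `γ : T_x X → T_y Y`, where `x` is the
projection of `y`, with `Tπ ∘ γ = id`. -/
def JetFiber (B : SmoothFiberBundle n N X Y F) (y : Y) : Type :=
  {γ : TangentSpace (baseModel n) (B.proj y) →L[ℝ] TangentSpace (totalModel n N) y //
    ∀ v, B.dproj y (γ v) = v}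

/-- The fibre at `y` of the dual jet bundle `Z`: the `(n+1)`-forms on `T_y Y` which vanish when two
of their arguments are vertical. -/
def DualJetFiber (B : SmoothFiberBundle n N X Y F) (y : Y) : Type :=
  {z : TangentSpace (totalModel n N) y [⋀^Fin (n + 1)]→L[ℝ] ℝ //
    ∀ w i j, i ≠ j → B.dproj y (w i) = 0 → B.dproj y (w j) = 0 → z w = 0}

/-- The fibre coordinates `v^A_μ` on the jet bundle:
`γ (∂/∂x^μ) = ∂/∂x^μ + v^A_μ ∂/∂y^A`. -/
def jetCoord (B : SmoothFiberBundle n N X Y F) (c : FiberedChart B) (y : Y)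
    (hy : y ∈ c.total.source) : JetFiber B y ≃ (Base n →L[ℝ] Fib N) where
  toFun γ := (ContinuousLinearMap.snd ℝ (Base n) (Fib N)).comp
    ((c.dTotal y).comp (γ.1.comp (c.dBaseInv (B.proj y))))
  invFun v := ⟨(c.dTotalInv y).comp
    (((ContinuousLinearMap.id ℝ (Base n)).prod v).comp (c.dBase (B.proj y))), fun w => by
      change B.dproj y (c.dTotalInv y (c.dBase (B.proj y) w, v (c.dBase (B.proj y) w))) = w
      rw [c.dproj_dTotalInv hy, c.dBaseInv_dBase (c.proj_mem y hy)]⟩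
  left_inv γ := by
    refine Subtype.ext (ContinuousLinearMap.ext fun w => ?_)
    change c.dTotalInv y (c.dBase (B.proj y) w,
      (c.dTotal y (γ.1 (c.dBaseInv (B.proj y) (c.dBase (B.proj y) w)))).2) = γ.1 w
    rw [c.dBaseInv_dBase (c.proj_mem y hy)]
    have h : c.dBase (B.proj y) w = (c.dTotal y (γ.1 w)).1 := by rw [c.fst_dTotal hy, γ.2 w]
    rw [h]
    exact c.dTotalInv_dTotal hy _
  right_inv v := by
    refine ContinuousLinearMap.ext fun w => ?_
    change (c.dTotal y (c.dTotalInv y (c.dBase (B.proj y) (c.dBaseInv (B.proj y) w),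
      v (c.dBase (B.proj y) (c.dBaseInv (B.proj y) w))))).2 = v w
    rw [c.dTotal_dTotalInv hy, c.dBase_dBaseInv (c.proj_mem y hy)]

/-- The fibre coordinates `(p, p_A^μ)` on the dual jet bundle:
`z = p d^{n+1}x + p_A^μ dy^A ∧ (∂_μ ⌟ d^{n+1}x)`. -/
def dualCoord (B : SmoothFiberBundle n N X Y F) (c : FiberedChart B) (y : Y)
    (hy : y ∈ c.total.source) : DualJetFiber B y ≃ ℝ × (Fin N → Fin (n + 1) → ℝ) where
  toFun z := semibasicCoeff (z.1.compContinuousLinearMap (c.dTotalInv y))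
  invFun q := ⟨(semibasicOf q).compContinuousLinearMap (c.dTotal y), fun w i j hij hi hj =>
    semibasic_semibasicOf q _ i j hij
      (by change (c.dTotal y (w i)).1 = 0; rw [c.fst_dTotal hy, hi, map_zero])
      (by change (c.dTotal y (w j)).1 = 0; rw [c.fst_dTotal hy, hj, map_zero])⟩
  left_inv z := by
    have hz : Semibasic (z.1.compContinuousLinearMap (c.dTotalInv y)) := by
      intro w i j hij hi hj
      refine z.2 _ i j hij ?_ ?_
      · change B.dproj y (c.dTotalInv y (w i)) = 0
        rw [c.dproj_dTotalInv hy, hi, map_zero]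
      · change B.dproj y (c.dTotalInv y (w j)) = 0
        rw [c.dproj_dTotalInv hy, hj, map_zero]
    have h := semibasic_ext (semibasic_semibasicOf _) hz (semibasicCoeff_semibasicOf _)
    refine Subtype.ext ?_
    dsimp only
    rw [h]
    ext w
    refine congrArg z.1 (funext fun i => ?_)
    exact c.dTotalInv_dTotal hy (w i)
  right_inv q := by
    refine Eq.trans (congrArg semibasicCoeff ?_) (semibasicCoeff_semibasicOf q)
    ext w
    refine congrArg (semibasicOf q) (funext fun i => ?_)
    exact c.dTotal_dTotalInv hy (w i)

theorem FiberedChart.contDiffOn_fderiv_back {B : SmoothFiberBundle n N X Y F}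
    (c c' : FiberedChart B) :
    ContDiffOn ℝ ∞ (fun u => fderiv ℝ (c'.change c) (c.change c' u)) (c.overlap c') :=
  ((c'.contDiffOn_change c).fderiv_of_isOpen (c'.isOpen_overlap c) (by simp)).comp
    (c.contDiffOn_change c') fun _ hu => c.change_mem_overlap c' hu

/-- The first jet bundle `J¹Y`, as a bundle over `Y`. -/
def jetData (B : SmoothFiberBundle n N X Y F) : FiberData B (Base n →L[ℝ] Fib N) where
  Fiber := JetFiber B
  coord := jetCoord B
  exists_transition c c' := by
    refine ⟨fun w => (ContinuousLinearMap.snd ℝ (Base n) (Fib N)).comp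
      ((fderiv ℝ (c.change c') w.1).comp
        (((ContinuousLinearMap.id ℝ (Base n)).prod w.2).comp
          ((ContinuousLinearMap.fst ℝ (Base n) (Fib N)).comp
            ((fderiv ℝ (c'.change c) (c.change c' w.1)).comp
              (ContinuousLinearMap.inl ℝ (Base n) (Fib N)))))), ?_, ?_⟩
    · have h1 : ContDiffOn ℝ ∞ (fun w : (Base n × Fib N) × (Base n →L[ℝ] Fib N) =>
          fderiv ℝ (c.change c') w.1) (c.overlap c' ×ˢ univ) :=
        ((c.contDiffOn_change c').fderiv_of_isOpen (c.isOpen_overlap c') (by simp)).comp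
          contDiff_fst.contDiffOn fun w hw => hw.1
      have h2 : ContDiffOn ℝ ∞ (fun w : (Base n × Fib N) × (Base n →L[ℝ] Fib N) =>
          fderiv ℝ (c'.change c) (c.change c' w.1)) (c.overlap c' ×ˢ univ) :=
        (c.contDiffOn_fderiv_back c').comp contDiff_fst.contDiffOn fun w hw => hw.1
      have h3 : ContDiffOn ℝ ∞ (fun w : (Base n × Fib N) × (Base n →L[ℝ] Fib N) =>
          (ContinuousLinearMap.id ℝ (Base n)).prod w.2) (c.overlap c' ×ˢ univ) := by
        have : (fun w : (Base n × Fib N) × (Base n →L[ℝ] Fib N) =>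
            (ContinuousLinearMap.id ℝ (Base n)).prod w.2) = fun w =>
            (ContinuousLinearMap.inl ℝ (Base n) (Fib N)) +
              (ContinuousLinearMap.inr ℝ (Base n) (Fib N)).comp w.2 := by
          funext w
          ext <;> simp
        rw [this]
        exact (contDiff_const.add (contDiff_const.clm_comp contDiff_snd)).contDiffOn
      exact contDiffOn_const.clm_comp (h1.clm_comp (h3.clm_comp
        (contDiffOn_const.clm_comp (h2.clm_comp contDiffOn_const))))
    · intro y hy hy' γ
      obtain ⟨v, rfl⟩ := (jetCoord B c y hy).symm.surjective γ
      rw [Equiv.apply_symm_apply]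
      have hch : c.change c' (c.total y) = c'.total y := by
        simp only [FiberedChart.change, c.total.left_inv hy]
      refine ContinuousLinearMap.ext fun w => ?_
      change (c'.dTotal y (c.dTotalInv y (c.dBase (B.proj y) (c'.dBaseInv (B.proj y) w),
        v (c.dBase (B.proj y) (c'.dBaseInv (B.proj y) w))))).2 =
        (fderiv ℝ (c.change c') (c.total y)
          ((fderiv ℝ (c'.change c) (c.change c' (c.total y)) (w, 0)).1,
            v (fderiv ℝ (c'.change c) (c.change c' (c.total y)) (w, 0)).1)).2
      rw [hch, ← c'.dBase_comp_dBaseInv c hy' hy, ← c.dTotal_comp_dTotalInv c' hy hy']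

theorem contDiff_semibasicOf (n N : ℕ) : ContDiff ℝ ∞
    (fun s : (ℝ × (Fin N → Fin (n + 1) → ℝ)) × (Fin (n + 1) → Base n × Fib N) =>
      semibasicOf s.1 s.2) := by
  have hv : ContDiff ℝ ∞ (fun m : Fin (n + 1) → Base n => stdVol n m) :=
    (stdVol n).toContinuousMultilinearMap.contDiff
  have h : ∀ s : (ℝ × (Fin N → Fin (n + 1) → ℝ)) × (Fin (n + 1) → Base n × Fib N),
      semibasicOf s.1 s.2 = s.1.1 * stdVol n (fun k => (s.2 k).1) +
        ∑ A, ∑ μ, s.1.2 A μ * stdVol n (fun k => replaceCoord A μ (s.2 k)) := by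
    intro s
    have h0 : ∀ A μ, dyVol A μ s.2 = stdVol n (fun k => replaceCoord A μ (s.2 k)) :=
      fun _ _ => rfl
    have h1 : stdVol n ((fun a => a.1) ∘ s.2) = stdVol n (fun k => (s.2 k).1) := rfl
    simp [semibasicOf, ContinuousAlternatingMap.sum_apply, h0, h1]
  simp only [h]
  refine ContDiff.add (ContDiff.mul (by fun_prop) (hv.comp (by fun_prop))) ?_
  refine ContDiff.sum fun A _ => ContDiff.sum fun μ _ => ContDiff.mul (by fun_prop) (hv.comp ?_)
  rw [contDiff_pi]
  intro k
  exact (replaceCoord A μ).contDiff.comp (by fun_prop)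

/-- The dual jet bundle `Z`, as a bundle over `Y`. -/
def dualJetData (B : SmoothFiberBundle n N X Y F) :
    FiberData B (ℝ × (Fin N → Fin (n + 1) → ℝ)) where
  Fiber := DualJetFiber B
  coord := dualCoord B
  exists_transition c c' := by
    refine ⟨fun w => semibasicCoeff ((semibasicOf w.2).compContinuousLinearMap
      (fderiv ℝ (c'.change c) (c.change c' w.1))), ?_, ?_⟩
    · have h2 : ContDiffOn ℝ ∞ (fun w : (Base n × Fib N) × (ℝ × (Fin N → Fin (n + 1) → ℝ)) =>
          fderiv ℝ (c'.change c) (c.change c' w.1)) (c.overlap c' ×ˢ univ) :=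
        (c.contDiffOn_fderiv_back c').comp contDiff_fst.contDiffOn fun w hw => hw.1
      have h3 : ∀ m : Fin (n + 1) → Base n × Fib N, ContDiffOn ℝ ∞
          (fun w : (Base n × Fib N) × (ℝ × (Fin N → Fin (n + 1) → ℝ)) =>
            semibasicOf w.2 (fun k => fderiv ℝ (c'.change c) (c.change c' w.1) (m k)))
          (c.overlap c' ×ˢ univ) := by
        intro m
        refine (contDiff_semibasicOf n N).comp_contDiffOn (contDiff_snd.contDiffOn.prodMk ?_)
        rw [contDiffOn_pi]
        exact fun k => h2.clm_apply contDiffOn_const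
      refine ContDiffOn.prodMk (h3 _) ?_
      rw [contDiffOn_pi]
      intro A
      rw [contDiffOn_pi]
      intro μ
      exact h3 _
    · intro y hy hy' z
      obtain ⟨q, rfl⟩ := (dualCoord B c y hy).symm.surjective z
      rw [Equiv.apply_symm_apply]
      have hch : c.change c' (c.total y) = c'.total y := by
        simp only [FiberedChart.change, c.total.left_inv hy]
      refine congrArg semibasicCoeff ?_
      ext w
      refine congrArg (semibasicOf q) (funext fun i => ?_)
      change c.dTotal y (c'.dTotalInv y (w i)) =
        fderiv ℝ (c'.change c) (c.change c' (c.total y)) (w i)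
      rw [hch, ← c'.dTotal_comp_dTotalInv c hy' hy]

/-- The first jet bundle `J¹Y`. -/
abbrev JetBundle (B : SmoothFiberBundle n N X Y F) := (jetData B).Total

/-- The dual jet bundle `Z`. -/
abbrev DualJetBundle (B : SmoothFiberBundle n N X Y F) := (dualJetData B).Total

/-- The Pontryagin bundle `M = J¹Y ×_Y Z`, as a bundle over `Y`. -/
abbrev pontryaginData (B : SmoothFiberBundle n N X Y F) :
    FiberData B ((Base n →L[ℝ] Fib N) × (ℝ × (Fin N → Fin (n + 1) → ℝ))) :=
  (jetData B).prod (dualJetData B)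

/-- The Pontryagin bundle `M = J¹Y ×_Y Z`. -/
abbrev PontryaginBundle (B : SmoothFiberBundle n N X Y F) := (pontryaginData B).Total

/-- The model space of the dual jet bundle, with the coordinates `((x, y), (p, p_A^μ))`. -/
abbrev DualJetModel (n N : ℕ) := (Base n × Fib N) × (ℝ × (Fin N → Fin (n + 1) → ℝ))

/-- The model space of the jet bundle, with the coordinates `((x, y), v)`. -/
abbrev JetModel (n N : ℕ) := (Base n × Fib N) × (Base n →L[ℝ] Fib N)

/-- The model space of the Pontryagin bundle, with the coordinates `((x, y), (v, (p, p_A^μ)))`. -/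
abbrev PontryaginModel (n N : ℕ) :=
  (Base n × Fib N) × ((Base n →L[ℝ] Fib N) × (ℝ × (Fin N → Fin (n + 1) → ℝ)))

/-! ### Differential forms on manifolds -/

/-- Differential `k`-forms on a manifold modelled on the vector space `E`. -/
abbrev DiffForm (E : Type*) [NormedAddCommGroup E] [NormedSpace ℝ E]
    (M : Type*) [TopologicalSpace M] [ChartedSpace E M] (k : ℕ) :=
  ∀ m : M, TangentSpace 𝓘(ℝ, E) m [⋀^Fin k]→L[ℝ] ℝ

namespace DiffForm

variable {E E' : Type*} [NormedAddCommGroup E] [NormedSpace ℝ E]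
  [NormedAddCommGroup E'] [NormedSpace ℝ E']
  {M M' : Type*} [TopologicalSpace M] [ChartedSpace E M]
  [TopologicalSpace M'] [ChartedSpace E' M'] {k : ℕ}

/-- The pullback `f^* α`. -/
def pullback (f : M → M') (α : DiffForm E' M' k) : DiffForm E M k := fun m =>
  (α (f m)).compContinuousLinearMap (mfderiv 𝓘(ℝ, E) 𝓘(ℝ, E') f m)

/-- The expression of a form in a chart. -/
def inChart (α : DiffForm E M k) (e : OpenPartialHomeomorph M E) (u : E) : E [⋀^Fin k]→L[ℝ] ℝ :=
  (α (e.symm u)).compContinuousLinearMap (mfderiv 𝓘(ℝ, E) 𝓘(ℝ, E) e.symm u)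

/-- Smoothness of a form: its expressions in the charts are smooth. -/
def IsSmooth (α : DiffForm E M k) : Prop :=
  ∀ m : M, ContDiffOn ℝ ∞ (α.inChart (chartAt E m)) (chartAt E m).target

/-- The exterior derivative of a form, computed at each point in a chart around that point. -/
def d (α : DiffForm E M k) : DiffForm E M (k + 1) := fun m =>
  (extDeriv (α.inChart (chartAt E m)) (chartAt E m m)).compContinuousLinearMap
    (mfderiv 𝓘(ℝ, E) 𝓘(ℝ, E) (chartAt E m) m)

/-- The contraction `V ⌟ α` of a form with a vector field. -/
def contract (V : ∀ m : M, TangentSpace 𝓘(ℝ, E) m) (α : DiffForm E M (k + 1)) : DiffForm E M k :=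
  fun m => ContinuousAlternatingMap.curryLeft (E := E) (α m) (V m)

end DiffForm

/-! ### Volume forms and integration of top degree forms -/

/-- The coefficient of `d^{n+1}x` in an `(n+1)`-form on `ℝ^{n+1}`. -/
def topCoeff {n : ℕ} (α : Base n [⋀^Fin (n + 1)]→L[ℝ] ℝ) : ℝ := α fun μ => eX μ

theorem eq_topCoeff_smul {n : ℕ} (α : Base n [⋀^Fin (n + 1)]→L[ℝ] ℝ) :
    α = topCoeff α • stdVol n := by
  apply ContinuousAlternatingMap.toAlternatingMap_injective
  have h := α.toAlternatingMap.eq_smul_basis_det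
    (EuclideanSpace.basisFun (Fin (n + 1)) ℝ).toBasis
  refine h.trans ?_
  ext w
  have h2 : (EuclideanSpace.basisFun (Fin (n + 1)) ℝ).toBasis.det w = stdVol n w := rfl
  have h3 : α (EuclideanSpace.basisFun (Fin (n + 1)) ℝ).toBasis = topCoeff α := by
    refine congrArg α (funext fun μ => ?_)
    simp
  have h4 : α (EuclideanSpace.basisFun (Fin (n + 1)) ℝ) = topCoeff α := by
    rw [← h3, OrthonormalBasis.coe_toBasis]
  simp [h2, h4]

theorem eq_div_topCoeff_smul {n : ℕ} (α β : Base n [⋀^Fin (n + 1)]→L[ℝ] ℝ) (h : topCoeff β ≠ 0) :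
    α = (topCoeff α / topCoeff β) • β := by
  have h1 : (topCoeff α / topCoeff β) • (topCoeff β • stdVol n) = topCoeff α • stdVol n := by
    rw [smul_smul, div_mul_cancel₀ _ h]
  rw [← eq_topCoeff_smul β, ← eq_topCoeff_smul α] at h1
  exact h1.symm

/-- A volume form `η` on `X`: a smooth nowhere vanishing form of top degree. It orients `X`. -/
structure VolumeForm (n : ℕ) (X : Type*) [TopologicalSpace X] [ChartedSpace (Base n) X] where
  form : DiffForm (Base n) X (n + 1)
  smooth : form.IsSmooth
  ne_zero : ∀ x, form x ≠ 0

theorem VolumeForm.topCoeff_ne_zero (η : VolumeForm n X) (x : X) :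
    topCoeff (n := n) (η.form x) ≠ 0 := fun h => η.ne_zero x (by
  have h' := eq_topCoeff_smul (n := n) (η.form x)
  rw [h, zero_smul] at h'
  exact h')

section Integration

variable [T2Space X] [SigmaCompactSpace X] [IsManifold (baseModel n) ∞ X]

/-- A smooth partition of unity on `X` subordinate to the domains of the charts. -/
def chartPartition (n : ℕ) (X : Type*) [TopologicalSpace X] [ChartedSpace (Base n) X]
    [T2Space X] [SigmaCompactSpace X] [IsManifold (baseModel n) ∞ X] :
    SmoothPartitionOfUnity X (baseModel n) X univ :=
  (SmoothPartitionOfUnity.exists_isSubordinate_chartAt_source (baseModel n) X).choose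

/-- The integral over `U ⊆ X` of a form of top degree, for the orientation of `X` given by the
volume form `η`: a partition of unity reduces it to Lebesgue integrals in the charts, which are
counted with a sign according to their orientation. -/
def integralOn (η : VolumeForm n X) (U : Set X) (α : DiffForm (Base n) X (n + 1)) : ℝ :=
  ∑ᶠ i : X, ∫ u in (chartAt (Base n) i).target ∩ (chartAt (Base n) i).symm ⁻¹' U,
    chartPartition n X i ((chartAt (Base n) i).symm u) *
      ((SignType.sign (topCoeff (η.form.inChart (chartAt (Base n) i) u)) : ℝ) *
        topCoeff (α.inChart (chartAt (Base n) i) u))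

end Integration

/-! ### The Hamilton–Pontryagin action -/

section Action

variable [IsManifold (baseModel n) ∞ X] [IsManifold (𝓡 N) ∞ F]
  {B : SmoothFiberBundle n N X Y F}

/-- The projection of the Pontryagin bundle to the jet bundle. -/
abbrev toJet (m : PontryaginBundle B) : JetBundle B := (jetData B).prodFst (dualJetData B) m

/-- The projection of the Pontryagin bundle to the dual jet bundle. -/
abbrev toDual (m : PontryaginBundle B) : DualJetBundle B := (jetData B).prodSnd (dualJetData B) m

/-- The canonical `(n+1)`-form `Θ` on the dual jet bundle `Z`. -/
def canonicalForm (B : SmoothFiberBundle n N X Y F) :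
    DiffForm (DualJetModel n N) (DualJetBundle B) (n + 1) := fun z =>
  z.val.1.compContinuousLinearMap
    (mfderiv 𝓘(ℝ, DualJetModel n N) (totalModel n N) (dualJetData B).toY z)

/-- The canonical multisymplectic form `Ω = -dΘ` on `Z`. -/
def multisymplecticForm (B : SmoothFiberBundle n N X Y F) :
    DiffForm (DualJetModel n N) (DualJetBundle B) (n + 2) :=
  -(canonicalForm B).d

/-- The form `Θ_M` on the Pontryagin bundle. -/
def thetaM (B : SmoothFiberBundle n N X Y F) :
    DiffForm (PontryaginModel n N) (PontryaginBundle B) (n + 1) :=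
  (canonicalForm B).pullback toDual

/-- The form `Ω_M` on the Pontryagin bundle. -/
def omegaM (B : SmoothFiberBundle n N X Y F) :
    DiffForm (PontryaginModel n N) (PontryaginBundle B) (n + 2) :=
  (multisymplecticForm B).pullback toDual

/-- The Lagrangian density `ℒ = L η`, with values in the `(n+1)`-forms on `X`. -/
def lagrangianDensity (η : VolumeForm n X) (L : JetBundle B → ℝ) (j : JetBundle B) :
    TangentSpace (baseModel n) (B.proj j.pt) [⋀^Fin (n + 1)]→L[ℝ] ℝ :=
  L j • η.form (B.proj j.pt)

/-- The duality pairing `⟨z, γ⟩ = γ^* z`, with values in the `(n+1)`-forms on `X`. -/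
def pairing (m : PontryaginBundle B) :
    TangentSpace (baseModel n) (B.proj m.pt) [⋀^Fin (n + 1)]→L[ℝ] ℝ :=
  m.val.2.1.compContinuousLinearMap m.val.1.1

/-- The generalized energy density `𝓔(γ, z) = ⟨z, γ⟩ - ℒ(γ)`. -/
def energyDensity (η : VolumeForm n X) (L : JetBundle B → ℝ) (m : PontryaginBundle B) :
    TangentSpace (baseModel n) (B.proj m.pt) [⋀^Fin (n + 1)]→L[ℝ] ℝ :=
  pairing m - lagrangianDensity η L (toJet m)

/-- The generalized energy `E`, the function with `𝓔 = E η`. -/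
def generalizedEnergy (η : VolumeForm n X) (L : JetBundle B → ℝ) (m : PontryaginBundle B) : ℝ :=
  topCoeff (n := n) (energyDensity η L m) / topCoeff (n := n) (η.form (B.proj m.pt))

theorem energyDensity_eq (η : VolumeForm n X) (L : JetBundle B → ℝ) (m : PontryaginBundle B) :
    energyDensity η L m = generalizedEnergy η L m • η.form (B.proj m.pt) :=
  eq_div_topCoeff_smul (n := n) _ _ (η.topCoeff_ne_zero _)

/-- The generalized energy density as an `(n+1)`-form on the Pontryagin bundle. -/
def energyForm (η : VolumeForm n X) (L : JetBundle B → ℝ) :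
    DiffForm (PontryaginModel n N) (PontryaginBundle B) (n + 1) := fun m =>
  (energyDensity η L m).compContinuousLinearMap
    (mfderiv 𝓘(ℝ, PontryaginModel n N) (baseModel n) (pontryaginData B).toX m)

/-- The form `Ω_𝓔 = Ω_M + d𝓔`. -/
def omegaE (η : VolumeForm n X) (L : JetBundle B → ℝ) :
    DiffForm (PontryaginModel n N) (PontryaginBundle B) (n + 2) :=
  omegaM B + (energyForm η L).d

/-- Smooth sections of `M → X`. -/
def IsSection (ψ : X → PontryaginBundle B) : Prop :=
  ContMDiff (baseModel n) 𝓘(ℝ, PontryaginModel n N) ∞ ψ ∧ ∀ x, (pontryaginData B).toX (ψ x) = x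

/-- `Ψ` is a vertical variation of `ψ` with support in the compact set `U`: a smooth one-parameter
family of sections, defined for small values of the parameter, which starts at `ψ` and agrees with
`ψ` outside `U`. -/
def IsVerticalVariation (ψ : X → PontryaginBundle B) (U : Set X)
    (Ψ : ℝ → X → PontryaginBundle B) : Prop :=
  IsCompact U ∧ Ψ 0 = ψ ∧ ∃ ε > 0,
    ContMDiffOn (𝓘(ℝ, ℝ).prod (baseModel n)) 𝓘(ℝ, PontryaginModel n N) ∞
      (fun s : ℝ × X => Ψ s.1 s.2) (Ioo (-ε) ε ×ˢ univ) ∧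
    ∀ t ∈ Ioo (-ε) ε, (∀ x, (pontryaginData B).toX (Ψ t x) = x) ∧ ∀ x ∉ U, Ψ t x = ψ x

/-- The Hamilton–Pontryagin action `∫_U ψ^*(Θ_M - 𝓔)` over a subset `U` of `X`. -/
def action [T2Space X] [SigmaCompactSpace X] (η : VolumeForm n X) (L : JetBundle B → ℝ)
    (U : Set X) (ψ : X → PontryaginBundle B) : ℝ :=
  integralOn η U ((thetaM B - energyForm η L).pullback ψ)

/-- `ψ` is a critical point of the Hamilton–Pontryagin action: the derivative of the action along
each vertical variation exists and is zero. -/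
def IsCriticalPoint [T2Space X] [SigmaCompactSpace X] (η : VolumeForm n X) (L : JetBundle B → ℝ)
    (ψ : X → PontryaginBundle B) : Prop :=
  ∀ U Ψ, IsVerticalVariation ψ U Ψ → HasDerivAt (fun t => action η L U (Ψ t)) 0 0

/-- Smooth vector fields on `M` which are vertical for `M → X`. -/
def IsVerticalField (V : ∀ m : PontryaginBundle B, TangentSpace 𝓘(ℝ, PontryaginModel n N) m) :
    Prop :=
  ContMDiff 𝓘(ℝ, PontryaginModel n N) 𝓘(ℝ, PontryaginModel n N).tangent ∞
    (fun m => (⟨m, V m⟩ : TangentBundle 𝓘(ℝ, PontryaginModel n N) (PontryaginBundle B))) ∧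
  ∀ m, mfderiv 𝓘(ℝ, PontryaginModel n N) (baseModel n) (pontryaginData B).toX m (V m) = 0

/-! ### The local equations -/

/-- The set of coordinates `u = (x^μ)` at which `ψ` takes values in a fibred chart. -/
def localDomain (c : FiberedChart B) (ψ : X → PontryaginBundle B) : Set (Base n) :=
  {u | u ∈ c.base.target ∧ (ψ (c.base.symm u)).pt ∈ c.total.source}

/-- The coordinates `((x, y), (v, (p, p_A^μ)))` of `ψ` as functions of `u = (x^μ)`. -/
def localRep (c : FiberedChart B) (ψ : X → PontryaginBundle B) (u : Base n) :
    PontryaginModel n N :=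
  (pontryaginData B).homeoOf c (ψ (c.base.symm u))

/-- The component `y^A` of `ψ`. -/
def localY (c : FiberedChart B) (ψ : X → PontryaginBundle B) (A : Fin N) (u : Base n) : ℝ :=
  (localRep c ψ u).1.2 A

/-- The component `v^A_μ` of `ψ`. -/
def localV (c : FiberedChart B) (ψ : X → PontryaginBundle B) (A : Fin N) (μ : Fin (n + 1))
    (u : Base n) : ℝ :=
  (localRep c ψ u).2.1 (eX μ) A

/-- The component `p` of `ψ`. -/
def localP (c : FiberedChart B) (ψ : X → PontryaginBundle B) (u : Base n) : ℝ :=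
  (localRep c ψ u).2.2.1

/-- The component `p_A^μ` of `ψ`. -/
def localMomentum (c : FiberedChart B) (ψ : X → PontryaginBundle B) (A : Fin N)
    (μ : Fin (n + 1)) (u : Base n) : ℝ :=
  (localRep c ψ u).2.2.2 A μ

/-- The local Lagrangian function `L(x, y, v)`: the coefficient of `ℒ` with respect to `d^{n+1}x`.
It is the function `L` itself if `η = d^{n+1}x` in the chart. -/
def localLagrangian (c : FiberedChart B) (η : VolumeForm n X) (L : JetBundle B → ℝ)
    (w : JetModel n N) : ℝ :=
  topCoeff ((lagrangianDensity η L (((jetData B).homeoOf c).symm w)).compContinuousLinearMap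
    (c.dBaseInv (B.proj (((jetData B).homeoOf c).symm w).pt)))

/-- The point `(x, y, v)` of the jet bundle underlying `ψ`, in coordinates. -/
def localJet (c : FiberedChart B) (ψ : X → PontryaginBundle B) (u : Base n) : JetModel n N :=
  ((localRep c ψ u).1, (localRep c ψ u).2.1)

/-- The partial derivative `∂L/∂y^A` of a function of `(x, y, v)`. -/
def partialY (L : JetModel n N → ℝ) (A : Fin N) (w : JetModel n N) : ℝ :=
  fderiv ℝ L w ((0, eF A), 0)

/-- The partial derivative `∂L/∂v^A_μ` of a function of `(x, y, v)`. -/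
def partialV (L : JetModel n N → ℝ) (A : Fin N) (μ : Fin (n + 1)) (w : JetModel n N) : ℝ :=
  fderiv ℝ L w (0, (EuclideanSpace.proj (𝕜 := ℝ) μ).smulRight (eF A))

/-- The implicit Euler–Lagrange equations in a fibred chart:
`∂y^A/∂x^μ = v^A_μ`, `∂p_A^μ/∂x^μ = ∂L/∂y^A`, `p_A^μ = ∂L/∂v^A_μ`. -/
def ImplicitEulerLagrange (c : FiberedChart B) (η : VolumeForm n X) (L : JetBundle B → ℝ)
    (ψ : X → PontryaginBundle B) : Prop :=
  ∀ u ∈ localDomain c ψ,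
    (∀ A μ, fderiv ℝ (localY c ψ A) u (eX μ) = localV c ψ A μ u) ∧
    (∀ A, ∑ μ, fderiv ℝ (localMomentum c ψ A μ) u (eX μ) =
      partialY (localLagrangian c η L) A (localJet c ψ u)) ∧
    (∀ A μ, localMomentum c ψ A μ u = partialV (localLagrangian c η L) A μ (localJet c ψ u))

/-- The covariant Legendre transformation in a fibred chart:
`p_A^μ = ∂L/∂v^A_μ`, `p = L - (∂L/∂v^A_μ) v^A_μ`. -/
def CovariantLegendre (c : FiberedChart B) (η : VolumeForm n X) (L : JetBundle B → ℝ)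
    (ψ : X → PontryaginBundle B) : Prop :=
  ∀ u ∈ localDomain c ψ,
    (∀ A μ, localMomentum c ψ A μ u = partialV (localLagrangian c η L) A μ (localJet c ψ u)) ∧
    localP c ψ u = localLagrangian c η L (localJet c ψ u) -
      ∑ A, ∑ μ, partialV (localLagrangian c η L) A μ (localJet c ψ u) * localV c ψ A μ u

end Action

end HamiltonPontryagin

end

open HamiltonPontryagin

/-!
The theorem rests on one computation in fibred coordinates. Along a section the form
`ψ^*(Θ_M - 𝓔)` has the coefficient `p_A^μ (∂_μ y^A - v^A_μ) + L(x, y, v)` (`density_section`), in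
which `p` does not occur, and `ψ^*(V ⌟ Ω_𝓔)` has as coefficient an expression which is linear in
the vertical vector `V` (`modelEulerLagrange`, `topCoeff_pullback_contract`). The components of
this expression are the three groups of implicit Euler–Lagrange equations, and the equation for `p`
says that the energy vanishes along `ψ`. So in a given chart the equations hold if and only if
`modelEulerLagrange` vanishes on all vertical vectors (`weakEulerLagrange_iff`). A vertical vector
at a point extends to a global vertical vector field by a bump function on `Y`
(`exists_verticalField`), which gives the equivalence of the equations with the vanishing of
`ψ^*(V ⌟ Ω_𝓔)`.

For the action, the first variation formula (`hasDerivAt_modelDensity`) says that the derivative of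
the coefficient along a family of sections is `-modelEulerLagrange`, in the direction of the
infinitesimal variation `δ`, plus the divergence of the flux `p_A^μ δy^A`. Integrals are taken with
respect to the measure of the volume form (`integralDensity`), where differentiation under the
integral is allowed and where the integral of a function supported in a chart can be computed in
that chart. If a family is constant outside a compact subset of a chart, the divergence integrates
to zero, and only the Euler–Lagrange term remains (`IsSmoothFamily.integralDensity_firstVariation`).

A critical point satisfies the equations in each chart by the fundamental lemma of the calculus of
variations, applied to a variation which adds `t χ v` to the coordinates
(`weakEulerLagrange_of_isCriticalPoint`). Conversely, let the equations hold in a chart around each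
point. The fibres have no linear structure, so a variation `Ψ` cannot be multiplied by a partition
of unity `χ_j`; it is replaced by `(t, x) ↦ Ψ_{t χ_j(x)}(x)`, whose infinitesimal variation is
`χ_j δ`. The first variation of the density along `Ψ` is the sum of those along the localized
families, each of which integrates to zero (`isCriticalPoint_of_weakEulerLagrange`).
-/

open Set Topology
open scoped Manifold ContDiff

set_option linter.unusedSectionVars false

noncomputable section

namespace HamiltonPontryagin

variable {n N : ℕ} {X Y F : Type*}
  [TopologicalSpace X] [ChartedSpace (Base n) X]
  [TopologicalSpace Y] [ChartedSpace (ModelProd (Base n) (Fib N)) Y]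
  [TopologicalSpace F] [ChartedSpace (Fib N) F]

/-! ### Induced charts of bundles over `Y` -/

namespace FiberData

variable {B : SmoothFiberBundle n N X Y F} {V : Type}
  [NormedAddCommGroup V] [NormedSpace ℝ V]
  [IsManifold (baseModel n) ∞ X] [IsManifold (𝓡 N) ∞ F]

theorem homeoOf_snd (D : FiberData B V) (c : FiberedChart B) {m : D.Total}
    (h : m.pt ∈ c.total.source) : (D.homeoOf c m).2 = D.coord c m.pt h m.val :=
  dif_pos h

theorem homeoOf_symm_pt (D : FiberData B V) (c : FiberedChart B) (w : (Base n × Fib N) × V) :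
    ((D.homeoOf c).symm w).pt = c.total.symm w.1 := rfl

theorem homeoOf_mem_maximalAtlas (D : FiberData B V) (c : FiberedChart B) :
    D.homeoOf c ∈ IsManifold.maximalAtlas 𝓘(ℝ, (Base n × Fib N) × V) ∞ D.Total :=
  IsManifold.subset_maximalAtlas (Set.mem_iUnion₂.2 ⟨D.chartOf c, ⟨c, rfl⟩, rfl⟩)

theorem contMDiffOn_homeoOf (D : FiberData B V) (c : FiberedChart B) :
    ContMDiffOn 𝓘(ℝ, (Base n × Fib N) × V) 𝓘(ℝ, (Base n × Fib N) × V) ∞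
      (D.homeoOf c) (D.homeoOf c).source :=
  contMDiffOn_of_mem_maximalAtlas (D.homeoOf_mem_maximalAtlas c)

theorem contMDiffOn_homeoOf_symm (D : FiberData B V) (c : FiberedChart B) :
    ContMDiffOn 𝓘(ℝ, (Base n × Fib N) × V) 𝓘(ℝ, (Base n × Fib N) × V) ∞
      (D.homeoOf c).symm (D.homeoOf c).target :=
  contMDiffOn_symm_of_mem_maximalAtlas (D.homeoOf_mem_maximalAtlas c)

theorem mdiff_homeoOf (D : FiberData B V) (c : FiberedChart B) :
    (D.homeoOf c).MDifferentiable 𝓘(ℝ, (Base n × Fib N) × V) 𝓘(ℝ, (Base n × Fib N) × V) :=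
  ⟨(D.contMDiffOn_homeoOf c).mdifferentiableOn (by simp),
    (D.contMDiffOn_homeoOf_symm c).mdifferentiableOn (by simp)⟩

theorem contMDiff_toY (D : FiberData B V) :
    ContMDiff 𝓘(ℝ, (Base n × Fib N) × V) (totalModel n N) ∞ D.toY := by
  intro m
  have hm := B.mem_chart m.pt
  set c := B.chart m.pt
  have h1 : ContMDiffAt 𝓘(ℝ, (Base n × Fib N) × V) 𝓘(ℝ, (Base n × Fib N) × V) ∞
      (D.homeoOf c) m :=
    (D.contMDiffOn_homeoOf c).contMDiffAt ((D.homeoOf c).open_source.mem_nhds hm)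
  have h2 : ContMDiffAt 𝓘(ℝ, (Base n × Fib N) × V) 𝓘(ℝ, Base n × Fib N) ∞
      (fun m => (D.homeoOf c m).1) m :=
    (contDiff_fst.contMDiff.contMDiffAt).comp m h1
  have h3 : ContMDiffAt 𝓘(ℝ, Base n × Fib N) (totalModel n N) ∞ c.total.symm
      (D.homeoOf c m).1 :=
    c.smooth_total_symm.contMDiffAt (c.total.open_target.mem_nhds (c.total.map_source hm))
  refine (h3.comp m h2).congr_of_eventuallyEq ?_
  filter_upwards [(D.homeoOf c).open_source.mem_nhds hm] with m' hm'
  exact (c.total.left_inv hm').symm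

theorem continuous_toY (D : FiberData B V) : Continuous D.toY := D.contMDiff_toY.continuous

end FiberData

theorem SmoothFiberBundle.contMDiff_proj [IsManifold (baseModel n) ∞ X] [IsManifold (𝓡 N) ∞ F]
    (B : SmoothFiberBundle n N X Y F) : ContMDiff (totalModel n N) (baseModel n) ∞ B.proj := by
  intro y
  have hy := B.mem_chart y
  set c := B.chart y
  have h1 : ContMDiffAt (totalModel n N) 𝓘(ℝ, Base n × Fib N) ∞ c.total y :=
    c.smooth_total.contMDiffAt (c.total.open_source.mem_nhds hy)
  have h2 : ContMDiffAt (totalModel n N) 𝓘(ℝ, Base n) ∞ (fun y => (c.total y).1) y :=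
    (contDiff_fst.contMDiff.contMDiffAt).comp y h1
  have h3 : ContMDiffAt 𝓘(ℝ, Base n) (baseModel n) ∞ c.base.symm (c.total y).1 := by
    rw [c.fst_total y hy]
    exact c.smooth_base_symm.contMDiffAt
      (c.base.open_target.mem_nhds (c.base.map_source (c.proj_mem y hy)))
  exact (h3.comp y h2).congr_of_eventuallyEq (c.proj_eventuallyEq hy)

section Pontryagin

variable [IsManifold (baseModel n) ∞ X] [IsManifold (𝓡 N) ∞ F]
  {B : SmoothFiberBundle n N X Y F}

theorem homeoOf_toDual (c : FiberedChart B) {m : PontryaginBundle B}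
    (h : m.pt ∈ c.total.source) : (dualJetData B).homeoOf c (toDual m) =
      (((pontryaginData B).homeoOf c m).1, ((pontryaginData B).homeoOf c m).2.2) := by
  refine Prod.ext rfl ?_
  rw [FiberData.homeoOf_snd _ c h, FiberData.homeoOf_snd _ c (m := toDual m) h]
  rfl

theorem homeoOf_toJet (c : FiberedChart B) {m : PontryaginBundle B}
    (h : m.pt ∈ c.total.source) : (jetData B).homeoOf c (toJet m) =
      (((pontryaginData B).homeoOf c m).1, ((pontryaginData B).homeoOf c m).2.1) := by
  refine Prod.ext rfl ?_
  rw [FiberData.homeoOf_snd _ c h, FiberData.homeoOf_snd _ c (m := toJet m) h]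
  rfl

theorem contMDiff_toDual : ContMDiff 𝓘(ℝ, PontryaginModel n N) 𝓘(ℝ, DualJetModel n N) ∞
    (toDual : PontryaginBundle B → DualJetBundle B) := by
  intro m
  have hm := B.mem_chart m.pt
  set c := B.chart m.pt
  have h1 : ContMDiffAt 𝓘(ℝ, PontryaginModel n N) 𝓘(ℝ, PontryaginModel n N) ∞
      ((pontryaginData B).homeoOf c) m :=
    ((pontryaginData B).contMDiffOn_homeoOf c).contMDiffAt
      (((pontryaginData B).homeoOf c).open_source.mem_nhds hm)
  have h2 : ContMDiffAt 𝓘(ℝ, PontryaginModel n N) 𝓘(ℝ, DualJetModel n N) ∞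
      (fun m => (((pontryaginData B).homeoOf c m).1, ((pontryaginData B).homeoOf c m).2.2)) m :=
    ((ContDiff.contMDiff (f := fun w : PontryaginModel n N => (w.1, w.2.2))
      (by fun_prop)).contMDiffAt).comp m h1
  have h3 : ContMDiffAt 𝓘(ℝ, DualJetModel n N) 𝓘(ℝ, DualJetModel n N) ∞
      ((dualJetData B).homeoOf c).symm
      (((pontryaginData B).homeoOf c m).1, ((pontryaginData B).homeoOf c m).2.2) :=
    ((dualJetData B).contMDiffOn_homeoOf_symm c).contMDiffAt
      (((dualJetData B).homeoOf c).open_target.mem_nhds ⟨c.total.map_source hm, mem_univ _⟩)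
  refine (h3.comp m h2).congr_of_eventuallyEq ?_
  filter_upwards [((pontryaginData B).homeoOf c).open_source.mem_nhds hm] with m' hm'
  refine (((dualJetData B).homeoOf c).left_inv (x := toDual m') hm').symm.trans ?_
  rw [homeoOf_toDual c hm']
  rfl

/-- In fibred coordinates, the dual jet component of a point of the Pontryagin bundle is the form
`p d^{n+1}x + p_A^μ dy^A ∧ (∂_μ ⌟ d^{n+1}x)`. -/
theorem dual_val_eq (c : FiberedChart B) {z : DualJetBundle B} (h : z.pt ∈ c.total.source) :
    z.val.1 = (semibasicOf ((dualJetData B).homeoOf c z).2).compContinuousLinearMap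
      (c.dTotal z.pt) := by
  rw [FiberData.homeoOf_snd _ c h]
  exact congrArg Subtype.val (((dualCoord B c z.pt h).left_inv z.val).symm)

/-- In fibred coordinates, a jet is the linear map `∂_μ ↦ ∂_μ + v^A_μ ∂_A`. -/
theorem jet_val_eq (c : FiberedChart B) {j : JetBundle B} (h : j.pt ∈ c.total.source) :
    j.val.1 = (c.dTotalInv j.pt).comp (((ContinuousLinearMap.id ℝ (Base n)).prod
      ((jetData B).homeoOf c j).2).comp (c.dBase (B.proj j.pt))) := by
  rw [FiberData.homeoOf_snd _ c h]
  exact congrArg Subtype.val (((jetCoord B c j.pt h).left_inv j.val).symm)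

end Pontryagin

/-! ### Semibasic forms on graphs and the exterior derivatives of the model forms -/

theorem stdVol_add_smul {n : ℕ} (μ : Fin (n + 1)) (a : Fin (n + 1) → ℝ) :
    stdVol n (fun ν => eX ν + a ν • eX μ) = 1 + a μ := by
  have h := Matrix.det_one_add_replicateCol_mul_replicateRow (ι := Unit)
    (Pi.single μ (1 : ℝ)) a
  rw [dotProduct_single_one] at h
  rw [stdVol_apply, ← h]
  congr 1
  ext i j
  simp [Matrix.one_apply, Matrix.mul_apply, Pi.single_apply, eq_comm]

theorem dyVol_graph {n N : ℕ} (A : Fin N) (μ : Fin (n + 1)) (Y : Fin (n + 1) → Fib N) :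
    dyVol A μ (fun ν => (eX ν, Y ν)) = Y μ A := by
  have h := stdVol_add_smul (n := n) μ (fun ν => Y ν A - (eX ν : Base n) μ)
  change stdVol n (fun ν => replaceCoord A μ (eX ν, Y ν)) = _
  simp only [replaceCoord_apply]
  rw [h]
  simp

theorem dyVol_update_graph {n N : ℕ} (A : Fin N) (μ κ : Fin (n + 1)) (Y : Fin (n + 1) → Fib N)
    (y : Fib N) :
    dyVol A κ (Function.update (fun ν => (eX ν, Y ν)) μ (0, y)) = if κ = μ then y A else 0 := by
  change stdVol n (fun ν => replaceCoord A κ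
    (Function.update (fun ν => ((eX ν, Y ν) : Base n × Fib N)) μ (0, y) ν)) = _
  split_ifs with h
  · subst h
    have h := stdVol_add_smul (n := n) κ
      (Function.update (fun ν => Y ν A - (eX ν : Base n) κ) κ (y A - 1))
    rw [Function.update_self, add_sub_cancel] at h
    rw [← h]
    congr 1
    funext ν
    by_cases hν : ν = κ
    · subst hν
      simp [replaceCoord_apply, sub_smul]
    · simp [replaceCoord_apply, hν, Ne.symm hν]
  · refine stdVol_eq_zero_of_smul _ h (eX κ) (Y κ A) (y A) ?_ ?_
    · rw [Function.update_of_ne h]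
      simp [replaceCoord_apply, sub_smul]
    · simp [replaceCoord_apply]

theorem semibasicOf_apply {n N : ℕ} (q : ℝ × (Fin N → Fin (n + 1) → ℝ))
    (w : Fin (n + 1) → Base n × Fib N) :
    semibasicOf q w = q.1 * stdVol n (fun k => (w k).1) + ∑ A, ∑ μ, q.2 A μ * dyVol A μ w := by
  have h1 : stdVol n ((fun a => a.1) ∘ w) = stdVol n (fun k => (w k).1) := rfl
  simp [semibasicOf, ContinuousAlternatingMap.sum_apply, h1]

/-- The value of `p d^{n+1}x + p_A^μ dy^A ∧ (∂_μ ⌟ d^{n+1}x)` on the graph of a linear map. -/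
theorem semibasicOf_graph {n N : ℕ} (q : ℝ × (Fin N → Fin (n + 1) → ℝ))
    (Y : Fin (n + 1) → Fib N) :
    semibasicOf q (fun ν => (eX ν, Y ν)) = q.1 + ∑ A, ∑ μ, q.2 A μ * Y μ A := by
  rw [semibasicOf_apply, stdVol_eX]
  simp [dyVol_graph]

theorem semibasicOf_update_graph {n N : ℕ} (q : ℝ × (Fin N → Fin (n + 1) → ℝ))
    (Y : Fin (n + 1) → Fib N) (μ : Fin (n + 1)) (y : Fib N) :
    semibasicOf q (Function.update (fun ν => (eX ν, Y ν)) μ (0, y)) = ∑ A, q.2 A μ * y A := by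
  have h : stdVol n (fun k =>
      (Function.update (fun ν => ((eX ν, Y ν) : Base n × Fib N)) μ (0, y) k).1) = 0 :=
    (stdVol n).map_coord_zero μ (by simp)
  rw [semibasicOf_apply, h]
  simp [dyVol_update_graph]

/-- The canonical form on the model space of the dual jet bundle, as a linear function of the
coordinates `(p, p_A^μ)`. -/
def modelCanonicalForm (n N : ℕ) :
    DualJetModel n N →L[ℝ] (DualJetModel n N [⋀^Fin (n + 1)]→L[ℝ] ℝ) :=
  (LinearMap.toContinuousLinearMap (𝕜 := ℝ)
    { toFun := fun q : ℝ × (Fin N → Fin (n + 1) → ℝ) =>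
        (semibasicOf q).compContinuousLinearMap
          (ContinuousLinearMap.fst ℝ (Base n × Fib N) (ℝ × (Fin N → Fin (n + 1) → ℝ)))
      map_add' := fun q q' => by
        ext w
        change semibasicOf (q + q') (fun k => (w k).1) =
          semibasicOf q (fun k => (w k).1) + semibasicOf q' (fun k => (w k).1)
        simp only [semibasicOf_apply, Prod.fst_add, Prod.snd_add, Pi.add_apply, add_mul,
          Finset.sum_add_distrib]
        ring
      map_smul' := fun a q => by
        ext w
        change semibasicOf (a • q) (fun k => (w k).1) = a * semibasicOf q (fun k => (w k).1)
        simp only [semibasicOf_apply, Prod.smul_fst, Prod.smul_snd, Pi.smul_apply, smul_eq_mul,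
          mul_add, Finset.mul_sum, mul_assoc] }).comp (ContinuousLinearMap.snd ℝ _ _)

theorem modelCanonicalForm_apply {n N : ℕ} (u : DualJetModel n N)
    (w : Fin (n + 1) → DualJetModel n N) :
    modelCanonicalForm n N u w = semibasicOf u.2 (fun k => (w k).1) := rfl

/-- The exterior derivative of the canonical form on a vertical vector followed by the coordinate
frame of a section. The vertical vector is moved past the `μ` vectors in front of its slot, so
that the alternating signs cancel. -/
theorem extDeriv_modelCanonicalForm {n N : ℕ} (b v : DualJetModel n N)
    (w : Fin (n + 1) → DualJetModel n N) (Y : Fin (n + 1) → Fib N) (y : Fib N)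
    (hv : v.1 = (0, y)) (hw : ∀ ν, (w ν).1 = (eX ν, Y ν)) :
    extDeriv (fun u => modelCanonicalForm n N u) b (Fin.cons v w) =
      v.2.1 + ∑ A, ∑ μ, v.2.2 A μ * Y μ A - ∑ A, ∑ μ, (w μ).2.2 A μ * y A := by
  rw [extDeriv_apply (modelCanonicalForm n N).differentiableAt, Fin.sum_univ_succ]
  have hd : ∀ (m : Fin (n + 1) → DualJetModel n N) (x : DualJetModel n N),
      fderiv ℝ (fun u => modelCanonicalForm n N u m) b x = modelCanonicalForm n N x m := by
    intro m x
    rw [fderiv_continuousAlternatingMap_apply_const_apply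
      (modelCanonicalForm n N).differentiableAt, ContinuousLinearMap.fderiv]
  have h0 : (Fin.removeNth 0 (Fin.cons v w : Fin (n + 2) → DualJetModel n N)) = w := by
    funext k
    simp [Fin.removeNth]
  have h1 : ∀ μ : Fin (n + 1),
      (-1 : ℤ) ^ ((μ.succ : Fin (n + 2)) : ℕ) • modelCanonicalForm n N (w μ)
        (Fin.removeNth μ.succ (Fin.cons v w : Fin (n + 2) → DualJetModel n N)) =
      - ∑ A, (w μ).2.2 A μ * y A := by
    intro μ
    have e1 : (Fin.removeNth μ.succ (Fin.cons v w : Fin (n + 2) → DualJetModel n N)) =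
        Matrix.vecCons v (Fin.removeNth μ w) := by
      funext k
      refine Fin.cases ?_ (fun j => ?_) k
      · simp [Fin.removeNth]
      · simp [Fin.removeNth, Fin.succ_succAbove_succ]
    have e2 : (-1 : ℝ) ^ (μ : ℕ) * modelCanonicalForm n N (w μ) (Function.update w μ v) =
        modelCanonicalForm n N (w μ) (Matrix.vecCons v (Fin.removeNth μ w)) := by
      have h := AlternatingMap.neg_one_pow_smul_map_insertNth
        (modelCanonicalForm n N (w μ)).toAlternatingMap μ v (Fin.removeNth μ w)
      rw [Fin.insertNth_removeNth] at h
      simpa using h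
    have e3 : modelCanonicalForm n N (w μ) (Function.update w μ v) = ∑ A, (w μ).2.2 A μ * y A := by
      rw [modelCanonicalForm_apply, ← semibasicOf_update_graph (w μ).2 Y μ y]
      congr 1
      funext k
      by_cases hk : k = μ
      · subst hk; simp [hv]
      · simp [hk, hw]
    rw [← e3, e1, Fin.val_succ, pow_succ, mul_neg_one, neg_smul]
    refine congrArg Neg.neg ?_
    rw [← e2, zsmul_eq_mul, Int.cast_pow, Int.cast_neg, Int.cast_one, ← mul_assoc, ← pow_add,
      Even.neg_one_pow ⟨_, rfl⟩, one_mul]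
  simp only [hd, Fin.cons_zero, Fin.cons_succ, h0]
  rw [Finset.sum_congr rfl fun μ _ => h1 μ]
  rw [modelCanonicalForm_apply]
  simp only [hw]
  rw [semibasicOf_graph, Finset.sum_comm (f := fun A μ => (w μ).2.2 A μ * y A)]
  simp [sub_eq_add_neg]

theorem differentiableAt_smul_stdVol {n : ℕ} {E : Type*} [NormedAddCommGroup E] [NormedSpace ℝ E]
    (π : E →L[ℝ] Base n) {e : E → ℝ} {b : E} (he : DifferentiableAt ℝ e b) :
    DifferentiableAt ℝ (fun u => e u • (stdVol n).compContinuousLinearMap π) b :=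
  he.smul_const _

/-- The exterior derivative of `e π^*d^{n+1}x`, for a linear projection `π`, on a vertical vector
followed by a frame which lifts the coordinate frame of the base. -/
theorem extDeriv_smul_stdVol {n : ℕ} {E : Type*} [NormedAddCommGroup E] [NormedSpace ℝ E]
    (π : E →L[ℝ] Base n) {e : E → ℝ} (b v : E) (he : DifferentiableAt ℝ e b)
    (w : Fin (n + 1) → E) (hv : π v = 0) (hw : ∀ ν, π (w ν) = eX ν) :
    extDeriv (fun u => e u • (stdVol n).compContinuousLinearMap π) b (Fin.cons v w) =
      fderiv ℝ e b v := by
  have hD : DifferentiableAt ℝ (fun u => e u • (stdVol n).compContinuousLinearMap π) b :=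
    differentiableAt_smul_stdVol π he
  rw [extDeriv_apply hD, Fin.sum_univ_succ]
  have hd : ∀ (m : Fin (n + 1) → E) (x : E),
      fderiv ℝ (fun u => (e u • (stdVol n).compContinuousLinearMap π) m) b x =
        fderiv ℝ e b x * stdVol n (fun k => π (m k)) := by
    intro m x
    change fderiv ℝ (fun u => e u * stdVol n (fun k => π (m k))) b x = _
    rw [fderiv_mul_const he]
    simp [mul_comm]
  have h0 : (Fin.removeNth 0 (Fin.cons v w : Fin (n + 2) → E)) = w := by
    funext k
    simp [Fin.removeNth]
  have h1 : ∀ μ : Fin (n + 1), stdVol n (fun k =>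
      π (Fin.removeNth μ.succ (Fin.cons v w : Fin (n + 2) → E) k)) = 0 := by
    intro μ
    refine (stdVol n).map_coord_zero 0 ?_
    change π ((Fin.cons v w : Fin (n + 2) → E) (Fin.succAbove μ.succ 0)) = 0
    rw [Fin.succ_succAbove_zero, Fin.cons_zero, hv]
  simp only [hd, Fin.cons_zero, h0, h1, hw, stdVol_eX]
  simp

/-! ### Densities of top degree forms -/

/-- The coefficient of `d^{n+1}x` in the volume form, in the coordinates of a chart. -/
def volCoeff (η : VolumeForm n X) (e : OpenPartialHomeomorph X (Base n)) (u : Base n) : ℝ :=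
  topCoeff (η.form.inChart e u)

/-- The density of a top degree form with respect to the volume form. -/
def density (η : VolumeForm n X) (α : DiffForm (Base n) X (n + 1)) (x : X) : ℝ :=
  topCoeff (n := n) (α x) / topCoeff (n := n) (η.form x)

theorem density_smul (η : VolumeForm n X) (α : DiffForm (Base n) X (n + 1)) (x : X) :
    α x = density η α x • η.form x :=
  eq_div_topCoeff_smul (n := n) _ _ (η.topCoeff_ne_zero _)

theorem topCoeff_inChart (η : VolumeForm n X) (α : DiffForm (Base n) X (n + 1))
    (e : OpenPartialHomeomorph X (Base n)) (u : Base n) :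
    topCoeff (α.inChart e u) = density η α (e.symm u) * volCoeff η e u := by
  rw [volCoeff, DiffForm.inChart, density_smul η α]
  rfl

theorem topCoeff_inChart_apply (α : DiffForm (Base n) X (n + 1))
    (e : OpenPartialHomeomorph X (Base n)) {x : X} (hx : x ∈ e.source) :
    topCoeff (α.inChart e (e x)) = topCoeff (n := n) ((α x).compContinuousLinearMap
      (mfderiv 𝓘(ℝ, Base n) 𝓘(ℝ, Base n) e.symm (e x) : Base n →L[ℝ] Base n)) := by
  -- all tangent spaces are the model space, so that `α` can be rewritten as a nondependent function
  let α' : X → Base n [⋀^Fin (n + 1)]→L[ℝ] ℝ := α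
  exact congrArg (fun β : Base n [⋀^Fin (n + 1)]→L[ℝ] ℝ =>
    topCoeff (β.compContinuousLinearMap
      (mfderiv 𝓘(ℝ, Base n) 𝓘(ℝ, Base n) e.symm (e x) : Base n →L[ℝ] Base n)))
    (congrArg α' (e.left_inv hx))

theorem topCoeff_comp {n : ℕ} (β : Base n [⋀^Fin (n + 1)]→L[ℝ] ℝ) (A : Base n →L[ℝ] Base n) :
    topCoeff (β.compContinuousLinearMap A) = topCoeff β * A.det := by
  conv_lhs => rw [eq_topCoeff_smul β]
  change topCoeff β * stdVol n (A ∘ fun μ => eX μ) = _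
  have h : stdVol n (A ∘ fun μ => eX μ) = LinearMap.det (A : Base n →ₗ[ℝ] Base n) *
      stdVol n (fun μ => eX μ) :=
    Module.Basis.det_comp (EuclideanSpace.basisFun (Fin (n + 1)) ℝ).toBasis
      (A : Base n →ₗ[ℝ] Base n) (fun μ => eX μ)
  rw [h, stdVol_eX, mul_one]

theorem topCoeff_comp_ne_zero {n : ℕ} {β : Base n [⋀^Fin (n + 1)]→L[ℝ] ℝ} (hβ : topCoeff β ≠ 0)
    {A A' : Base n →L[ℝ] Base n} (h : ∀ v, A' (A v) = v) :
    topCoeff (β.compContinuousLinearMap A) ≠ 0 := by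
  rw [topCoeff_comp]
  refine mul_ne_zero hβ ?_
  have h1 : (A' : Base n →ₗ[ℝ] Base n) ∘ₗ (A : Base n →ₗ[ℝ] Base n) = LinearMap.id :=
    LinearMap.ext h
  have h2 := congrArg LinearMap.det h1
  rw [LinearMap.det_comp, LinearMap.det_id] at h2
  exact right_ne_zero_of_mul_eq_one h2

/-- A chart of `X` which need not belong to the given atlas, but is smooth in both directions. -/
structure IsSmoothChart (e : OpenPartialHomeomorph X (Base n)) : Prop where
  smooth : ContMDiffOn (baseModel n) 𝓘(ℝ, Base n) ∞ e e.source
  smooth_symm : ContMDiffOn 𝓘(ℝ, Base n) (baseModel n) ∞ e.symm e.target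

namespace IsSmoothChart

theorem mdiff {e : OpenPartialHomeomorph X (Base n)} (he : IsSmoothChart e) :
    e.MDifferentiable (baseModel n) 𝓘(ℝ, Base n) :=
  ⟨he.smooth.mdifferentiableOn (by simp), he.smooth_symm.mdifferentiableOn (by simp)⟩

theorem chartAt [IsManifold (baseModel n) ∞ X] (x : X) :
    IsSmoothChart (_root_.chartAt (Base n) x) :=
  ⟨contMDiffOn_chart, contMDiffOn_chart_symm⟩

theorem base {B : SmoothFiberBundle n N X Y F} (c : FiberedChart B) : IsSmoothChart c.base :=
  ⟨c.smooth_base, c.smooth_base_symm⟩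

theorem contDiffOn_change {e e' : OpenPartialHomeomorph X (Base n)} (he : IsSmoothChart e)
    (he' : IsSmoothChart e') :
    ContDiffOn ℝ ∞ (e' ∘ e.symm) (e.target ∩ e.symm ⁻¹' e'.source) :=
  (he'.smooth.comp (he.smooth_symm.mono inter_subset_left) fun _ hu => hu.2).contDiffOn

end IsSmoothChart

theorem isOpen_change {e e' : OpenPartialHomeomorph X (Base n)} :
    IsOpen (e.target ∩ e.symm ⁻¹' e'.source) :=
  e.isOpen_inter_preimage_symm e'.open_source

theorem volCoeff_ne_zero (η : VolumeForm n X) {e : OpenPartialHomeomorph X (Base n)}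
    (he : IsSmoothChart e) {u : Base n} (hu : u ∈ e.target) : volCoeff η e u ≠ 0 := by
  refine topCoeff_comp_ne_zero (n := n) (η.topCoeff_ne_zero (e.symm u))
    (A := mfderiv 𝓘(ℝ, Base n) 𝓘(ℝ, Base n) e.symm u)
    (A' := mfderiv 𝓘(ℝ, Base n) 𝓘(ℝ, Base n) e (e.symm u)) fun v => ?_
  exact DFunLike.congr_fun (he.mdiff.comp_symm_deriv hu) v

/-- The transformation rule of the coefficient of the volume form under a change of charts. -/
theorem volCoeff_change (η : VolumeForm n X) {e e' : OpenPartialHomeomorph X (Base n)}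
    (he : IsSmoothChart e) (he' : IsSmoothChart e') {u : Base n}
    (hu : u ∈ e.target ∩ e.symm ⁻¹' e'.source) :
    volCoeff η e u = volCoeff η e' (e' (e.symm u)) * (fderiv ℝ (e' ∘ e.symm) u).det := by
  have h1 : (mfderiv 𝓘(ℝ, Base n) 𝓘(ℝ, Base n) e.symm u : Base n →L[ℝ] Base n) =
      (mfderiv 𝓘(ℝ, Base n) 𝓘(ℝ, Base n) e'.symm (e' (e.symm u)) : Base n →L[ℝ] Base n).comp
        (fderiv ℝ (e' ∘ e.symm) u) := by
    have hev : e.symm =ᶠ[𝓝 u] e'.symm ∘ (e' ∘ e.symm) := by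
      filter_upwards [isOpen_change.mem_nhds hu] with u' hu'
      exact (e'.left_inv hu'.2).symm
    have h2 := hev.mfderiv_eq (I := 𝓘(ℝ, Base n)) (I' := 𝓘(ℝ, Base n))
    have h3 : MDifferentiableAt 𝓘(ℝ, Base n) 𝓘(ℝ, Base n) (e' ∘ e.symm) u :=
      (((he.contDiffOn_change he').contDiffAt (isOpen_change.mem_nhds hu)).differentiableAt
        (by simp)).mdifferentiableAt
    have h4 := mfderiv_comp (I := 𝓘(ℝ, Base n)) (I' := 𝓘(ℝ, Base n)) (I'' := 𝓘(ℝ, Base n)) u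
      (he'.mdiff.mdifferentiableAt_symm (e'.map_source hu.2)) h3
    rw [mfderiv_eq_fderiv] at h4
    exact h2.trans h4
  rw [volCoeff, volCoeff, topCoeff_inChart_apply _ _ hu.2, ← topCoeff_comp]
  change topCoeff (n := n) ((η.form (e.symm u)).compContinuousLinearMap
    (mfderiv 𝓘(ℝ, Base n) 𝓘(ℝ, Base n) e.symm u : Base n →L[ℝ] Base n)) = _
  rw [h1]
  rfl

theorem contDiffOn_volCoeff [IsManifold (baseModel n) ∞ X] (η : VolumeForm n X)
    {e : OpenPartialHomeomorph X (Base n)} (he : IsSmoothChart e) :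
    ContDiffOn ℝ ∞ (volCoeff η e) e.target := by
  intro u hu
  refine ContDiffAt.contDiffWithinAt ?_
  set e' := chartAt (Base n) (e.symm u)
  have he' : IsSmoothChart e' := IsSmoothChart.chartAt _
  have hu' : u ∈ e.target ∩ e.symm ⁻¹' e'.source := ⟨hu, mem_chart_source _ _⟩
  have h0 : ContDiffOn ℝ ∞ (volCoeff η e') e'.target := by
    have h := η.smooth (e.symm u)
    exact (ContinuousAlternatingMap.apply ℝ (Base n) ℝ fun μ => eX μ).contDiff.comp_contDiffOn h
  have h1 := (he.contDiffOn_change he').contDiffAt (isOpen_change.mem_nhds hu')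
  have h2 : ContDiffAt ℝ ∞ (fun u => (fderiv ℝ (e' ∘ e.symm) u).det) u := by
    have h3 : ContDiffAt ℝ ∞ (fderiv ℝ (e' ∘ e.symm)) u := h1.fderiv_right (by simp)
    have h4 : ∀ A : Base n →L[ℝ] Base n,
        A.det = topCoeff ((stdVol n).compContinuousLinearMap A) := by
      intro A
      rw [topCoeff_comp, show topCoeff (stdVol n) = 1 from stdVol_eX n, one_mul]
    simp only [h4]
    change ContDiffAt ℝ ∞ (fun u' => stdVol n (fun μ => fderiv ℝ (e' ∘ e.symm) u' (eX μ))) u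
    refine (stdVol n).toContinuousMultilinearMap.contDiff.contDiffAt.comp u ?_
    rw [contDiffAt_pi]
    exact fun μ => h3.clm_apply contDiffAt_const
  have h5 : ContDiffAt ℝ ∞ (fun u => volCoeff η e' (e' (e.symm u))) u :=
    ContDiffAt.comp (g := volCoeff η e') (f := e' ∘ e.symm) u
      (h0.contDiffAt (e'.open_target.mem_nhds (e'.map_source hu'.2))) h1
  refine (h5.mul h2).congr_of_eventuallyEq ?_
  filter_upwards [isOpen_change.mem_nhds hu'] with u' hu'
  exact volCoeff_change η he he' hu'

/-! ### Coordinate expressions of the forms on the Pontryagin bundle -/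

/-- Evaluation of the fibre coordinate `y^A`. -/
def coordY (n : ℕ) {N : ℕ} (A : Fin N) : PontryaginModel n N →L[ℝ] ℝ :=
  (EuclideanSpace.proj A).comp
    ((ContinuousLinearMap.snd ℝ (Base n) (Fib N)).comp (ContinuousLinearMap.fst ℝ _ _))

/-- Evaluation of the coordinate `v^A_μ`. -/
def coordV {n N : ℕ} (A : Fin N) (μ : Fin (n + 1)) : PontryaginModel n N →L[ℝ] ℝ :=
  ((EuclideanSpace.proj A).comp (ContinuousLinearMap.apply ℝ (Fib N) (eX μ : Base n))).comp
    ((ContinuousLinearMap.fst ℝ _ _).comp (ContinuousLinearMap.snd ℝ _ _))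

/-- Evaluation of the coordinate `p_A^μ`. -/
def coordP {n N : ℕ} (A : Fin N) (μ : Fin (n + 1)) : PontryaginModel n N →L[ℝ] ℝ :=
  ((ContinuousLinearMap.proj (R := ℝ) (φ := fun _ : Fin (n + 1) => ℝ) μ).comp
    (ContinuousLinearMap.proj (R := ℝ) (φ := fun _ : Fin N => Fin (n + 1) → ℝ) A)).comp
    ((ContinuousLinearMap.snd ℝ _ _).comp ((ContinuousLinearMap.snd ℝ _ _).comp
      (ContinuousLinearMap.snd ℝ _ _)))

/-- The projection `(x, y, v, p, p_A^μ) ↦ (x, y, v)`. -/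
def coordJet (n N : ℕ) : PontryaginModel n N →L[ℝ] JetModel n N :=
  (ContinuousLinearMap.fst ℝ _ _).prod
    ((ContinuousLinearMap.fst ℝ _ _).comp (ContinuousLinearMap.snd ℝ _ _))

/-- The density `p_A^μ (∂_μ y^A - v^A_μ) + L(x, y, v)` of the Hamilton–Pontryagin action, as a
function of a point of the model space and of the differential of a section. -/
def modelDensity (Lc : JetModel n N → ℝ) (r : PontryaginModel n N)
    (D : Base n →L[ℝ] PontryaginModel n N) : ℝ :=
  ∑ A, ∑ μ, r.2.2.2 A μ * ((D (eX μ)).1.2 A - r.2.1 (eX μ) A) + Lc (r.1, r.2.1)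

/-- The generalized energy `p + p_A^μ v^A_μ - L(x, y, v)` in coordinates. -/
def modelEnergy (Lc : JetModel n N → ℝ) (r : PontryaginModel n N) : ℝ :=
  r.2.2.1 + ∑ A, ∑ μ, r.2.2.2 A μ * r.2.1 (eX μ) A - Lc (r.1, r.2.1)

section Coordinates

variable [IsManifold (baseModel n) ∞ X] [IsManifold (𝓡 N) ∞ F]
  {B : SmoothFiberBundle n N X Y F}

namespace FiberData

variable {V : Type} [NormedAddCommGroup V] [NormedSpace ℝ V] (D : FiberData B V)

/-- The tangent map of the chart induced by a fibred chart. -/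
def dHomeo (c : FiberedChart B) (m : D.Total) :
    TangentSpace 𝓘(ℝ, (Base n × Fib N) × V) m →L[ℝ] (Base n × Fib N) × V :=
  mfderiv 𝓘(ℝ, (Base n × Fib N) × V) 𝓘(ℝ, (Base n × Fib N) × V) (D.homeoOf c) m

/-- The tangent map of the inverse of the chart induced by a fibred chart. -/
def dHomeoInv (c : FiberedChart B) (m : D.Total) :
    (Base n × Fib N) × V →L[ℝ] TangentSpace 𝓘(ℝ, (Base n × Fib N) × V) m :=
  mfderiv 𝓘(ℝ, (Base n × Fib N) × V) 𝓘(ℝ, (Base n × Fib N) × V) (D.homeoOf c).symm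
    (D.homeoOf c m)

theorem dHomeo_dHomeoInv {c : FiberedChart B} {m : D.Total} (h : m.pt ∈ c.total.source)
    (v : (Base n × Fib N) × V) : D.dHomeo c m (D.dHomeoInv c m v) = v := by
  have h1 := (D.mdiff_homeoOf c).comp_symm_deriv ((D.homeoOf c).map_source h)
  rw [(D.homeoOf c).left_inv h] at h1
  exact DFunLike.congr_fun h1 v

theorem dTotal_mfderiv_toY {c : FiberedChart B} {m : D.Total} (h : m.pt ∈ c.total.source)
    (v : TangentSpace 𝓘(ℝ, (Base n × Fib N) × V) m) :
    c.dTotal m.pt (mfderiv 𝓘(ℝ, (Base n × Fib N) × V) (totalModel n N) D.toY m v) =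
      (D.dHomeo c m v).1 := by
  have h1 := mfderiv_comp (I := 𝓘(ℝ, (Base n × Fib N) × V)) (I' := totalModel n N)
    (I'' := 𝓘(ℝ, Base n × Fib N)) m (g := c.total) (f := D.toY)
    (c.mdiff_total.mdifferentiableAt h) (D.contMDiff_toY.mdifferentiableAt (by simp))
  have h2 := mfderiv_comp (I := 𝓘(ℝ, (Base n × Fib N) × V)) (I' := 𝓘(ℝ, (Base n × Fib N) × V))
    (I'' := 𝓘(ℝ, Base n × Fib N)) m (g := Prod.fst) (f := D.homeoOf c)
    differentiableAt_fst.mdifferentiableAt ((D.mdiff_homeoOf c).mdifferentiableAt h)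
  rw [mfderiv_eq_fderiv, fderiv_fst] at h2
  exact DFunLike.congr_fun (h1.symm.trans h2) v

theorem mfderiv_toX {c : FiberedChart B} {m : D.Total} (h : m.pt ∈ c.total.source)
    (v : TangentSpace 𝓘(ℝ, (Base n × Fib N) × V) m) :
    mfderiv 𝓘(ℝ, (Base n × Fib N) × V) (baseModel n) D.toX m v =
      c.dBaseInv (B.proj m.pt) (D.dHomeo c m v).1.1 := by
  have h0 : (D.dHomeo c m v).1.1 = c.dBase (B.proj m.pt) (B.dproj m.pt
      (mfderiv 𝓘(ℝ, (Base n × Fib N) × V) (totalModel n N) D.toY m v)) :=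
    (congrArg Prod.fst (D.dTotal_mfderiv_toY h v)).symm.trans (c.fst_dTotal h _)
  rw [h0, c.dBaseInv_dBase (c.proj_mem _ h)]
  have h1 := mfderiv_comp (I := 𝓘(ℝ, (Base n × Fib N) × V)) (I' := totalModel n N)
    (I'' := baseModel n) m (g := B.proj) (f := D.toY)
    (B.contMDiff_proj.mdifferentiableAt (by simp)) (D.contMDiff_toY.mdifferentiableAt (by simp))
  exact DFunLike.congr_fun h1 v

end FiberData

theorem dHomeo_mfderiv_toDual {c : FiberedChart B} {m : PontryaginBundle B}
    (h : m.pt ∈ c.total.source) (v : TangentSpace 𝓘(ℝ, PontryaginModel n N) m) :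
    (dualJetData B).dHomeo c (toDual m)
        (mfderiv 𝓘(ℝ, PontryaginModel n N) 𝓘(ℝ, DualJetModel n N) toDual m v) =
      (((pontryaginData B).dHomeo c m v).1, ((pontryaginData B).dHomeo c m v).2.2) := by
  have h1 := mfderiv_comp (I := 𝓘(ℝ, PontryaginModel n N)) (I' := 𝓘(ℝ, DualJetModel n N))
    (I'' := 𝓘(ℝ, DualJetModel n N)) m (g := (dualJetData B).homeoOf c) (f := toDual)
    (((dualJetData B).mdiff_homeoOf c).mdifferentiableAt h)
    (contMDiff_toDual.mdifferentiableAt (by simp))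
  let P : PontryaginModel n N →L[ℝ] DualJetModel n N :=
    (ContinuousLinearMap.fst ℝ _ _).prod
      ((ContinuousLinearMap.snd ℝ _ _).comp (ContinuousLinearMap.snd ℝ _ _))
  have h2 := mfderiv_comp (I := 𝓘(ℝ, PontryaginModel n N)) (I' := 𝓘(ℝ, PontryaginModel n N))
    (I'' := 𝓘(ℝ, DualJetModel n N)) m (g := P) (f := (pontryaginData B).homeoOf c)
    P.differentiableAt.mdifferentiableAt
    (((pontryaginData B).mdiff_homeoOf c).mdifferentiableAt h)
  rw [mfderiv_eq_fderiv, P.fderiv] at h2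
  have hev : (dualJetData B).homeoOf c ∘ toDual =ᶠ[𝓝 m] P ∘ (pontryaginData B).homeoOf c := by
    filter_upwards [((pontryaginData B).homeoOf c).open_source.mem_nhds h] with m' hm'
    exact homeoOf_toDual c hm'
  have h3 := hev.mfderiv_eq (I := 𝓘(ℝ, PontryaginModel n N)) (I' := 𝓘(ℝ, DualJetModel n N))
  exact DFunLike.congr_fun ((h1.symm.trans h3).trans h2) v

/-- The coordinate expression of the tangent map of a section. -/
theorem dHomeo_mfderiv_section {c : FiberedChart B} {σ : X → PontryaginBundle B} {x : X}
    (hσ : MDifferentiableAt (baseModel n) 𝓘(ℝ, PontryaginModel n N) σ x)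
    (hx : x ∈ c.base.source) (h : (σ x).pt ∈ c.total.source) (v : Base n) :
    (pontryaginData B).dHomeo c (σ x)
        (mfderiv (baseModel n) 𝓘(ℝ, PontryaginModel n N) σ x (c.dBaseInv x v)) =
      fderiv ℝ (localRep c σ) (c.base x) v := by
  have h0 : c.base.symm (c.base x) = x := c.base.left_inv hx
  have h1 := mfderiv_comp_of_eq (I := 𝓘(ℝ, Base n)) (I' := baseModel n)
    (I'' := 𝓘(ℝ, PontryaginModel n N)) (x := c.base x) (g := σ) (f := c.base.symm) hσ
    (c.mdiff_base.mdifferentiableAt_symm (c.base.map_source hx)) h0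
  have hd : MDifferentiableAt 𝓘(ℝ, Base n) 𝓘(ℝ, PontryaginModel n N) (σ ∘ c.base.symm)
      (c.base x) :=
    MDifferentiableAt.comp (I' := baseModel n) _ (by rwa [h0])
      (c.mdiff_base.mdifferentiableAt_symm (c.base.map_source hx))
  have h2 := mfderiv_comp_of_eq (I := 𝓘(ℝ, Base n)) (I' := 𝓘(ℝ, PontryaginModel n N))
    (I'' := 𝓘(ℝ, PontryaginModel n N)) (x := c.base x) (g := (pontryaginData B).homeoOf c)
    (f := σ ∘ c.base.symm) (y := σ x)
    (((pontryaginData B).mdiff_homeoOf c).mdifferentiableAt h) hd (congrArg σ h0)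
  rw [mfderiv_eq_fderiv] at h2
  let G : X → Base n → PontryaginModel n N := fun x' w =>
    mfderiv 𝓘(ℝ, PontryaginModel n N) 𝓘(ℝ, PontryaginModel n N)
      ((pontryaginData B).homeoOf c) (σ x') (mfderiv (baseModel n) 𝓘(ℝ, PontryaginModel n N) σ x' w)
  have h3 : G (c.base.symm (c.base x)) (c.dBaseInv x v) = G x (c.dBaseInv x v) :=
    congrFun (congrArg G h0) _
  have h4 := DFunLike.congr_fun (h2.trans (congrArg _ h1)) v
  exact (h4.trans h3).symm

theorem localLagrangian_homeoOf (c : FiberedChart B) (η : VolumeForm n X) (L : JetBundle B → ℝ)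
    {j : JetBundle B} (h : j.pt ∈ c.total.source) :
    localLagrangian c η L ((jetData B).homeoOf c j) =
      L j * volCoeff η c.base (c.base (B.proj j.pt)) := by
  have h1 : localLagrangian c η L ((jetData B).homeoOf c j) =
      topCoeff ((lagrangianDensity η L j).compContinuousLinearMap (c.dBaseInv (B.proj j.pt))) :=
    congrArg (fun j : JetBundle B => topCoeff ((lagrangianDensity η L j).compContinuousLinearMap
      (c.dBaseInv (B.proj j.pt)))) (((jetData B).homeoOf c).left_inv h)
  rw [h1, volCoeff, topCoeff_inChart_apply _ _ (c.proj_mem _ h)]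
  rfl

theorem energyDensity_coord (c : FiberedChart B) (η : VolumeForm n X) (L : JetBundle B → ℝ)
    {m : PontryaginBundle B} (h : m.pt ∈ c.total.source) :
    topCoeff ((energyDensity η L m).compContinuousLinearMap (c.dBaseInv (B.proj m.pt))) =
      modelEnergy (localLagrangian c η L) ((pontryaginData B).homeoOf c m) := by
  have hx := c.proj_mem _ h
  have h1 : localLagrangian c η L ((jetData B).homeoOf c (toJet m)) =
      topCoeff ((lagrangianDensity η L (toJet m)).compContinuousLinearMap
        (c.dBaseInv (B.proj m.pt))) :=
    congrArg (fun j : JetBundle B => topCoeff ((lagrangianDensity η L j).compContinuousLinearMap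
      (c.dBaseInv (B.proj j.pt)))) (((jetData B).homeoOf c).left_inv (x := toJet m) h)
  rw [homeoOf_toJet c h] at h1
  have h2 : topCoeff ((pairing m).compContinuousLinearMap (c.dBaseInv (B.proj m.pt))) =
      ((pontryaginData B).homeoOf c m).2.2.1 + ∑ A, ∑ μ,
        ((pontryaginData B).homeoOf c m).2.2.2 A μ *
          ((pontryaginData B).homeoOf c m).2.1 (eX μ) A := by
    rw [← semibasicOf_graph]
    change m.val.2.1 (fun μ => m.val.1.1 (c.dBaseInv (B.proj m.pt) (eX μ))) = _
    have e1 := dual_val_eq c (z := toDual m) h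
    have e2 := jet_val_eq c (j := toJet m) h
    rw [homeoOf_toDual c h] at e1
    rw [homeoOf_toJet c h] at e2
    change m.val.2.1 = _ at e1
    change m.val.1.1 = _ at e2
    rw [e1, e2]
    refine congrArg (semibasicOf _) (funext fun μ => ?_)
    change c.dTotal m.pt (c.dTotalInv m.pt (c.dBase (B.proj m.pt) (c.dBaseInv (B.proj m.pt) (eX μ)),
      ((pontryaginData B).homeoOf c m).2.1
        (c.dBase (B.proj m.pt) (c.dBaseInv (B.proj m.pt) (eX μ))))) = _
    rw [c.dTotal_dTotalInv h, c.dBase_dBaseInv hx]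
  rw [modelEnergy, ← h2, h1]
  rfl

theorem generalizedEnergy_coord (c : FiberedChart B) (η : VolumeForm n X) (L : JetBundle B → ℝ)
    {m : PontryaginBundle B} (h : m.pt ∈ c.total.source) :
    modelEnergy (localLagrangian c η L) ((pontryaginData B).homeoOf c m) =
      generalizedEnergy η L m * volCoeff η c.base (c.base (B.proj m.pt)) := by
  rw [← energyDensity_coord c η L h, energyDensity_eq, volCoeff,
    topCoeff_inChart_apply _ _ (c.proj_mem _ h)]
  rfl

theorem energyForm_apply (c : FiberedChart B) (η : VolumeForm n X) (L : JetBundle B → ℝ)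
    {m : PontryaginBundle B} (h : m.pt ∈ c.total.source)
    (w : Fin (n + 1) → TangentSpace 𝓘(ℝ, PontryaginModel n N) m) :
    energyForm η L m w = modelEnergy (localLagrangian c η L) ((pontryaginData B).homeoOf c m) *
      stdVol n (fun k => ((pontryaginData B).dHomeo c m (w k)).1.1) := by
  have h1 := eq_topCoeff_smul
    ((energyDensity η L m).compContinuousLinearMap (c.dBaseInv (B.proj m.pt)))
  rw [energyDensity_coord c η L h] at h1
  have h2 := DFunLike.congr_fun h1 (fun k => ((pontryaginData B).dHomeo c m (w k)).1.1)
  refine Eq.trans ?_ h2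
  refine congrArg (energyDensity η L m) (funext fun k => ?_)
  exact (pontryaginData B).mfderiv_toX h (w k)

theorem canonicalForm_apply (c : FiberedChart B) {z : DualJetBundle B}
    (h : z.pt ∈ c.total.source)
    (w : Fin (n + 1) → TangentSpace 𝓘(ℝ, DualJetModel n N) z) :
    canonicalForm B z w = semibasicOf ((dualJetData B).homeoOf c z).2
      (fun k => ((dualJetData B).dHomeo c z (w k)).1) := by
  have e1 := dual_val_eq c h
  change z.val.1 (fun k => mfderiv 𝓘(ℝ, DualJetModel n N) (totalModel n N)
    (dualJetData B).toY z (w k)) = _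
  rw [e1]
  refine congrArg (semibasicOf _) (funext fun k => ?_)
  exact (dualJetData B).dTotal_mfderiv_toY h (w k)

theorem thetaM_apply (c : FiberedChart B) {m : PontryaginBundle B} (h : m.pt ∈ c.total.source)
    (w : Fin (n + 1) → TangentSpace 𝓘(ℝ, PontryaginModel n N) m) :
    thetaM B m w = semibasicOf ((pontryaginData B).homeoOf c m).2.2
      (fun k => ((pontryaginData B).dHomeo c m (w k)).1) := by
  refine (canonicalForm_apply c (z := toDual m) h _).trans ?_
  rw [homeoOf_toDual c h]
  refine congrArg (semibasicOf _) (funext fun k => ?_)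
  exact congrArg Prod.fst (dHomeo_mfderiv_toDual h (w k))

theorem base_localRep {c : FiberedChart B} {σ : X → PontryaginBundle B}
    (hs : ∀ x, (pontryaginData B).toX (σ x) = x) {u : Base n} (hu : u ∈ localDomain c σ) :
    (localRep c σ u).1.1 = u := by
  change (c.total (σ (c.base.symm u)).pt).1 = u
  rw [c.fst_total _ hu.2, show B.proj (σ (c.base.symm u)).pt = c.base.symm u from hs _,
    c.base.right_inv hu.1]

theorem isOpen_localDomain (c : FiberedChart B) {σ : X → PontryaginBundle B}
    (hσ : Continuous σ) : IsOpen (localDomain c σ) :=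
  c.base.isOpen_inter_preimage_symm
    (c.total.open_source.preimage ((pontryaginData B).continuous_toY.comp hσ))

theorem contDiffOn_localRep (c : FiberedChart B) {σ : X → PontryaginBundle B}
    (hσ : ContMDiff (baseModel n) 𝓘(ℝ, PontryaginModel n N) ∞ σ) :
    ContDiffOn ℝ ∞ (localRep c σ) (localDomain c σ) :=
  (((pontryaginData B).contMDiffOn_homeoOf c).comp
    (hσ.comp_contMDiffOn (c.smooth_base_symm.mono fun _ hu => hu.1))
    fun _ hu => hu.2).contDiffOn

theorem fderiv_localRep_base (c : FiberedChart B) {σ : X → PontryaginBundle B}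
    (hσ : ContMDiff (baseModel n) 𝓘(ℝ, PontryaginModel n N) ∞ σ)
    (hs : ∀ x, (pontryaginData B).toX (σ x) = x) {u : Base n} (hu : u ∈ localDomain c σ)
    (v : Base n) : (fderiv ℝ (localRep c σ) u v).1.1 = v := by
  have ho := (isOpen_localDomain c hσ.continuous).mem_nhds hu
  have hd : HasFDerivAt (localRep c σ) (fderiv ℝ (localRep c σ) u) u :=
    (((contDiffOn_localRep c hσ).contDiffAt ho).differentiableAt (by simp)).hasFDerivAt
  let P : PontryaginModel n N →L[ℝ] Base n :=
    (ContinuousLinearMap.fst ℝ (Base n) (Fib N)).comp (ContinuousLinearMap.fst ℝ _ _)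
  have h1 := P.hasFDerivAt.comp u hd
  have h2 : (fun u => (localRep c σ u).1.1) =ᶠ[𝓝 u] id := by
    filter_upwards [ho] with u' hu' using base_localRep hs hu'
  have h3 := (hasFDerivAt_id (𝕜 := ℝ) u).congr_of_eventuallyEq h2
  exact DFunLike.congr_fun (h1.unique h3) v

/-- The density of the Hamilton–Pontryagin action along a section, in fibred coordinates. The
coordinate `p` drops out. -/
theorem density_section (c : FiberedChart B) (η : VolumeForm n X) (L : JetBundle B → ℝ)
    {σ : X → PontryaginBundle B}
    (hσ : ContMDiff (baseModel n) 𝓘(ℝ, PontryaginModel n N) ∞ σ)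
    (hs : ∀ x, (pontryaginData B).toX (σ x) = x) {u : Base n} (hu : u ∈ localDomain c σ) :
    density η ((thetaM B - energyForm η L).pullback (E := Base n) σ) (c.base.symm u) *
        volCoeff η c.base u =
      modelDensity (localLagrangian c η L) (localRep c σ u) (fderiv ℝ (localRep c σ) u) := by
  have hf : (fun ν => (fderiv ℝ (localRep c σ) u (eX ν)).1.1) = fun ν => eX ν :=
    funext fun ν => fderiv_localRep_base c hσ hs hu _
  obtain ⟨hu1, hu2⟩ := hu
  obtain ⟨x, hx, rfl⟩ : ∃ x ∈ c.base.source, c.base x = u :=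
    ⟨c.base.symm u, c.base.map_target hu1, c.base.right_inv hu1⟩
  rw [c.base.left_inv hx] at hu2 ⊢
  have hr : localRep c σ (c.base x) = (pontryaginData B).homeoOf c (σ x) := by
    rw [localRep, c.base.left_inv hx]
  have h1 := topCoeff_inChart η ((thetaM B - energyForm η L).pullback (E := Base n) σ) c.base
    (c.base x)
  rw [c.base.left_inv hx, topCoeff_inChart_apply _ _ hx] at h1
  rw [← h1]
  set w : Fin (n + 1) → TangentSpace 𝓘(ℝ, PontryaginModel n N) (σ x) := fun ν =>
    mfderiv (baseModel n) 𝓘(ℝ, PontryaginModel n N) σ x (c.dBaseInv x (eX ν)) with hw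
  have hwν : ∀ ν, (pontryaginData B).dHomeo c (σ x) (w ν) =
      fderiv ℝ (localRep c σ) (c.base x) (eX ν) := fun ν =>
    dHomeo_mfderiv_section (hσ.mdifferentiableAt (by simp)) hx hu2 _
  change thetaM B (σ x) w - energyForm η L (σ x) w = _
  rw [thetaM_apply c hu2, energyForm_apply c η L hu2]
  simp only [hwν]
  have hg : (fun ν => (fderiv ℝ (localRep c σ) (c.base x) (eX ν)).1) = fun ν =>
      (eX ν, (fderiv ℝ (localRep c σ) (c.base x) (eX ν)).1.2) :=
    funext fun ν => Prod.ext (congrFun hf ν) rfl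
  rw [hg, hf, semibasicOf_graph, stdVol_eX, ← hr, modelEnergy, modelDensity]
  simp only [mul_sub, Finset.sum_sub_distrib]
  ring

end Coordinates

/-! ### The contraction of `Ω_𝓔` with vertical vectors -/

/-- The value of `Ω_𝓔` on a vertical vector `v = (δy, δv, δp, δp_A^μ)` followed by the coordinate
frame of a section, whose differential is `D`. Its vanishing for all `v` is the system of implicit
Euler–Lagrange equations. -/
def modelEulerLagrange (Lc : JetModel n N → ℝ) (r : PontryaginModel n N)
    (D : Base n →L[ℝ] PontryaginModel n N) (v : PontryaginModel n N) : ℝ :=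
  ∑ A, ∑ μ, v.2.2.2 A μ * (r.2.1 (eX μ) A - (D (eX μ)).1.2 A) +
    ∑ A, ∑ μ, (D (eX μ)).2.2.2 A μ * v.1.2 A + ∑ A, ∑ μ, r.2.2.2 A μ * v.2.1 (eX μ) A -
    fderiv ℝ Lc (r.1, r.2.1) (v.1, v.2.1)

/-- The exterior derivative can be computed in any chart of the maximal atlas. -/
theorem DiffForm.d_eq_of_mem_maximalAtlas {E M : Type*} [NormedAddCommGroup E] [NormedSpace ℝ E]
    [TopologicalSpace M] [ChartedSpace E M] [IsManifold 𝓘(ℝ, E) ∞ M] {k : ℕ} {α : DiffForm E M k}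
    {e : OpenPartialHomeomorph M E} (he : e ∈ IsManifold.maximalAtlas 𝓘(ℝ, E) ∞ M) {m : M}
    (hm : m ∈ e.source) (hα : DifferentiableAt ℝ (α.inChart e) (e m)) :
    α.d m = (extDeriv (α.inChart e) (e m)).compContinuousLinearMap
      (mfderiv 𝓘(ℝ, E) 𝓘(ℝ, E) e m) := by
  set e₀ := chartAt E m with he₀
  have h0 : e₀ ∈ IsManifold.maximalAtlas 𝓘(ℝ, E) ∞ M := IsManifold.chart_mem_maximalAtlas m
  have hm0 : m ∈ e₀.source := mem_chart_source E m
  have hd : e.MDifferentiable 𝓘(ℝ, E) 𝓘(ℝ, E) :=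
    ⟨(contMDiffOn_of_mem_maximalAtlas he).mdifferentiableOn (by simp),
      (contMDiffOn_symm_of_mem_maximalAtlas he).mdifferentiableOn (by simp)⟩
  have hd0 : e₀.MDifferentiable 𝓘(ℝ, E) 𝓘(ℝ, E) :=
    ⟨(contMDiffOn_of_mem_maximalAtlas h0).mdifferentiableOn (by simp),
      (contMDiffOn_symm_of_mem_maximalAtlas h0).mdifferentiableOn (by simp)⟩
  set τ : E → E := e ∘ e₀.symm with hτ
  set O : Set E := e₀.target ∩ e₀.symm ⁻¹' e.source with hO
  have hOo : IsOpen O := e₀.isOpen_inter_preimage_symm e.open_source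
  have hmO : e₀ m ∈ O := ⟨e₀.map_source hm0, by
    change e₀.symm (e₀ m) ∈ e.source
    rwa [e₀.left_inv hm0]⟩
  have hτd : ContDiffOn ℝ ∞ τ O :=
    ((contMDiffOn_of_mem_maximalAtlas he).comp
      ((contMDiffOn_symm_of_mem_maximalAtlas h0).mono inter_subset_left)
      fun _ hu => hu.2).contDiffOn
  have hτm : τ (e₀ m) = e m := congrArg e (e₀.left_inv hm0)
  have hev : α.inChart e₀ =ᶠ[𝓝 (e₀ m)] fun u =>
      (α.inChart e (τ u)).compContinuousLinearMap (fderiv ℝ τ u) := by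
    filter_upwards [hOo.mem_nhds hmO] with u hu
    have h1 : e.symm (τ u) = e₀.symm u := e.left_inv hu.2
    have h2 : fderiv ℝ τ u = (mfderiv 𝓘(ℝ, E) 𝓘(ℝ, E) e (e₀.symm u)).comp
        (mfderiv 𝓘(ℝ, E) 𝓘(ℝ, E) e₀.symm u) := by
      rw [← mfderiv_eq_fderiv]
      exact mfderiv_comp (I' := 𝓘(ℝ, E)) u (hd.mdifferentiableAt hu.2)
        (hd0.mdifferentiableAt_symm hu.1)
    let α' : M → E [⋀^Fin k]→L[ℝ] ℝ := α
    have h3 : α' (e.symm (τ u)) = α' (e₀.symm u) := congrArg α' h1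
    ext w
    change α' (e₀.symm u) (fun i => (mfderiv 𝓘(ℝ, E) 𝓘(ℝ, E) e₀.symm u : E →L[ℝ] E) (w i)) =
      α' (e.symm (τ u)) (fun i => (mfderiv 𝓘(ℝ, E) 𝓘(ℝ, E) e.symm (τ u) : E →L[ℝ] E)
        (fderiv ℝ τ u (w i)))
    rw [h3, h2]
    refine congrArg (α' (e₀.symm u)) (funext fun i => ?_)
    exact (DFunLike.congr_fun (hd.symm_comp_deriv hu.2)
      (mfderiv 𝓘(ℝ, E) 𝓘(ℝ, E) e₀.symm u (w i))).symm
  have h4 : (mfderiv 𝓘(ℝ, E) 𝓘(ℝ, E) e m : E →L[ℝ] E) =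
      (fderiv ℝ τ (e₀ m)).comp (mfderiv 𝓘(ℝ, E) 𝓘(ℝ, E) e₀ m : E →L[ℝ] E) := by
    have hev2 : e =ᶠ[𝓝 m] τ ∘ e₀ := by
      filter_upwards [e₀.open_source.mem_nhds hm0] with m' hm'
      exact congrArg e (e₀.left_inv hm').symm
    have h5 := mfderiv_comp (I := 𝓘(ℝ, E)) (I' := 𝓘(ℝ, E)) (I'' := 𝓘(ℝ, E)) m (g := τ) (f := e₀)
      ((hτd.contDiffAt (hOo.mem_nhds hmO)).differentiableAt (by simp)).mdifferentiableAt
      (hd0.mdifferentiableAt hm0)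
    rw [mfderiv_eq_fderiv] at h5
    exact (hev2.mfderiv_eq).trans h5
  have hα' : DifferentiableAt ℝ (α.inChart e) (τ (e₀ m)) := by rwa [hτm]
  have h6 := extDeriv_pullback hα' (hτd.contDiffAt (hOo.mem_nhds hmO))
    (by rw [minSmoothness_of_isRCLikeNormedField]; exact WithTop.coe_le_coe.2 le_top)
  rw [hτm] at h6
  change (extDeriv (α.inChart e₀) (e₀ m)).compContinuousLinearMap _ = _
  rw [hev.extDeriv_eq, h6]
  ext w
  refine congrArg (extDeriv (α.inChart e) (e m)) (funext fun i => ?_)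
  exact (DFunLike.congr_fun h4 (w i)).symm

section Contraction

variable [IsManifold (baseModel n) ∞ X] [IsManifold (𝓡 N) ∞ F]
  {B : SmoothFiberBundle n N X Y F}

theorem contDiffOn_localLagrangian (c : FiberedChart B) (η : VolumeForm n X) {L : JetBundle B → ℝ}
    (hL : ContMDiff 𝓘(ℝ, JetModel n N) 𝓘(ℝ, ℝ) ∞ L) :
    ContDiffOn ℝ ∞ (localLagrangian c η L) (c.total.target ×ˢ univ) := by
  have h1 : ContDiffOn ℝ ∞ (fun w => L (((jetData B).homeoOf c).symm w))
      (c.total.target ×ˢ univ) :=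
    (hL.comp_contMDiffOn ((jetData B).contMDiffOn_homeoOf_symm c)).contDiffOn
  have hbase : ∀ w ∈ c.total.target, c.base (B.proj (c.total.symm w)) = w.1 := by
    intro w hw
    rw [← c.fst_total _ (c.total.map_target hw), c.total.right_inv hw]
  have h2 : ContDiffOn ℝ ∞ (fun w : JetModel n N => volCoeff η c.base w.1.1)
      (c.total.target ×ˢ univ) := by
    refine (contDiffOn_volCoeff η (IsSmoothChart.base c)).comp
      (f := fun w : JetModel n N => w.1.1) (by fun_prop) ?_
    rintro w ⟨hw, -⟩
    change w.1.1 ∈ c.base.target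
    rw [← hbase w.1 hw]
    exact c.base.map_source (c.proj_mem _ (c.total.map_target hw))
  refine (h1.mul h2).congr ?_
  rintro w ⟨hw, -⟩
  have h3 := localLagrangian_homeoOf c η L (j := ((jetData B).homeoOf c).symm w)
    (c.total.map_target hw)
  rw [((jetData B).homeoOf c).right_inv ⟨hw, mem_univ _⟩] at h3
  rw [h3, FiberData.homeoOf_symm_pt, hbase _ hw]

theorem differentiableAt_localLagrangian (c : FiberedChart B) (η : VolumeForm n X)
    {L : JetBundle B → ℝ} (hL : ContMDiff 𝓘(ℝ, JetModel n N) 𝓘(ℝ, ℝ) ∞ L) {w : JetModel n N}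
    (hw : w.1 ∈ c.total.target) : DifferentiableAt ℝ (localLagrangian c η L) w :=
  ((contDiffOn_localLagrangian c η hL).contDiffAt
    ((c.total.open_target.prod isOpen_univ).mem_nhds ⟨hw, mem_univ _⟩)).differentiableAt (by simp)

theorem differentiableAt_fderiv_modelEnergy {Lc : JetModel n N → ℝ} {r : PontryaginModel n N}
    (hL : DifferentiableAt ℝ Lc (r.1, r.2.1)) :
    DifferentiableAt ℝ (modelEnergy Lc) r ∧ ∀ v, fderiv ℝ (modelEnergy Lc) r v =
      v.2.2.1 + ∑ A, ∑ μ, (v.2.2.2 A μ * r.2.1 (eX μ) A + r.2.2.2 A μ * v.2.1 (eX μ) A) -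
        fderiv ℝ Lc (r.1, r.2.1) (v.1, v.2.1) := by
  let P0 : PontryaginModel n N →L[ℝ] ℝ :=
    (ContinuousLinearMap.fst ℝ _ _).comp ((ContinuousLinearMap.snd ℝ _ _).comp
        (ContinuousLinearMap.snd ℝ _ _))
  have h1 : HasFDerivAt
      (fun r => P0 r + ∑ A, ∑ μ, coordP A μ r * coordV A μ r - Lc (coordJet n N r))
      (P0 + ∑ A, ∑ μ, (coordP A μ r • coordV A μ + coordV A μ r • coordP A μ) -
        (fderiv ℝ Lc (r.1, r.2.1)).comp (coordJet n N)) r := by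
    refine (P0.hasFDerivAt.add (HasFDerivAt.fun_sum fun A _ => HasFDerivAt.fun_sum fun μ _ =>
      (coordP A μ).hasFDerivAt.mul (coordV A μ).hasFDerivAt)).sub ?_
    exact HasFDerivAt.comp r (f := coordJet n N) (g := Lc) hL.hasFDerivAt (coordJet n N).hasFDerivAt
  have h2 : HasFDerivAt (modelEnergy Lc) _ r := h1
  refine ⟨h2.differentiableAt, fun v => ?_⟩
  rw [h2.fderiv]
  simp only [sub_apply, add_apply,
    sum_apply, smul_apply, smul_eq_mul]
  have e : ∀ A μ, coordP A μ r * coordV A μ v + coordV A μ r * coordP A μ v =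
      v.2.2.2 A μ * r.2.1 (eX μ) A + r.2.2.2 A μ * v.2.1 (eX μ) A := fun A μ => by
    change r.2.2.2 A μ * v.2.1 (eX μ) A + r.2.1 (eX μ) A * v.2.2.2 A μ = _
    ring
  simp only [e]
  rfl

theorem inChart_canonicalForm (c : FiberedChart B) {u : DualJetModel n N}
    (hu : u.1 ∈ c.total.target) :
    (canonicalForm B).inChart ((dualJetData B).homeoOf c) u = modelCanonicalForm n N u := by
  have hu' : u ∈ ((dualJetData B).homeoOf c).target := ⟨hu, mem_univ _⟩
  ext w
  refine (canonicalForm_apply c (z := ((dualJetData B).homeoOf c).symm u)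
    (c.total.map_target hu) _).trans ?_
  rw [((dualJetData B).homeoOf c).right_inv hu']
  refine congrArg (semibasicOf u.2) (funext fun k => ?_)
  exact congrArg Prod.fst
    (DFunLike.congr_fun (((dualJetData B).mdiff_homeoOf c).comp_symm_deriv hu') (w k))

theorem inChart_energyForm (c : FiberedChart B) (η : VolumeForm n X) (L : JetBundle B → ℝ)
    {u : PontryaginModel n N} (hu : u.1 ∈ c.total.target) :
    (energyForm η L).inChart ((pontryaginData B).homeoOf c) u =
      modelEnergy (localLagrangian c η L) u • (stdVol n).compContinuousLinearMap
        ((ContinuousLinearMap.fst ℝ (Base n) (Fib N)).comp (ContinuousLinearMap.fst ℝ _ _)) := by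
  have hu' : u ∈ ((pontryaginData B).homeoOf c).target := ⟨hu, mem_univ _⟩
  ext w
  refine (energyForm_apply c η L (m := ((pontryaginData B).homeoOf c).symm u)
    (c.total.map_target hu) _).trans ?_
  rw [((pontryaginData B).homeoOf c).right_inv hu']
  refine congrArg (fun t => modelEnergy (localLagrangian c η L) u * stdVol n t) (funext fun k => ?_)
  exact congrArg (fun t : PontryaginModel n N => t.1.1)
    (DFunLike.congr_fun (((pontryaginData B).mdiff_homeoOf c).comp_symm_deriv hu') (w k))

theorem map_vecCons {E E' : Type*} {k : ℕ} (f : E → E') (v : E) (w : Fin k → E) :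
    (fun i => f (Matrix.vecCons v w i)) = Fin.cons (f v) fun i => f (w i) := by
  funext i
  refine Fin.cases ?_ (fun j => ?_) i <;> simp

/-- The form `Ω_𝓔` on a vertical vector followed by the coordinate frame of a section, in fibred
coordinates. -/
theorem omegaE_apply (c : FiberedChart B) (η : VolumeForm n X) {L : JetBundle B → ℝ}
    (hL : ContMDiff 𝓘(ℝ, JetModel n N) 𝓘(ℝ, ℝ) ∞ L) {m : PontryaginBundle B}
    (hm : m.pt ∈ c.total.source) (v : TangentSpace 𝓘(ℝ, PontryaginModel n N) m)
    (w : Fin (n + 1) → TangentSpace 𝓘(ℝ, PontryaginModel n N) m)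
    (D : Base n →L[ℝ] PontryaginModel n N)
    (hv : ((pontryaginData B).dHomeo c m v).1.1 = 0)
    (hw : ∀ ν, (pontryaginData B).dHomeo c m (w ν) = D (eX ν))
    (hD : ∀ ν, (D (eX ν)).1.1 = eX ν) :
    omegaE η L m (Matrix.vecCons v w) =
      modelEulerLagrange (localLagrangian c η L)
        ((pontryaginData B).homeoOf c m) D
        ((pontryaginData B).dHomeo c m v) := by
  set V := (pontryaginData B).dHomeo c m v with hV
  have ht : c.total m.pt ∈ c.total.target := c.total.map_source hm
  have hΘ : omegaM B m (Matrix.vecCons v w) = -(V.2.2.1 + ∑ A, ∑ μ, V.2.2.2 A μ *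
      (D (eX μ)).1.2 A - ∑ A, ∑ μ, (D (eX μ)).2.2.2 A μ * V.1.2 A) := by
    have hev : (canonicalForm B).inChart ((dualJetData B).homeoOf c) =ᶠ[𝓝
        ((dualJetData B).homeoOf c (toDual m))] fun u => modelCanonicalForm n N u := by
      filter_upwards [((dualJetData B).homeoOf c).open_target.mem_nhds
        (((dualJetData B).homeoOf c).map_source (x := toDual m) hm)] with u hu
      exact inChart_canonicalForm c hu.1
    have hd := DiffForm.d_eq_of_mem_maximalAtlas (α := canonicalForm B) (m := toDual m)
      ((dualJetData B).homeoOf_mem_maximalAtlas c) hm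
      ((modelCanonicalForm n N).differentiableAt.congr_of_eventuallyEq hev)
    refine congrArg Neg.neg ?_
    refine (DFunLike.congr_fun hd _).trans ?_
    change extDeriv ((canonicalForm B).inChart ((dualJetData B).homeoOf c))
      ((dualJetData B).homeoOf c (toDual m)) (fun i => (dualJetData B).dHomeo c (toDual m)
        (mfderiv 𝓘(ℝ, PontryaginModel n N) 𝓘(ℝ, DualJetModel n N) toDual m
          (Matrix.vecCons v w i))) = _
    simp only [dHomeo_mfderiv_toDual hm]
    rw [hev.extDeriv_eq]
    have h1 := map_vecCons (fun t : TangentSpace 𝓘(ℝ, PontryaginModel n N) m =>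
      ((((pontryaginData B).dHomeo c m t).1, ((pontryaginData B).dHomeo c m t).2.2) :
        DualJetModel n N)) v w
    rw [h1]
    simp only [hw]
    exact extDeriv_modelCanonicalForm _ _ _ (fun μ => (D (eX μ)).1.2) V.1.2
      (Prod.ext hv rfl) (fun ν => Prod.ext (hD ν) rfl)
  obtain ⟨hE1, hE2⟩ := differentiableAt_fderiv_modelEnergy
    (r := (pontryaginData B).homeoOf c m) (differentiableAt_localLagrangian c η hL ht)
  have hE : (energyForm η L).d m (Matrix.vecCons v w) = fderiv ℝ
      (modelEnergy (localLagrangian c η L)) ((pontryaginData B).homeoOf c m) V := by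
    have hev : (energyForm η L).inChart ((pontryaginData B).homeoOf c) =ᶠ[𝓝
        ((pontryaginData B).homeoOf c m)] fun u => modelEnergy (localLagrangian c η L) u •
        (stdVol n).compContinuousLinearMap ((ContinuousLinearMap.fst ℝ (Base n) (Fib N)).comp
          (ContinuousLinearMap.fst ℝ _ _)) := by
      filter_upwards [((pontryaginData B).homeoOf c).open_target.mem_nhds
        (((pontryaginData B).homeoOf c).map_source hm)] with u hu
      exact inChart_energyForm c η L hu.1
    have hd := DiffForm.d_eq_of_mem_maximalAtlas (α := energyForm η L) (m := m)
      ((pontryaginData B).homeoOf_mem_maximalAtlas c) hm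
      ((differentiableAt_smul_stdVol _ hE1).congr_of_eventuallyEq hev)
    refine (DFunLike.congr_fun hd _).trans ?_
    change extDeriv ((energyForm η L).inChart ((pontryaginData B).homeoOf c))
      ((pontryaginData B).homeoOf c m) (fun i => (pontryaginData B).dHomeo c m
          (Matrix.vecCons v w i)) = _
    rw [hev.extDeriv_eq, map_vecCons]
    simp only [hw]
    exact extDeriv_smul_stdVol _ _ _ hE1 _ hv hD
  change omegaM B m (Matrix.vecCons v w) + (energyForm η L).d m (Matrix.vecCons v w) = _
  rw [hΘ, hE, hE2, modelEulerLagrange]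
  simp only [mul_sub, Finset.sum_sub_distrib, Finset.sum_add_distrib]
  ring

theorem IsVerticalField.dHomeo_fst
    {V : ∀ m : PontryaginBundle B, TangentSpace 𝓘(ℝ, PontryaginModel n N) m}
    (hV : IsVerticalField V) {c : FiberedChart B} {m : PontryaginBundle B}
    (hm : m.pt ∈ c.total.source) : ((pontryaginData B).dHomeo c m (V m)).1.1 = 0 := by
  have h1 := (pontryaginData B).mfderiv_toX hm (V m)
  rw [hV.2] at h1
  have h2 := congrArg (c.dBase (B.proj m.pt)) h1
  rw [c.dBase_dBaseInv (c.proj_mem _ hm)] at h2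
  exact h2.symm.trans (map_zero (c.dBase (B.proj m.pt)))

/-- The coefficient of `ψ^*(V ⌟ Ω_𝓔)` in fibred coordinates. -/
theorem topCoeff_pullback_contract (c : FiberedChart B) (η : VolumeForm n X) {L : JetBundle B → ℝ}
    (hL : ContMDiff 𝓘(ℝ, JetModel n N) 𝓘(ℝ, ℝ) ∞ L) {ψ : X → PontryaginBundle B}
    (hψ : IsSection ψ) {V : ∀ m : PontryaginBundle B, TangentSpace 𝓘(ℝ, PontryaginModel n N) m}
    (hV : IsVerticalField V) {x : X} (hm : (ψ x).pt ∈ c.total.source) :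
    topCoeff ((DiffForm.pullback (E := Base n) ψ
        (DiffForm.contract V (omegaE η L)) x).compContinuousLinearMap
          (c.dBaseInv x)) =
      modelEulerLagrange (localLagrangian c η L)
        (localRep c ψ (c.base x))
        (fderiv ℝ (localRep c ψ) (c.base x))
        ((pontryaginData B).dHomeo c (ψ x) (V (ψ x))) := by
  have hpx : B.proj (ψ x).pt = x := hψ.2 x
  have hx : x ∈ c.base.source := by
    have := c.proj_mem _ hm
    rwa [hpx] at this
  have hu : c.base x ∈ localDomain c ψ :=
    ⟨c.base.map_source hx, by rw [c.base.left_inv hx]; exact hm⟩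
  have hv := hV.dHomeo_fst hm
  refine (omegaE_apply c η hL hm (V (ψ x)) _ (fderiv ℝ (localRep c ψ) (c.base x)) hv
    (fun ν => dHomeo_mfderiv_section (hψ.1.mdifferentiableAt (by simp)) hx hm (eX ν))
    (fun ν => fderiv_localRep_base c hψ.1 hψ.2 hu _)).trans ?_
  rw [localRep, c.base.left_inv hx]

end Contraction

/-! ### The implicit Euler–Lagrange equations in coordinates -/

section Equations

variable [IsManifold (baseModel n) ∞ X] [IsManifold (𝓡 N) ∞ F]
  {B : SmoothFiberBundle n N X Y F}

/-- The implicit Euler–Lagrange equations in a fibred chart, in the weak form: the contraction of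
`Ω_𝓔` with every vertical vector vanishes along the section. -/
def WeakEulerLagrange (c : FiberedChart B) (η : VolumeForm n X) (L : JetBundle B → ℝ)
    (ψ : X → PontryaginBundle B) : Prop :=
  ∀ u ∈ localDomain c ψ, ∀ v : PontryaginModel n N, v.1.1 = 0 →
    modelEulerLagrange (localLagrangian c η L) (localRep c ψ u) (fderiv ℝ (localRep c ψ) u) v = 0

theorem sum_smul_eF {N : ℕ} (y : Fib N) : ∑ A, y A • (eF A : Fib N) = y := by
  ext A
  simp [Pi.single_apply]

theorem sum_smul_proj {n N : ℕ} (V : Base n →L[ℝ] Fib N) :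
    ∑ A, ∑ μ, V (eX μ) A • (EuclideanSpace.proj (𝕜 := ℝ) μ : Base n →L[ℝ] ℝ).smulRight
      (eF A : Fib N) = V := by
  ext x B
  have hx : x = ∑ μ, x μ • (eX μ : Base n) := (sum_smul_eF (N := n + 1) x).symm
  conv_rhs => rw [hx]
  simp only [map_sum, map_smul]
  simp [Pi.single_apply, mul_comm]

/-- The differential of a function of `(x, y, v)` on vertical vectors, by partial derivatives. -/
theorem fderiv_jet (Lc : JetModel n N → ℝ) (w : JetModel n N) (y : Fib N)
    (V : Base n →L[ℝ] Fib N) :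
    fderiv ℝ Lc w ((0, y), V) =
      ∑ A, partialY Lc A w * y A + ∑ A, ∑ μ, partialV Lc A μ w * V (eX μ) A := by
  have h1 : (((0, y), V) : JetModel n N) = ∑ A, y A • (((0, eF A), 0) : JetModel n N) +
      ∑ A, ∑ μ, V (eX μ) A • ((0, (EuclideanSpace.proj (𝕜 := ℝ) μ).smulRight (eF A)) :
        JetModel n N) := by
    refine Prod.ext (Prod.ext ?_ ?_) ?_
    · simp [Prod.fst_sum]
    · simp [Prod.fst_sum, Prod.snd_sum, sum_smul_eF]
    · rw [Prod.snd_add, Prod.snd_sum, Prod.snd_sum]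
      simp only [Prod.snd_sum, Prod.smul_snd, sum_smul_proj]
      rw [Finset.sum_eq_zero fun A _ => smul_zero _, zero_add]
  rw [h1, map_add, map_sum, map_sum]
  simp only [map_sum, map_smul, smul_eq_mul, partialY, partialV, mul_comm]

theorem fderiv_localY (c : FiberedChart B) {ψ : X → PontryaginBundle B} {u : Base n}
    (hd : DifferentiableAt ℝ (localRep c ψ) u) (A : Fin N) (v : Base n) :
    fderiv ℝ (localY c ψ A) u v = (fderiv ℝ (localRep c ψ) u v).1.2 A := by
  have h := (coordY n A).hasFDerivAt.comp u hd.hasFDerivAt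
  exact DFunLike.congr_fun h.fderiv v

theorem fderiv_localMomentum (c : FiberedChart B) {ψ : X → PontryaginBundle B} {u : Base n}
    (hd : DifferentiableAt ℝ (localRep c ψ) u) (A : Fin N) (μ : Fin (n + 1)) (v : Base n) :
    fderiv ℝ (localMomentum c ψ A μ) u v = (fderiv ℝ (localRep c ψ) u v).2.2.2 A μ := by
  have h := (coordP A μ).hasFDerivAt.comp u hd.hasFDerivAt
  exact DFunLike.congr_fun h.fderiv v

/-- The Euler–Lagrange expression on a vertical vector, with the three groups of equations as the
coefficients of `δp_A^μ`, `δy^A` and `δv^A_μ`. -/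
theorem modelEulerLagrange_eq (Lc : JetModel n N → ℝ) (r : PontryaginModel n N)
    (D : Base n →L[ℝ] PontryaginModel n N) {v : PontryaginModel n N} (hv : v.1.1 = 0) :
    modelEulerLagrange Lc r D v =
      ∑ A, ∑ μ, v.2.2.2 A μ * (r.2.1 (eX μ) A - (D (eX μ)).1.2 A) +
      ∑ A, (∑ μ, (D (eX μ)).2.2.2 A μ - partialY Lc A (r.1, r.2.1)) * v.1.2 A +
      ∑ A, ∑ μ, (r.2.2.2 A μ - partialV Lc A μ (r.1, r.2.1)) * v.2.1 (eX μ) A := by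
  have h1 : (v.1, v.2.1) = ((0, v.1.2), v.2.1) := Prod.ext (Prod.ext hv rfl) rfl
  rw [modelEulerLagrange, h1, fderiv_jet]
  simp only [sub_mul, Finset.sum_sub_distrib, Finset.sum_mul]
  ring

/-- For a section of zero energy, the weak form of the equations is equivalent to the implicit
Euler–Lagrange equations with the covariant Legendre transformation. The equation for `p` is the
vanishing of the energy. -/
theorem weakEulerLagrange_iff (c : FiberedChart B) (η : VolumeForm n X) (L : JetBundle B → ℝ)
    {ψ : X → PontryaginBundle B} (hψ : IsSection ψ) (hE : ∀ x, generalizedEnergy η L (ψ x) = 0) :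
    WeakEulerLagrange c η L ψ ↔ ImplicitEulerLagrange c η L ψ ∧ CovariantLegendre c η L ψ := by
  have hd : ∀ u ∈ localDomain c ψ, DifferentiableAt ℝ (localRep c ψ) u := fun u hu =>
    ((contDiffOn_localRep c hψ.1).contDiffAt
      ((isOpen_localDomain c hψ.1.continuous).mem_nhds hu)).differentiableAt (by simp)
  constructor
  · intro h
    have key : ∀ u ∈ localDomain c ψ, _ := fun u hu (v : PontryaginModel n N) (hv : v.1.1 = 0) =>
      (modelEulerLagrange_eq (localLagrangian c η L) _ _ hv).symm.trans (h u hu v hv)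
    have h1 : ∀ u ∈ localDomain c ψ, ∀ A μ,
        fderiv ℝ (localY c ψ A) u (eX μ) = localV c ψ A μ u := by
      intro u hu A μ
      -- the direction `∂/∂p_A^μ`
      have h1 := key u hu (0, 0, 0, Pi.single A (Pi.single μ 1)) rfl
      simp only [Prod.snd_zero, PiLp.zero_apply, mul_zero, Finset.sum_const_zero, add_zero,
        zero_apply] at h1
      rw [Finset.sum_eq_single A (fun b _ hb => by simp [hb]) (by simp),
        Finset.sum_eq_single μ (fun b _ hb => by simp [hb]) (by simp)] at h1
      simp only [Pi.single_eq_same, one_mul] at h1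
      rw [fderiv_localY c (hd u hu)]
      exact (sub_eq_zero.1 h1).symm
    have h2 : ∀ u ∈ localDomain c ψ, ∀ A, ∑ μ, fderiv ℝ (localMomentum c ψ A μ) u (eX μ) =
        partialY (localLagrangian c η L) A (localJet c ψ u) := by
      intro u hu A
      -- the direction `∂/∂y^A`
      have h1 := key u hu ((0, eF A), 0, 0, 0) rfl
      simp only [PiLp.zero_apply, mul_zero, Finset.sum_const_zero, add_zero, zero_add, zero_apply,
        Pi.zero_apply, zero_mul] at h1
      rw [Finset.sum_eq_single A (fun b _ hb => by simp [hb]) (by simp)] at h1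
      simp only [PiLp.single_apply, if_true, mul_one] at h1
      simp only [fderiv_localMomentum c (hd u hu)]
      exact sub_eq_zero.1 h1
    have h3 : ∀ u ∈ localDomain c ψ, ∀ A μ, localMomentum c ψ A μ u =
        partialV (localLagrangian c η L) A μ (localJet c ψ u) := by
      intro u hu A μ
      -- the direction `∂/∂v^A_μ`
      have h1 := key u hu (0, (EuclideanSpace.proj (𝕜 := ℝ) μ).smulRight (eF A), 0, 0) rfl
      simp only [Prod.snd_zero, PiLp.zero_apply, mul_zero, Finset.sum_const_zero,
        add_zero, zero_add, Pi.zero_apply, zero_mul] at h1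
      have hv : ∀ A' μ', ((EuclideanSpace.proj (𝕜 := ℝ) μ : Base n →L[ℝ] ℝ).smulRight
          (eF A : Fib N) (eX μ')) A' = if A' = A ∧ μ' = μ then 1 else 0 := fun A' μ' => by
        by_cases hA : A' = A <;> by_cases hμ : μ' = μ <;>
          simp [hA, hμ]
      simp only [hv] at h1
      rw [Finset.sum_eq_single A (fun b _ hb => by simp [hb]) (by simp),
        Finset.sum_eq_single μ (fun b _ hb => by simp [hb]) (by simp)] at h1
      simp only [and_self, if_true, mul_one] at h1
      exact sub_eq_zero.1 h1
    refine ⟨fun u hu => ⟨h1 u hu, h2 u hu, h3 u hu⟩, fun u hu => ⟨h3 u hu, ?_⟩⟩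
    -- with the other equations, `E = 0` determines `p`
    have h4 := generalizedEnergy_coord c η L hu.2
    rw [hE, zero_mul] at h4
    change modelEnergy (localLagrangian c η L) (localRep c ψ u) = 0 at h4
    have h5 : ∀ A μ, partialV (localLagrangian c η L) A μ (localJet c ψ u) * localV c ψ A μ u =
        (localRep c ψ u).2.2.2 A μ * (localRep c ψ u).2.1 (eX μ) A := fun A μ => by
      rw [← h3 u hu]; rfl
    simp only [h5]
    rw [modelEnergy] at h4
    change (localRep c ψ u).2.2.1 = localLagrangian c η L ((localRep c ψ u).1,
      (localRep c ψ u).2.1) - _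
    linarith
  · rintro ⟨h, -⟩ u hu v hv
    obtain ⟨h1, h2, h3⟩ := h u hu
    simp only [fderiv_localY c (hd u hu)] at h1
    simp only [fderiv_localMomentum c (hd u hu)] at h2
    have h1' : ∀ A μ, (localRep c ψ u).2.1 (eX μ) A -
        (fderiv ℝ (localRep c ψ) u (eX μ)).1.2 A = 0 := fun A μ => sub_eq_zero.2 (h1 A μ).symm
    have h2' : ∀ A, ∑ μ, (fderiv ℝ (localRep c ψ) u (eX μ)).2.2.2 A μ -
        partialY (localLagrangian c η L) A ((localRep c ψ u).1, (localRep c ψ u).2.1) = 0 :=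
      fun A => sub_eq_zero.2 (h2 A)
    have h3' : ∀ A μ, (localRep c ψ u).2.2.2 A μ -
        partialV (localLagrangian c η L) A μ ((localRep c ψ u).1, (localRep c ψ u).2.1) = 0 :=
      fun A μ => sub_eq_zero.2 (h3 A μ)
    rw [modelEulerLagrange_eq _ _ _ hv]
    simp [h1', h2', h3']

/-! ### Vertical vector fields -/

/-- A bump function on `Y` extends a vertical vector, constant in fibred coordinates, to a global
smooth vertical vector field. -/
theorem exists_verticalField [T2Space Y] [IsManifold (totalModel n N) ∞ Y]
    (c : FiberedChart B) {m : PontryaginBundle B}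
    (hm : m.pt ∈ c.total.source) {v : PontryaginModel n N} (hv : v.1.1 = 0) :
    ∃ V, IsVerticalField V ∧ (pontryaginData B).dHomeo c m (V m) = v := by
  obtain ⟨f, -, hf⟩ := (SmoothBumpFunction.nhds_basis_tsupport (I := totalModel n N)
    m.pt).mem_iff.1 (c.total.open_source.mem_nhds hm)
  let χ : PontryaginBundle B → ℝ := fun m' => f m'.pt
  have hχ : ContMDiff 𝓘(ℝ, PontryaginModel n N) 𝓘(ℝ, ℝ) ∞ χ :=
    f.contMDiff.comp (pontryaginData B).contMDiff_toY
  have hsupp : tsupport χ ⊆ ((pontryaginData B).homeoOf c).source :=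
    (tsupport_comp_subset_preimage f (pontryaginData B).continuous_toY).trans
      (preimage_mono hf)
  let V : ∀ m' : PontryaginBundle B, TangentSpace 𝓘(ℝ, PontryaginModel n N) m' :=
    χ • fun m' => (pontryaginData B).dHomeoInv c m' v
  refine ⟨V, ⟨?_, ?_⟩, ?_⟩
  · refine ContMDiffOn.smul_section_of_tsupport hχ.contMDiffOn
      ((pontryaginData B).homeoOf c).open_source hsupp fun m' hm' => ?_
    refine ContMDiffAt.contMDiffWithinAt ?_
    have hv : ContMDiff 𝓘(ℝ, PontryaginModel n N) 𝓘(ℝ, PontryaginModel n N).tangent ∞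
        (fun w => (⟨w, v⟩ : TangentBundle 𝓘(ℝ, PontryaginModel n N) (PontryaginModel n N))) :=
      contMDiff_vectorSpace_iff_contDiff.2 contDiff_const
    have hd := (pontryaginData B).mdiff_homeoOf c
    have h1 := ContMDiffAt.mpullback_vectorField_preimage (I := 𝓘(ℝ, PontryaginModel n N))
      (I' := 𝓘(ℝ, PontryaginModel n N)) (f := (pontryaginData B).homeoOf c) (x₀ := m') (m := ∞)
      (n := ∞) hv.contMDiffAt
      (((pontryaginData B).contMDiffOn_homeoOf c).contMDiffAt
        (((pontryaginData B).homeoOf c).open_source.mem_nhds hm')) ⟨hd.mfderiv hm', rfl⟩ (by simp)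
    refine h1.congr_of_eventuallyEq ?_
    filter_upwards [((pontryaginData B).homeoOf c).open_source.mem_nhds hm'] with m₁ hm₁
    refine congrArg (Bundle.TotalSpace.mk m₁) ?_
    exact (DFunLike.congr_fun (ContinuousLinearMap.inverse_equiv (hd.mfderiv hm₁)) v).symm
  · intro m'
    by_cases hm' : m'.pt ∈ c.total.source
    · refine ((pontryaginData B).mfderiv_toX hm' (V m')).trans ?_
      have h1 : (pontryaginData B).dHomeo c m' (V m') = χ m' • v :=
        (map_smul _ _ _).trans (congrArg _ ((pontryaginData B).dHomeo_dHomeoInv hm' v))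
      rw [h1, Prod.smul_fst, Prod.smul_fst, hv, smul_zero]
      exact map_zero (c.dBaseInv (B.proj m'.pt))
    · have h1 : χ m' = 0 := image_eq_zero_of_notMem_tsupport fun h => hm' (hsupp h)
      have h2 : V m' = 0 := by
        change χ m' • (pontryaginData B).dHomeoInv c m' v = _
        rw [h1, zero_smul]
      rw [h2]
      exact map_zero _
  · have h1 : χ m = 1 := f.eq_one
    change (pontryaginData B).dHomeo c m (χ m • (pontryaginData B).dHomeoInv c m v) = v
    rw [h1, one_smul, (pontryaginData B).dHomeo_dHomeoInv hm]

theorem weakEulerLagrange_of_pullback_contract [T2Space Y] [IsManifold (totalModel n N) ∞ Y]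
    (η : VolumeForm n X) {L : JetBundle B → ℝ}
    (hL : ContMDiff 𝓘(ℝ, JetModel n N) 𝓘(ℝ, ℝ) ∞ L) {ψ : X → PontryaginBundle B}
    (hψ : IsSection ψ) (c : FiberedChart B) (hc : ∀ V, IsVerticalField V →
      DiffForm.pullback (E := Base n) ψ (DiffForm.contract V (omegaE η L)) = 0) :
    WeakEulerLagrange c η L ψ := by
  intro u hu v hv
  obtain ⟨x, hx, rfl⟩ : ∃ x ∈ c.base.source, c.base x = u :=
    ⟨c.base.symm u, c.base.map_target hu.1, c.base.right_inv hu.1⟩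
  have hm : (ψ x).pt ∈ c.total.source := by
    have := hu.2
    rwa [c.base.left_inv hx] at this
  obtain ⟨V, hV, rfl⟩ := exists_verticalField c hm hv
  rw [← topCoeff_pullback_contract c η hL hψ hV hm, hc V hV]
  rfl

theorem pullback_contract_eq_zero (η : VolumeForm n X) {L : JetBundle B → ℝ}
    (hL : ContMDiff 𝓘(ℝ, JetModel n N) 𝓘(ℝ, ℝ) ∞ L) {ψ : X → PontryaginBundle B}
    (hψ : IsSection ψ) (hc : ∀ x, ∃ c : FiberedChart B, (ψ x).pt ∈ c.total.source ∧
      WeakEulerLagrange c η L ψ) {V} (hV : IsVerticalField V) :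
    DiffForm.pullback (E := Base n) ψ (DiffForm.contract V (omegaE η L)) = 0 := by
  funext x
  obtain ⟨c, hm, hw⟩ := hc x
  have hpx : B.proj (ψ x).pt = x := hψ.2 x
  have hx : x ∈ c.base.source := hpx ▸ c.proj_mem _ hm
  have hu : c.base x ∈ localDomain c ψ :=
    ⟨c.base.map_source hx, by rw [c.base.left_inv hx]; exact hm⟩
  have hv := hV.dHomeo_fst hm
  have h1 := topCoeff_pullback_contract c η hL hψ hV hm
  rw [hw _ hu _ hv] at h1
  have h2 := eq_topCoeff_smul ((DiffForm.pullback (E := Base n) ψ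
        (DiffForm.contract V (omegaE η L)) x).compContinuousLinearMap (c.dBaseInv x))
  rw [h1, zero_smul] at h2
  ext w
  have h3 := DFunLike.congr_fun h2 (fun i => c.dBase x (w i))
  refine Eq.trans (congrArg _ (funext fun i => ?_)) h3
  exact (c.dBaseInv_dBase hx (w i)).symm

end Equations

/-! ### Integration of densities -/

section Integration

open MeasureTheory

variable [T2Space X] [SigmaCompactSpace X] [IsManifold (baseModel n) ∞ X]

theorem chartPartition_isSubordinate (i : X) :
    tsupport (chartPartition n X i) ⊆ (chartAt (Base n) i).source :=
  (SmoothPartitionOfUnity.exists_isSubordinate_chartAt_source (baseModel n) X).choose_spec i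

/-- The weight with which the density of a form is integrated in a chart. -/
def chartWeight (η : VolumeForm n X) (i : X) (u : Base n) : ℝ :=
  chartPartition n X i ((chartAt (Base n) i).symm u) * |volCoeff η (chartAt (Base n) i) u|

/-- The integral over `U` of a function, with respect to the measure of the volume form. -/
def integralDensity (η : VolumeForm n X) (U : Set X) (f : X → ℝ) : ℝ :=
  ∑ᶠ i : X, ∫ u in (chartAt (Base n) i).target ∩ (chartAt (Base n) i).symm ⁻¹' U,
    chartWeight η i u * f ((chartAt (Base n) i).symm u)

theorem integralOn_eq (η : VolumeForm n X) (U : Set X) (α : DiffForm (Base n) X (n + 1)) :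
    integralOn η U α = integralDensity η U (density η α) := by
  refine finsum_congr fun i => ?_
  congr 1
  funext u
  rw [topCoeff_inChart η α, chartWeight, ← sign_mul_self (volCoeff η (chartAt (Base n) i) u)]
  change _ * (((SignType.sign (volCoeff η (chartAt (Base n) i) u)) : ℝ) * _) = _
  ring

theorem continuousOn_chartWeight (η : VolumeForm n X) (i : X) :
    ContinuousOn (chartWeight η i) (chartAt (Base n) i).target := by
  refine ContinuousOn.mul ?_ ?_
  · exact (chartPartition n X i).contMDiff.continuous.comp_continuousOn
      (chartAt (Base n) i).continuousOn_symm
  · exact (contDiffOn_volCoeff η (IsSmoothChart.chartAt i)).continuousOn.abs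

/-- The compact set of coordinates which contributes to the integral over `U` in a chart. -/
def chartCore (n : ℕ) {X : Type*} [TopologicalSpace X] [ChartedSpace (Base n) X]
    [T2Space X] [SigmaCompactSpace X] [IsManifold (baseModel n) ∞ X] (U : Set X) (i : X) :
    Set (Base n) :=
  chartAt (Base n) i '' (U ∩ tsupport (chartPartition n X i))

theorem chartCore_subset (U : Set X) (i : X) :
    chartCore n U i ⊆ (chartAt (Base n) i).target ∩ (chartAt (Base n) i).symm ⁻¹' U := by
  rintro _ ⟨x, hx, rfl⟩
  have hs := chartPartition_isSubordinate i hx.2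
  refine ⟨(chartAt (Base n) i).map_source hs, ?_⟩
  rw [mem_preimage, (chartAt (Base n) i).left_inv hs]
  exact hx.1

theorem isCompact_chartCore {U : Set X} (hU : IsCompact U) (i : X) :
    IsCompact (chartCore n U i) :=
  (hU.inter_right (isClosed_tsupport _)).image_of_continuousOn
    ((chartAt (Base n) i).continuousOn.mono fun _ hx => chartPartition_isSubordinate i hx.2)

theorem chartWeight_eq_zero (η : VolumeForm n X) {U : Set X} {i : X} {u : Base n}
    (hu : u ∈ ((chartAt (Base n) i).target ∩ (chartAt (Base n) i).symm ⁻¹' U) \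
      chartCore n U i) : chartWeight η i u = 0 := by
  have h : (chartAt (Base n) i).symm u ∉ tsupport (chartPartition n X i) := fun h =>
    hu.2 ⟨_, ⟨hu.1.2, h⟩, (chartAt (Base n) i).right_inv hu.1.1⟩
  rw [chartWeight, image_eq_zero_of_notMem_tsupport h, zero_mul]

theorem measurableSet_chart_preimage {e : OpenPartialHomeomorph X (Base n)} {U : Set X}
    (hU : IsClosed U) : MeasurableSet (e.target ∩ e.symm ⁻¹' U) := by
  have h : e.target ∩ e.symm ⁻¹' U = e.target \ (e.target ∩ e.symm ⁻¹' Uᶜ) := by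
    ext u
    simp only [mem_inter_iff, mem_preimage, mem_sdiff, mem_compl_iff, not_and, not_not]
    tauto
  rw [h]
  exact e.open_target.measurableSet.diff
    (e.isOpen_inter_preimage_symm hU.isOpen_compl).measurableSet

theorem finite_chartPartition_inter (n : ℕ) {X : Type*} [TopologicalSpace X]
    [ChartedSpace (Base n) X] [T2Space X] [SigmaCompactSpace X] [IsManifold (baseModel n) ∞ X]
    {U : Set X} (hU : IsCompact U) :
    {i | (Function.support (chartPartition n X i) ∩ U).Nonempty}.Finite :=
  (chartPartition n X).locallyFinite.finite_nonempty_inter_compact hU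

/-- Only finitely many charts contribute to the integral over a compact set. -/
theorem integralDensity_eq_sum (η : VolumeForm n X) {U : Set X} (hU : IsCompact U) (f : X → ℝ) :
    integralDensity η U f = ∑ i ∈ (finite_chartPartition_inter n hU).toFinset,
      ∫ u in (chartAt (Base n) i).target ∩ (chartAt (Base n) i).symm ⁻¹' U,
        chartWeight η i u * f ((chartAt (Base n) i).symm u) := by
  refine finsum_eq_sum_of_support_subset _ fun i hi => ?_
  rw [Finite.coe_toFinset]
  by_contra hne
  refine hi ?_
  refine setIntegral_eq_zero_of_forall_eq_zero fun u hu => ?_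
  have h : chartPartition n X i ((chartAt (Base n) i).symm u) = 0 := by
    by_contra h
    exact hne ⟨_, h, hu.2⟩
  simp [chartWeight, h]

theorem integralDensity_eq_sum_core (η : VolumeForm n X) {U : Set X} (hU : IsCompact U)
    (f : X → ℝ) :
    integralDensity η U f = ∑ i ∈ (finite_chartPartition_inter n hU).toFinset,
      ∫ u in chartCore n U i, chartWeight η i u * f ((chartAt (Base n) i).symm u) := by
  rw [integralDensity_eq_sum η hU]
  refine Finset.sum_congr rfl fun i _ => ?_
  refine setIntegral_eq_of_subset_of_forall_sdiff_eq_zero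
    (measurableSet_chart_preimage hU.isClosed) (chartCore_subset U i) fun u hu => ?_
  rw [chartWeight_eq_zero η hu, zero_mul]

theorem integralDensity_finset_sum (η : VolumeForm n X) {U : Set X} (hU : IsCompact U)
    {ι : Type*} (J : Finset ι) {g : ι → X → ℝ} (hg : ∀ j ∈ J, Continuous (g j)) :
    integralDensity η U (fun x => ∑ j ∈ J, g j x) = ∑ j ∈ J, integralDensity η U (g j) := by
  simp only [integralDensity_eq_sum_core η hU]
  rw [Finset.sum_comm]
  refine Finset.sum_congr rfl fun i _ => ?_
  simp only [Finset.mul_sum]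
  refine integral_finsetSum _ fun j hj => ?_
  refine ContinuousOn.integrableOn_compact (isCompact_chartCore hU i) ?_
  have hsub : chartCore n U i ⊆ (chartAt (Base n) i).target := fun u hu =>
    (chartCore_subset U i hu).1
  exact ((continuousOn_chartWeight η i).mono hsub).mul
    ((hg j hj).comp_continuousOn ((chartAt (Base n) i).continuousOn_symm.mono hsub))

/-- Differentiation under the integral over a compact set. -/
theorem hasDerivAt_integralDensity (η : VolumeForm n X) {U : Set X} (hU : IsCompact U) {ε : ℝ}
    (hε : 0 < ε) {f f' : ℝ → X → ℝ}
    (hf : ContinuousOn (fun s : ℝ × X => f s.1 s.2) (Ioo (-ε) ε ×ˢ univ))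
    (hf' : ContinuousOn (fun s : ℝ × X => f' s.1 s.2) (Ioo (-ε) ε ×ˢ univ))
    (hd : ∀ t ∈ Ioo (-ε) ε, ∀ x, HasDerivAt (fun t => f t x) (f' t x) t) :
    HasDerivAt (fun t => integralDensity η U (f t)) (integralDensity η U (f' 0)) 0 := by
  simp only [integralDensity_eq_sum_core η hU]
  refine HasDerivAt.fun_sum fun i _ => ?_
  set K := chartCore n U i
  have hK : IsCompact K := isCompact_chartCore hU i
  have hsub : K ⊆ (chartAt (Base n) i).target := fun u hu => (chartCore_subset U i hu).1
  have hcont : ∀ g : ℝ → X → ℝ, ContinuousOn (fun s : ℝ × X => g s.1 s.2) (Ioo (-ε) ε ×ˢ univ) →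
      ContinuousOn (fun s : ℝ × Base n => chartWeight η i s.2 *
        g s.1 ((chartAt (Base n) i).symm s.2)) (Ioo (-ε) ε ×ˢ K) := by
    intro g hg
    refine ContinuousOn.mul (((continuousOn_chartWeight η i).mono hsub).comp
      continuousOn_snd fun s hs => hs.2) ?_
    refine hg.comp (f := fun s : ℝ × Base n => (s.1, (chartAt (Base n) i).symm s.2))
      (continuousOn_fst.prodMk (((chartAt (Base n) i).continuousOn_symm.mono hsub).comp
        continuousOn_snd fun s hs => hs.2)) fun s hs => ⟨hs.1, mem_univ _⟩
  have hcont1 : ∀ g : ℝ → X → ℝ, ContinuousOn (fun s : ℝ × X => g s.1 s.2) (Ioo (-ε) ε ×ˢ univ) →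
      ∀ t ∈ Ioo (-ε) ε, ContinuousOn (fun u => chartWeight η i u *
        g t ((chartAt (Base n) i).symm u)) K := fun g hg t ht =>
    (hcont g hg).comp (f := fun u => (t, u)) (by fun_prop) fun u hu => ⟨ht, hu⟩
  have h0 : (0 : ℝ) ∈ Ioo (-ε) ε := ⟨by linarith, hε⟩
  -- a compact interval of parameters, on which the derivative is bounded
  have hsub2 : Icc (-(ε / 2)) (ε / 2) ⊆ Ioo (-ε) ε := fun t ht =>
    ⟨by linarith [ht.1], by linarith [ht.2]⟩
  obtain ⟨C, hC⟩ := (isCompact_Icc (a := -(ε / 2)) (b := ε / 2)).prod hK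
    |>.exists_bound_of_continuousOn ((hcont f' hf').mono (prod_mono hsub2 Subset.rfl))
  refine (hasDerivAt_integral_of_dominated_loc_of_deriv_le (μ := volume.restrict K)
    (s := Icc (-(ε / 2)) (ε / 2)) (bound := fun _ => C)
    (F := fun t u => chartWeight η i u * f t ((chartAt (Base n) i).symm u))
    (F' := fun t u => chartWeight η i u * f' t ((chartAt (Base n) i).symm u))
    (Icc_mem_nhds (by linarith) (by linarith)) ?_ ?_ ?_ ?_ ?_ ?_).2
  · filter_upwards [Ioo_mem_nhds h0.1 h0.2] with t ht
    exact (hcont1 f hf t ht).aestronglyMeasurable hK.measurableSet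
  · exact (hcont1 f hf 0 h0).integrableOn_compact hK
  · exact (hcont1 f' hf' 0 h0).aestronglyMeasurable hK.measurableSet
  · exact ae_restrict_of_forall_mem hK.measurableSet fun u hu t ht => hC (t, u) ⟨ht, hu⟩
  · exact integrableOn_const hK.measure_lt_top.ne
  · exact ae_restrict_of_forall_mem hK.measurableSet fun u hu t ht =>
      (hd t (hsub2 ht) _).const_mul _

/-- The integral of a function supported in the domain of a chart is computed in that chart, by
the change of variables formula. -/
theorem integralDensity_eq_chart (η : VolumeForm n X) {U K : Set X} (hU : IsCompact U)
    (hK : IsCompact K) {e : OpenPartialHomeomorph X (Base n)} (he : IsSmoothChart e)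
    (hKe : K ⊆ e.source) (hKU : K ⊆ U) {f : X → ℝ} (hf : Continuous f) (hfK : ∀ x ∉ K, f x = 0) :
    integralDensity η U f = ∫ u in e.target, f (e.symm u) * |volCoeff η e u| := by
  set G : Base n → ℝ := fun u => f (e.symm u) * |volCoeff η e u| with hG
  set ρ := chartPartition n X
  -- each term of the partition of unity is moved to the chart `e`
  have hpiece : ∀ i : X, ∫ u in (chartAt (Base n) i).target ∩ (chartAt (Base n) i).symm ⁻¹' U,
      chartWeight η i u * f ((chartAt (Base n) i).symm u) =
      ∫ u in e.target, ρ i (e.symm u) * G u := by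
    intro i
    set φ := chartAt (Base n) i with hφ
    have hφs : IsSmoothChart φ := IsSmoothChart.chartAt i
    set T := e.target ∩ e.symm ⁻¹' φ.source with hT
    have hTo : IsOpen T := isOpen_change
    have h1 : ∫ u in φ.target ∩ φ.symm ⁻¹' U, chartWeight η i u * f (φ.symm u) =
        ∫ u in φ.target, chartWeight η i u * f (φ.symm u) :=
      (setIntegral_eq_of_subset_of_forall_sdiff_eq_zero φ.open_target.measurableSet
        inter_subset_left fun u hu => by
          rw [hfK _ fun h => hu.2 ⟨hu.1, hKU h⟩, mul_zero]).symm
    have h2 : ∫ u in φ.target ∩ φ.symm ⁻¹' e.source, chartWeight η i u * f (φ.symm u) =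
        ∫ u in φ.target, chartWeight η i u * f (φ.symm u) :=
      (setIntegral_eq_of_subset_of_forall_sdiff_eq_zero φ.open_target.measurableSet
        inter_subset_left fun u hu => by
          rw [hfK _ fun h => hu.2 ⟨hu.1, hKe h⟩, mul_zero]).symm
    have himg : φ.target ∩ φ.symm ⁻¹' e.source = (φ ∘ e.symm) '' T := by
      ext u
      constructor
      · rintro ⟨hu1, hu2⟩
        refine ⟨e (φ.symm u), ⟨e.map_source hu2, ?_⟩, ?_⟩
        · rw [mem_preimage, e.left_inv hu2]
          exact φ.map_target hu1
        · rw [Function.comp_apply, e.left_inv hu2, φ.right_inv hu1]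
      · rintro ⟨w, ⟨hw1, hw2⟩, rfl⟩
        refine ⟨φ.map_source hw2, ?_⟩
        rw [mem_preimage, Function.comp_apply, φ.left_inv hw2]
        exact e.map_target hw1
    have hinj : InjOn (φ ∘ e.symm) T := fun a ha b hb hab =>
      e.symm.injOn ha.1 hb.1 (φ.injOn ha.2 hb.2 hab)
    have hder : ∀ u ∈ T, HasFDerivWithinAt (φ ∘ e.symm) (fderiv ℝ (φ ∘ e.symm) u) T u := fun u hu =>
      (((he.contDiffOn_change hφs).contDiffAt (hTo.mem_nhds hu)).differentiableAt
        (by simp)).hasFDerivAt.hasFDerivWithinAt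
    have h3 := integral_image_eq_integral_abs_det_fderiv_smul volume hTo.measurableSet hder hinj
      (fun u => chartWeight η i u * f (φ.symm u))
    have h4 : ∫ u in T, |(fderiv ℝ (φ ∘ e.symm) u).det| •
        (chartWeight η i ((φ ∘ e.symm) u) * f (φ.symm ((φ ∘ e.symm) u))) =
        ∫ u in T, ρ i (e.symm u) * G u := by
      refine setIntegral_congr_fun hTo.measurableSet fun u hu => ?_
      have h5 : φ.symm (φ (e.symm u)) = e.symm u := φ.left_inv hu.2
      simp only [Function.comp_apply, chartWeight, ← hφ, h5, hG, smul_eq_mul,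
        volCoeff_change η he hφs hu, abs_mul]
      ring
    have h6 : ∫ u in T, ρ i (e.symm u) * G u = ∫ u in e.target, ρ i (e.symm u) * G u :=
      (setIntegral_eq_of_subset_of_forall_sdiff_eq_zero e.open_target.measurableSet
        inter_subset_left fun u hu => by
          have h7 : e.symm u ∉ tsupport (ρ i) := fun h =>
            hu.2 ⟨hu.1, chartPartition_isSubordinate i h⟩
          rw [image_eq_zero_of_notMem_tsupport h7, zero_mul]).symm
    rw [h1, ← h2, himg, h3, h4, h6]
  rw [integralDensity_eq_sum η hU]
  simp only [hpiece]
  have hKc : IsCompact (e '' K) := hK.image_of_continuousOn (e.continuousOn.mono hKe)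
  have hKt : e '' K ⊆ e.target := by
    rintro _ ⟨x, hx, rfl⟩
    exact e.map_source (hKe hx)
  have hGz : ∀ u ∈ e.target \ e '' K, G u = 0 := fun u hu => by
    have h8 : e.symm u ∉ K := fun h => hu.2 ⟨_, h, e.right_inv hu.1⟩
    simp only [hG, hfK _ h8, zero_mul]
  rw [← integral_finsetSum]
  · refine setIntegral_congr_fun e.open_target.measurableSet fun u hu => ?_
    change ∑ i ∈ _, ρ i (e.symm u) * G u = G u
    by_cases hx : e.symm u ∈ K
    · rw [← Finset.sum_mul, ρ.sum_finsupport' (e.symm u) (mem_univ _), one_mul]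
      intro i hi
      rw [Finite.mem_toFinset]
      exact ⟨_, (ρ.mem_finsupport _).1 hi, hKU hx⟩
    · simp only [hG, hfK _ hx, zero_mul, mul_zero, Finset.sum_const_zero]
  · intro i _
    have hc : ContinuousOn (fun u => ρ i (e.symm u) * G u) e.target :=
      ((ρ i).contMDiff.continuous.comp_continuousOn e.continuousOn_symm).mul
        ((hf.comp_continuousOn e.continuousOn_symm).mul
          (contDiffOn_volCoeff η he).continuousOn.abs)
    exact ((hc.mono hKt).integrableOn_compact hKc).of_forall_sdiff_eq_zero
      e.open_target.measurableSet fun u hu => by simp only [hGz u hu, mul_zero]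

end Integration

/-! ### The first variation on the model space -/

theorem modelDensity_eq (Lc : JetModel n N → ℝ) (r : PontryaginModel n N)
    (D : Base n →L[ℝ] PontryaginModel n N) :
    modelDensity Lc r D = ∑ A, ∑ μ, coordP A μ r * (coordY n A (D (eX μ)) - coordV A μ r) +
      Lc (coordJet n N r) := rfl

theorem modelEulerLagrange_coord (Lc : JetModel n N → ℝ) (r : PontryaginModel n N)
    (D : Base n →L[ℝ] PontryaginModel n N) (v : PontryaginModel n N) :
    modelEulerLagrange Lc r D v =
      ∑ A, ∑ μ, coordP A μ v * (coordV A μ r - coordY n A (D (eX μ))) +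
      ∑ A, ∑ μ, coordP A μ (D (eX μ)) * coordY n A v +
      ∑ A, ∑ μ, coordP A μ r * coordV A μ v - fderiv ℝ Lc (coordJet n N r) (coordJet n N v) := rfl

/-- The flux `p_A^μ δy^A` of a variation `δ`. -/
def flux (r δ : PontryaginModel n N) (μ : Fin (n + 1)) : ℝ := ∑ A, coordP A μ r * coordY n A δ

section Family

variable {E G : Type*} [NormedAddCommGroup E] [NormedSpace ℝ E] [NormedAddCommGroup G]
  [NormedSpace ℝ G] {R : ℝ × G → E} {t : ℝ} {u : G}

theorem hasDerivAt_family (h : DifferentiableAt ℝ R (t, u)) :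
    HasDerivAt (fun t => R (t, u)) (fderiv ℝ R (t, u) (1, 0)) t :=
  HasFDerivAt.comp_hasDerivAt (f := fun t => (t, u)) t h.hasFDerivAt
    ((hasDerivAt_id t).prodMk (hasDerivAt_const t u))

theorem hasFDerivAt_family (h : DifferentiableAt ℝ R (t, u)) :
    HasFDerivAt (fun u => R (t, u)) ((fderiv ℝ R (t, u)).comp (ContinuousLinearMap.inr ℝ ℝ G)) u :=
  HasFDerivAt.comp (f := fun u => (t, u)) u h.hasFDerivAt (hasFDerivAt_prodMk_right t u)

theorem eventually_differentiableAt (hR : ContDiffAt ℝ ∞ R (t, u)) :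
    ∀ᶠ s in 𝓝 (t, u), DifferentiableAt ℝ R s :=
  ((hR.of_le (m := 1) (by exact_mod_cast le_top)).eventually (by simp)).mono fun s hs =>
    hs.differentiableAt (by simp)

theorem differentiableAt_fderiv (hR : ContDiffAt ℝ ∞ R (t, u)) :
    DifferentiableAt ℝ (fderiv ℝ R) (t, u) :=
  (hR.fderiv_right (m := ∞) (by simp)).differentiableAt (by simp)

theorem hasDerivAt_fderiv_family (hR : ContDiffAt ℝ ∞ R (t, u)) (w : G) :
    HasDerivAt (fun t => fderiv ℝ (fun u' => R (t, u')) u w)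
      (fderiv ℝ (fderiv ℝ R) (t, u) (1, 0) (0, w)) t := by
  have ht : Filter.Tendsto (fun t : ℝ => (t, u)) (𝓝 t) (𝓝 (t, u)) :=
    (Continuous.prodMk continuous_id continuous_const).tendsto t
  have h2 : HasDerivAt (fun t => fderiv ℝ R (t, u) (0, w))
      (fderiv ℝ (fderiv ℝ R) (t, u) (1, 0) (0, w)) t := by
    simpa using (hasDerivAt_family (differentiableAt_fderiv hR)).clm_apply
      (hasDerivAt_const t ((0 : ℝ), w))
  refine h2.congr_of_eventuallyEq ?_
  filter_upwards [ht.eventually (eventually_differentiableAt hR)] with t ht'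
  rw [(hasFDerivAt_family ht').fderiv]
  rfl

theorem hasFDerivAt_deriv_family (hR : ContDiffAt ℝ ∞ R (t, u)) :
    HasFDerivAt (fun u' => deriv (fun t => R (t, u')) t)
      (((fderiv ℝ (fderiv ℝ R) (t, u)).comp (ContinuousLinearMap.inr ℝ ℝ G)).flip (1, 0)) u := by
  have hu : Filter.Tendsto (fun u' : G => (t, u')) (𝓝 u) (𝓝 (t, u)) :=
    (Continuous.prodMk continuous_const continuous_id).tendsto u
  have h2 := (hasFDerivAt_family (differentiableAt_fderiv hR)).clm_apply
    (hasFDerivAt_const ((1 : ℝ), (0 : G)) u)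
  refine HasFDerivAt.congr_of_eventuallyEq (f := fun u' => fderiv ℝ R (t, u') (1, 0)) ?_ ?_
  · simpa using h2
  · filter_upwards [hu.eventually (eventually_differentiableAt hR)] with u' hu'
    exact (hasDerivAt_family hu').deriv

end Family

/-- The product rule behind the first variation formula, for given derivatives `δ` and `D'` of a
point of the model space and of the differential of a section. -/
theorem hasDerivAt_modelDensity_aux {Lc : JetModel n N → ℝ} {r : ℝ → PontryaginModel n N}
    {D : ℝ → Base n →L[ℝ] PontryaginModel n N} {δ : PontryaginModel n N}
    {D' : Base n → PontryaginModel n N} (hr : HasDerivAt r δ 0)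
    (hD : ∀ w, HasDerivAt (fun t => D t w) (D' w) 0)
    (hL : DifferentiableAt ℝ Lc (coordJet n N (r 0))) :
    HasDerivAt (fun t => modelDensity Lc (r t) (D t))
      (∑ A, ∑ μ, (coordP A μ δ * (coordY n A (D 0 (eX μ)) - coordV A μ (r 0)) +
        coordP A μ (r 0) * (coordY n A (D' (eX μ)) - coordV A μ δ)) +
      fderiv ℝ Lc (coordJet n N (r 0)) (coordJet n N δ)) 0 := by
  have hc : ∀ {H : Type} [NormedAddCommGroup H] [NormedSpace ℝ H]
      (P : PontryaginModel n N →L[ℝ] H) {f : ℝ → PontryaginModel n N} {f' : PontryaginModel n N},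
      HasDerivAt f f' 0 → HasDerivAt (fun t => P (f t)) (P f') 0 := fun P _ _ hf =>
    P.hasFDerivAt.comp_hasDerivAt (0 : ℝ) hf
  simp only [modelDensity_eq]
  refine HasDerivAt.add (HasDerivAt.fun_sum fun A _ => HasDerivAt.fun_sum fun μ _ => ?_) ?_
  · exact (hc _ hr).mul ((hc _ (hD (eX μ))).sub (hc _ hr))
  · exact HasFDerivAt.comp_hasDerivAt (f := fun t => coordJet n N (r t)) (0 : ℝ)
      hL.hasFDerivAt (hc _ hr)

theorem fderiv_flux {r δ : Base n → PontryaginModel n N}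
    {D D' : Base n →L[ℝ] PontryaginModel n N} {u : Base n} (hr : HasFDerivAt r D u)
    (hδ : HasFDerivAt δ D' u) (μ : Fin (n + 1)) (w : Base n) :
    fderiv ℝ (fun u' => flux (r u') (δ u') μ) u w =
      ∑ A, (coordP A μ (r u) * coordY n A (D' w) + coordY n A (δ u) * coordP A μ (D w)) := by
  have h1 : HasFDerivAt (fun u' => flux (r u') (δ u') μ) (∑ A,
      (coordP A μ (r u) • (coordY n A).comp D' + coordY n A (δ u) • (coordP A μ).comp D)) u :=
    HasFDerivAt.fun_sum fun A _ => HasFDerivAt.mul (c := fun u => coordP A μ (r u))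
      (d := fun u => coordY n A (δ u)) ((coordP A μ).hasFDerivAt.comp u hr)
      ((coordY n A).hasFDerivAt.comp u hδ)
  rw [h1.fderiv, sum_apply]
  rfl

theorem firstVariation_sum {ι κ : Type*} [Fintype ι] [Fintype κ] (a b v p b' v' p' : ι → κ → ℝ)
    (y : ι → ℝ) (l : ℝ) :
    ∑ A, ∑ μ, (a A μ * (b A μ - v A μ) + p A μ * (b' A μ - v' A μ)) + l =
      -(∑ A, ∑ μ, a A μ * (v A μ - b A μ) + ∑ A, ∑ μ, p' A μ * y A + ∑ A, ∑ μ, p A μ * v' A μ - l) +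
        ∑ μ, ∑ A, (p A μ * b' A μ + y A * p' A μ) := by
  rw [Finset.sum_comm (s := (Finset.univ : Finset κ))]
  simp only [mul_sub, Finset.sum_sub_distrib, Finset.sum_add_distrib, mul_comm (y _)]
  ring

/-- The first variation formula: the derivative of the density of the action is the
Euler–Lagrange expression in the direction of the variation, up to sign, plus the divergence of
the flux. It rests on the symmetry of the second derivative of the family. -/
theorem hasDerivAt_modelDensity {Lc : JetModel n N → ℝ} {R : ℝ × Base n → PontryaginModel n N}
    {u : Base n} (hR : ContDiffAt ℝ ∞ R (0, u))
    (hL : DifferentiableAt ℝ Lc (coordJet n N (R (0, u)))) :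
    HasDerivAt (fun t => modelDensity Lc (R (t, u)) (fderiv ℝ (fun u' => R (t, u')) u))
      (-modelEulerLagrange Lc (R (0, u)) (fderiv ℝ (fun u' => R (0, u')) u)
          (deriv (fun t => R (t, u)) 0) +
        ∑ μ, fderiv ℝ (fun u' => flux (R (0, u')) (deriv (fun t => R (t, u')) 0) μ) u (eX μ))
      0 := by
  have hR0 := (eventually_differentiableAt hR).self_of_nhds
  have hsymm : ∀ a b, fderiv ℝ (fderiv ℝ R) (0, u) a b = fderiv ℝ (fderiv ℝ R) (0, u) b a :=
    fun a b => (hR.isSymmSndFDerivAt (by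
      rw [minSmoothness_of_isRCLikeNormedField]; exact WithTop.coe_le_coe.2 le_top)).eq a b
  have h1 := hasDerivAt_modelDensity_aux (r := fun t => R (t, u))
    (hasDerivAt_family hR0).differentiableAt.hasDerivAt (hasDerivAt_fderiv_family hR) hL
  have h2 := fun μ => fderiv_flux (hasFDerivAt_family hR0).differentiableAt.hasFDerivAt
    (hasFDerivAt_deriv_family hR) μ (eX μ)
  have h3 : ∀ w : Base n, (((fderiv ℝ (fderiv ℝ R) (0, u)).comp
      (ContinuousLinearMap.inr ℝ ℝ (Base n))).flip (1, 0)) w =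
      fderiv ℝ (fderiv ℝ R) (0, u) (1, 0) (0, w) := fun w => hsymm _ _
  simp only [h3] at h2
  refine h1.congr_deriv ?_
  rw [Finset.sum_congr rfl fun μ _ => h2 μ, modelEulerLagrange_coord]
  exact firstVariation_sum _ _ _ _ _ _ _ _ _

/-! ### Integrals of divergences -/

section Divergence

open MeasureTheory

/-- A function on an open set which vanishes outside a closed subset extends smoothly by zero. -/
theorem contDiff_indicator {E G : Type*} [NormedAddCommGroup E] [NormedSpace ℝ E]
    [NormedAddCommGroup G] [NormedSpace ℝ G]
    {D K : Set E} (hD : IsOpen D) (hK : IsClosed K) (hKD : K ⊆ D) {k : WithTop ℕ∞} {W : E → G}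
    (hW : ContDiffOn ℝ k W D) (h0 : ∀ u ∈ D \ K, W u = 0) : ContDiff ℝ k (D.indicator W) := by
  rw [contDiff_iff_contDiffAt]
  intro u
  by_cases hu : u ∈ D
  · refine (hW.contDiffAt (hD.mem_nhds hu)).congr_of_eventuallyEq ?_
    filter_upwards [hD.mem_nhds hu] with u' hu' using indicator_of_mem hu' _
  · refine (contDiffAt_const (c := (0 : G))).congr_of_eventuallyEq ?_
    filter_upwards [hK.isOpen_compl.mem_nhds fun h => hu (hKD h)] with u' hu'
    by_cases h : u' ∈ D
    · rw [indicator_of_mem h, h0 u' ⟨h, hu'⟩]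
    · exact indicator_of_notMem h _

theorem hasCompactSupport_indicator {E G : Type*} [TopologicalSpace E] [T2Space E] [Zero G]
    {D K : Set E} (hK : IsCompact K) {W : E → G}
    (h0 : ∀ u ∈ D \ K, W u = 0) : HasCompactSupport (D.indicator W) := by
  refine HasCompactSupport.intro hK fun u hu => ?_
  by_cases h : u ∈ D
  · rw [indicator_of_mem h, h0 u ⟨h, hu⟩]
  · exact indicator_of_notMem h _

theorem integral_fderiv_eq_zero {E : Type*} [NormedAddCommGroup E] [NormedSpace ℝ E]
    [FiniteDimensional ℝ E] [MeasurableSpace E] [BorelSpace E] (μ : Measure E)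
    [μ.IsAddHaarMeasure] {W : E → ℝ} (hW : ContDiff ℝ 1 W)
    (hc : HasCompactSupport W) (v : E) : ∫ u, fderiv ℝ W u v ∂μ = 0 := by
  have hWc : Continuous fun u => fderiv ℝ W u v :=
    (hW.continuous_fderiv (by simp)).clm_apply continuous_const
  -- integration by parts against the constant function `1`
  have h := integral_mul_fderiv_eq_neg_fderiv_mul_of_integrable (μ := μ) (f := fun _ => (1 : ℝ))
    (g := W) (v := v) (by simp)
    (by simpa using hWc.integrable_of_hasCompactSupport (hc.fderiv_apply ℝ v))
    (by simpa using hW.continuous.integrable_of_hasCompactSupport hc)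
    (fun _ _ => differentiableAt_const _) (fun u _ => (hW.differentiable (by simp)) u)
  simpa using h

/-- The divergence of a compactly supported vector field does not contribute to an integral. -/
theorem setIntegral_add_divergence {D K T : Set (Base n)} (hD : IsOpen D) (hK : IsCompact K)
    (hKD : K ⊆ D) (hDT : D ⊆ T) (hT : MeasurableSet T) {g a : Base n → ℝ}
    {W : Fin (n + 1) → Base n → ℝ} (ha : ContinuousOn a D) (ha0 : ∀ u ∈ D \ K, a u = 0)
    (hW : ∀ μ, ContDiffOn ℝ 1 (W μ) D) (hW0 : ∀ μ, ∀ u ∈ D \ K, W μ u = 0)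
    (hg : ∀ u ∈ D, g u = a u + ∑ μ, fderiv ℝ (W μ) u (eX μ)) (hg0 : ∀ u ∈ T \ D, g u = 0) :
    ∫ u in T, g u = ∫ u, D.indicator a u := by
  have hac : Continuous (D.indicator a) :=
    contDiff_zero.1 (contDiff_indicator hD hK.isClosed hKD (contDiffOn_zero.2 ha) ha0)
  have hW1 : ∀ μ, ContDiff ℝ 1 (D.indicator (W μ)) := fun μ =>
    contDiff_indicator hD hK.isClosed hKD (hW μ) (hW0 μ)
  have hWs : ∀ μ, HasCompactSupport (D.indicator (W μ)) := fun μ =>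
    hasCompactSupport_indicator hK (hW0 μ)
  have h1 : ∀ u, T.indicator g u =
      D.indicator a u + ∑ μ, fderiv ℝ (D.indicator (W μ)) u (eX μ) := by
    intro u
    by_cases hu : u ∈ D
    · rw [indicator_of_mem (hDT hu), indicator_of_mem hu, hg u hu]
      refine congrArg _ (Finset.sum_congr rfl fun μ _ => ?_)
      have hev : D.indicator (W μ) =ᶠ[𝓝 u] W μ := by
        filter_upwards [hD.mem_nhds hu] with u' hu' using indicator_of_mem hu' _
      rw [hev.fderiv_eq]
    · have h2 : ∀ μ, fderiv ℝ (D.indicator (W μ)) u (eX μ) = 0 := fun μ => by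
        have hev : D.indicator (W μ) =ᶠ[𝓝 u] fun _ => (0 : ℝ) := by
          filter_upwards [hK.isClosed.isOpen_compl.mem_nhds fun h => hu (hKD h)] with u' hu'
          by_cases h : u' ∈ D
          · rw [indicator_of_mem h, hW0 μ u' ⟨h, hu'⟩]
          · exact indicator_of_notMem h _
        rw [hev.fderiv_eq]
        simp
      simp only [h2, indicator_of_notMem hu, Finset.sum_const_zero, add_zero]
      by_cases huT : u ∈ T
      · rw [indicator_of_mem huT, hg0 u ⟨huT, hu⟩]
      · exact indicator_of_notMem huT _
  have hint : ∀ μ, Integrable fun u => fderiv ℝ (D.indicator (W μ)) u (eX μ) := fun μ =>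
    (((hW1 μ).continuous_fderiv (by simp)).clm_apply
      continuous_const).integrable_of_hasCompactSupport ((hWs μ).fderiv_apply ℝ _)
  rw [← integral_indicator hT]
  simp only [h1]
  rw [integral_add (hac.integrable_of_hasCompactSupport (hasCompactSupport_indicator hK ha0))
    (integrable_finsetSum _ fun μ _ => hint μ), integral_finsetSum _ fun μ _ => hint μ]
  simp only [fun μ => integral_fderiv_eq_zero volume (hW1 μ) (hWs μ) (eX μ),
    Finset.sum_const_zero, add_zero]

end Divergence

/-! ### One-parameter families of sections -/

section Families

variable [IsManifold (baseModel n) ∞ X] [IsManifold (𝓡 N) ∞ F]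
  {B : SmoothFiberBundle n N X Y F}

/-- A smooth one-parameter family of sections of the Pontryagin bundle, defined for parameters
`|t| < ε`. No condition on the support is included. -/
structure IsSmoothFamily (ε : ℝ) (Ψ : ℝ → X → PontryaginBundle B) : Prop where
  pos : 0 < ε
  smooth : ContMDiffOn (𝓘(ℝ, ℝ).prod (baseModel n)) 𝓘(ℝ, PontryaginModel n N) ∞
    (fun s : ℝ × X => Ψ s.1 s.2) (Ioo (-ε) ε ×ˢ univ)
  toX : ∀ t ∈ Ioo (-ε) ε, ∀ x, (pontryaginData B).toX (Ψ t x) = x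

/-- The coordinates of a family of sections, as functions of the parameter and of the `x^μ`. -/
def familyRep (c : FiberedChart B) (Ψ : ℝ → X → PontryaginBundle B) (s : ℝ × Base n) :
    PontryaginModel n N :=
  localRep c (Ψ s.1) s.2

/-- The set on which the coordinates of a family of sections are defined. -/
def familyDomain (ε : ℝ) (c : FiberedChart B) (Ψ : ℝ → X → PontryaginBundle B) :
    Set (ℝ × Base n) :=
  {s | s.1 ∈ Ioo (-ε) ε ∧ s.2 ∈ localDomain c (Ψ s.1)}

/-- The coordinates of the infinitesimal variation defined by a family of sections. -/
def localVar (c : FiberedChart B) (Ψ : ℝ → X → PontryaginBundle B) (u : Base n) :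
    PontryaginModel n N :=
  deriv (fun t => localRep c (Ψ t) u) 0

/-- The density of the Hamilton–Pontryagin action, with respect to the volume form. -/
def actionDensity (η : VolumeForm n X) (L : JetBundle B → ℝ) (σ : X → PontryaginBundle B) (x : X) :
    ℝ :=
  density η ((thetaM B - energyForm η L).pullback (E := Base n) σ) x

/-- The derivative of the density of the action along a family of sections. -/
def firstVariation (η : VolumeForm n X) (L : JetBundle B → ℝ) (Ψ : ℝ → X → PontryaginBundle B)
    (x : X) : ℝ :=
  deriv (fun t => actionDensity η L (Ψ t) x) 0

/-- The density of the action depends only on the germ of the section. -/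
theorem actionDensity_congr (η : VolumeForm n X) (L : JetBundle B → ℝ)
    {σ σ' : X → PontryaginBundle B} {x : X} (h : σ =ᶠ[𝓝 x] σ') :
    actionDensity η L σ x = actionDensity η L σ' x := by
  have h1 := h.mfderiv_eq (I := baseModel n) (I' := 𝓘(ℝ, PontryaginModel n N))
  let G : PontryaginBundle B → (Base n →L[ℝ] PontryaginModel n N) → ℝ := fun m A =>
    topCoeff (ContinuousAlternatingMap.compContinuousLinearMap (M := PontryaginModel n N)
      ((thetaM B - energyForm η L) m) A)
  have h2 : G (σ x) (mfderiv (baseModel n) 𝓘(ℝ, PontryaginModel n N) σ x) =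
      G (σ' x) (mfderiv (baseModel n) 𝓘(ℝ, PontryaginModel n N) σ' x) :=
    congrArg₂ G h.self_of_nhds h1
  exact congrArg (· / topCoeff (n := n) (η.form x)) h2

namespace IsSmoothFamily

variable {ε : ℝ} {Ψ : ℝ → X → PontryaginBundle B}

theorem zero_mem (h : IsSmoothFamily ε Ψ) : (0 : ℝ) ∈ Ioo (-ε) ε :=
  ⟨neg_lt_zero.2 h.pos, h.pos⟩

theorem contMDiff (h : IsSmoothFamily ε Ψ) {t : ℝ} (ht : t ∈ Ioo (-ε) ε) :
    ContMDiff (baseModel n) 𝓘(ℝ, PontryaginModel n N) ∞ (Ψ t) := by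
  rw [← contMDiffOn_univ]
  exact h.smooth.comp (f := fun x : X => (t, x)) (contMDiff_const.prodMk contMDiff_id).contMDiffOn
    fun x _ => ⟨ht, mem_univ _⟩

theorem contMDiffOn_symm (h : IsSmoothFamily ε Ψ) (c : FiberedChart B) :
    ContMDiffOn 𝓘(ℝ, ℝ × Base n) 𝓘(ℝ, PontryaginModel n N) ∞
      (fun s : ℝ × Base n => Ψ s.1 (c.base.symm s.2)) (Ioo (-ε) ε ×ˢ c.base.target) :=
  h.smooth.comp (f := fun s : ℝ × Base n => (s.1, c.base.symm s.2))
    (contDiff_fst.contMDiff.contMDiffOn.prodMk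
      (c.smooth_base_symm.comp contDiff_snd.contMDiff.contMDiffOn fun _ hs => hs.2))
    fun _ hs => ⟨hs.1, mem_univ _⟩

theorem isOpen_familyDomain (h : IsSmoothFamily ε Ψ) (c : FiberedChart B) :
    IsOpen (familyDomain ε c Ψ) := by
  have h1 := (((pontryaginData B).continuous_toY.comp_continuousOn
    (h.contMDiffOn_symm c).continuousOn).isOpen_inter_preimage
    (isOpen_Ioo.prod c.base.open_target) c.total.open_source)
  convert h1 using 1
  ext s
  exact ⟨fun hs => ⟨⟨hs.1, hs.2.1⟩, hs.2.2⟩, fun hs => ⟨hs.1.1, hs.1.2, hs.2⟩⟩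

theorem contDiffOn_familyRep (h : IsSmoothFamily ε Ψ) (c : FiberedChart B) :
    ContDiffOn ℝ ∞ (familyRep c Ψ) (familyDomain ε c Ψ) :=
  (((pontryaginData B).contMDiffOn_homeoOf c).comp ((h.contMDiffOn_symm c).mono
    fun _ hs => ⟨hs.1, hs.2.1⟩) fun _ hs => hs.2.2).contDiffOn

theorem contDiffAt_familyRep (h : IsSmoothFamily ε Ψ) (c : FiberedChart B) {s : ℝ × Base n}
    (hs : s ∈ familyDomain ε c Ψ) : ContDiffAt ℝ ∞ (familyRep c Ψ) s :=
  (h.contDiffOn_familyRep c).contDiffAt ((h.isOpen_familyDomain c).mem_nhds hs)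

theorem familyRep_fst_mem (c : FiberedChart B) {s : ℝ × Base n} (hs : s ∈ familyDomain ε c Ψ) :
    (familyRep c Ψ s).1 ∈ c.total.target :=
  c.total.map_source hs.2.2

/-- The coordinate expression of the density of the action along a family is smooth. -/
theorem contDiffOn_modelDensity (h : IsSmoothFamily ε Ψ) (c : FiberedChart B) (η : VolumeForm n X)
    {L : JetBundle B → ℝ} (hL : ContMDiff 𝓘(ℝ, JetModel n N) 𝓘(ℝ, ℝ) ∞ L) :
    ContDiffOn ℝ ∞ (fun s => modelDensity (localLagrangian c η L) (familyRep c Ψ s)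
      ((fderiv ℝ (familyRep c Ψ) s).comp (ContinuousLinearMap.inr ℝ ℝ (Base n))))
      (familyDomain ε c Ψ) := by
  have h1 := h.contDiffOn_familyRep c
  have h2 : ContDiffOn ℝ ∞ (fderiv ℝ (familyRep c Ψ)) (familyDomain ε c Ψ) :=
    h1.fderiv_of_isOpen (h.isOpen_familyDomain c) (by simp)
  simp only [modelDensity_eq]
  refine ContDiffOn.add (ContDiffOn.sum fun A _ => ContDiffOn.sum fun μ _ => ContDiffOn.mul ?_
    (ContDiffOn.sub ?_ ?_)) ?_
  · exact (coordP A μ).contDiff.comp_contDiffOn h1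
  · exact (coordY n A).contDiff.comp_contDiffOn (h2.clm_apply contDiffOn_const)
  · exact (coordV A μ).contDiff.comp_contDiffOn h1
  · exact (contDiffOn_localLagrangian c η hL).comp ((coordJet n N).contDiff.comp_contDiffOn h1)
      fun s hs => ⟨familyRep_fst_mem c hs, mem_univ _⟩

theorem actionDensity_coord (h : IsSmoothFamily ε Ψ) (c : FiberedChart B) (η : VolumeForm n X)
    (L : JetBundle B → ℝ) {t : ℝ} {u : Base n} (hs : (t, u) ∈ familyDomain ε c Ψ) :
    actionDensity η L (Ψ t) (c.base.symm u) * volCoeff η c.base u =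
      modelDensity (localLagrangian c η L) (familyRep c Ψ (t, u))
        ((fderiv ℝ (familyRep c Ψ) (t, u)).comp (ContinuousLinearMap.inr ℝ ℝ (Base n))) := by
  rw [actionDensity, density_section c η L (h.contMDiff hs.1) (h.toX t hs.1) hs.2,
    ← (hasFDerivAt_family ((h.contDiffAt_familyRep c hs).differentiableAt (by simp))).fderiv]
  rfl

/-- Near each point the density of the action along a family is a smooth function of the parameter
and of the coordinates. -/
theorem exists_actionDensity_eq (h : IsSmoothFamily ε Ψ) (η : VolumeForm n X)
    {L : JetBundle B → ℝ} (hL : ContMDiff 𝓘(ℝ, JetModel n N) 𝓘(ℝ, ℝ) ∞ L) {t : ℝ}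
    (ht : t ∈ Ioo (-ε) ε) (x : X) :
    ∃ (c : FiberedChart B) (G : ℝ × Base n → ℝ), ContinuousAt c.base x ∧
      ContDiffAt ℝ ∞ G (t, c.base x) ∧
      ∀ᶠ s in 𝓝 (t, x), actionDensity η L (Ψ s.1) s.2 = G (s.1, c.base s.2) := by
  set c := B.chart (Ψ t x).pt
  have hm : (Ψ t x).pt ∈ c.total.source := B.mem_chart _
  have hx : x ∈ c.base.source := by
    have h1 := c.proj_mem _ hm
    rwa [show B.proj (Ψ t x).pt = x from h.toX t ht x] at h1
  have hcx := c.base.continuousAt hx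
  have hs0 : (t, c.base x) ∈ familyDomain ε c Ψ :=
    ⟨ht, c.base.map_source hx, by rwa [c.base.left_inv hx]⟩
  refine ⟨c, fun s => modelDensity (localLagrangian c η L) (familyRep c Ψ s)
      ((fderiv ℝ (familyRep c Ψ) s).comp (ContinuousLinearMap.inr ℝ ℝ (Base n))) /
      volCoeff η c.base s.2, hcx, ?_, ?_⟩
  · refine ContDiffAt.div ((h.contDiffOn_modelDensity c η hL).contDiffAt
      ((h.isOpen_familyDomain c).mem_nhds hs0)) ?_
      (volCoeff_ne_zero η (IsSmoothChart.base c) hs0.2.1)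
    exact ((contDiffOn_volCoeff η (IsSmoothChart.base c)).contDiffAt
      (c.base.open_target.mem_nhds hs0.2.1)).comp (t, c.base x) contDiffAt_snd
  · have hcont : ContinuousAt (fun s : ℝ × X => (s.1, c.base s.2)) (t, x) :=
      continuousAt_fst.prodMk (ContinuousAt.comp (f := Prod.snd) (x := (t, x)) hcx continuousAt_snd)
    have hsrc : ∀ᶠ s : ℝ × X in 𝓝 (t, x), s.2 ∈ c.base.source :=
      continuousAt_snd.eventually (c.base.open_source.mem_nhds hx)
    filter_upwards [hcont.eventually ((h.isOpen_familyDomain c).mem_nhds hs0), hsrc] with s hs hs'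
    have h1 := h.actionDensity_coord c η L (u := c.base s.2) hs
    rw [c.base.left_inv hs'] at h1
    rw [eq_div_iff (volCoeff_ne_zero η (IsSmoothChart.base c) hs.2.1), h1]

theorem hasDerivAt_actionDensity (h : IsSmoothFamily ε Ψ) (η : VolumeForm n X)
    {L : JetBundle B → ℝ} (hL : ContMDiff 𝓘(ℝ, JetModel n N) 𝓘(ℝ, ℝ) ∞ L) {t : ℝ}
    (ht : t ∈ Ioo (-ε) ε) (x : X) :
    HasDerivAt (fun t => actionDensity η L (Ψ t) x)
      (deriv (fun t => actionDensity η L (Ψ t) x) t) t := by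
  obtain ⟨c, G, -, hG, hev⟩ := h.exists_actionDensity_eq η hL ht x
  have ht' : Filter.Tendsto (fun t : ℝ => (t, x)) (𝓝 t) (𝓝 (t, x)) :=
    (Continuous.prodMk continuous_id continuous_const).tendsto t
  exact ((hasDerivAt_family (hG.differentiableAt (by simp))).congr_of_eventuallyEq
    (ht'.eventually hev)).differentiableAt.hasDerivAt

theorem continuousOn_actionDensity (h : IsSmoothFamily ε Ψ) (η : VolumeForm n X)
    {L : JetBundle B → ℝ} (hL : ContMDiff 𝓘(ℝ, JetModel n N) 𝓘(ℝ, ℝ) ∞ L) :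
    ContinuousOn (fun s : ℝ × X => actionDensity η L (Ψ s.1) s.2) (Ioo (-ε) ε ×ˢ univ) := by
  rintro ⟨t, x⟩ ⟨ht : t ∈ Ioo (-ε) ε, -⟩
  obtain ⟨c, G, hc, hG, hev⟩ := h.exists_actionDensity_eq η hL ht x
  refine ContinuousAt.continuousWithinAt (ContinuousAt.congr ?_ (hev.mono fun _ hs => hs.symm))
  exact ContinuousAt.comp (f := fun s : ℝ × X => (s.1, c.base s.2)) (x := (t, x)) hG.continuousAt
    (continuousAt_fst.prodMk (ContinuousAt.comp (f := Prod.snd) (x := (t, x)) hc continuousAt_snd))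

theorem continuousOn_deriv_actionDensity (h : IsSmoothFamily ε Ψ) (η : VolumeForm n X)
    {L : JetBundle B → ℝ} (hL : ContMDiff 𝓘(ℝ, JetModel n N) 𝓘(ℝ, ℝ) ∞ L) :
    ContinuousOn (fun s : ℝ × X => deriv (fun t => actionDensity η L (Ψ t) s.2) s.1)
      (Ioo (-ε) ε ×ˢ univ) := by
  rintro ⟨t, x⟩ ⟨ht : t ∈ Ioo (-ε) ε, -⟩
  obtain ⟨c, G, hc, hG, hev⟩ := h.exists_actionDensity_eq η hL ht x
  have hcont : ContinuousAt (fun s : ℝ × X => (s.1, c.base s.2)) (t, x) :=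
    continuousAt_fst.prodMk (ContinuousAt.comp (f := Prod.snd) (x := (t, x)) hc continuousAt_snd)
  have hG' : ContinuousAt (fun w => fderiv ℝ G w (1, 0)) (t, c.base x) :=
    ((hG.fderiv_right (m := ∞) (by simp)).continuousAt).clm_apply continuousAt_const
  refine ContinuousAt.continuousWithinAt (ContinuousAt.congr
    (ContinuousAt.comp (f := fun s : ℝ × X => (s.1, c.base s.2)) (x := (t, x)) hG' hcont) ?_)
  filter_upwards [hev.eventually_nhds, hcont.eventually (eventually_differentiableAt hG)]
    with s hs hsd
  have ht' : Filter.Tendsto (fun t : ℝ => (t, s.2)) (𝓝 s.1) (𝓝 (s.1, s.2)) :=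
    (Continuous.prodMk continuous_id continuous_const).tendsto s.1
  exact ((hasDerivAt_family hsd).congr_of_eventuallyEq (ht'.eventually hs)).deriv.symm

theorem continuous_firstVariation (h : IsSmoothFamily ε Ψ) (η : VolumeForm n X)
    {L : JetBundle B → ℝ} (hL : ContMDiff 𝓘(ℝ, JetModel n N) 𝓘(ℝ, ℝ) ∞ L) :
    Continuous (firstVariation η L Ψ) := by
  rw [← continuousOn_univ]
  exact (h.continuousOn_deriv_actionDensity η hL).comp (f := fun x : X => ((0 : ℝ), x))
    (by fun_prop) fun x _ => ⟨h.zero_mem, mem_univ _⟩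

theorem hasDerivAt_action [T2Space X] [SigmaCompactSpace X] (h : IsSmoothFamily ε Ψ)
    (η : VolumeForm n X) {L : JetBundle B → ℝ} (hL : ContMDiff 𝓘(ℝ, JetModel n N) 𝓘(ℝ, ℝ) ∞ L)
    {U : Set X} (hU : IsCompact U) :
    HasDerivAt (fun t => action η L U (Ψ t)) (integralDensity η U (firstVariation η L Ψ)) 0 := by
  simp only [action, integralOn_eq]
  exact hasDerivAt_integralDensity η hU h.pos (h.continuousOn_actionDensity η hL)
    (h.continuousOn_deriv_actionDensity η hL) fun t ht x => h.hasDerivAt_actionDensity η hL ht x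

theorem zero_mem_familyDomain (h : IsSmoothFamily ε Ψ) {c : FiberedChart B} {u : Base n}
    (hu : u ∈ localDomain c (Ψ 0)) : ((0 : ℝ), u) ∈ familyDomain ε c Ψ :=
  ⟨h.zero_mem, hu⟩

/-- The first variation of the density of the action in fibred coordinates. -/
theorem firstVariation_coord (h : IsSmoothFamily ε Ψ) (c : FiberedChart B) (η : VolumeForm n X)
    {L : JetBundle B → ℝ} (hL : ContMDiff 𝓘(ℝ, JetModel n N) 𝓘(ℝ, ℝ) ∞ L) {u : Base n}
    (hu : u ∈ localDomain c (Ψ 0)) :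
    firstVariation η L Ψ (c.base.symm u) * volCoeff η c.base u =
      -modelEulerLagrange (localLagrangian c η L) (localRep c (Ψ 0) u)
          (fderiv ℝ (localRep c (Ψ 0)) u) (localVar c Ψ u) +
        ∑ μ, fderiv ℝ (fun u' => flux (localRep c (Ψ 0) u') (localVar c Ψ u') μ) u (eX μ) := by
  have hs := h.zero_mem_familyDomain hu
  have h1 := hasDerivAt_modelDensity (Lc := localLagrangian c η L) (h.contDiffAt_familyRep c hs)
    (differentiableAt_localLagrangian c η hL (familyRep_fst_mem c hs))
  refine Eq.trans ?_ h1.deriv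
  rw [firstVariation, ← deriv_mul_const (h.hasDerivAt_actionDensity η hL h.zero_mem
    _).differentiableAt]
  refine Filter.EventuallyEq.deriv_eq ?_
  have ht : Filter.Tendsto (fun t : ℝ => (t, u)) (𝓝 0) (𝓝 (0, u)) :=
    (Continuous.prodMk continuous_id continuous_const).tendsto 0
  filter_upwards [ht.eventually ((h.isOpen_familyDomain c).mem_nhds hs)] with t ht'
  exact density_section c η L (h.contMDiff ht'.1) (h.toX t ht'.1) ht'.2

theorem firstVariation_eq_zero (h : IsSmoothFamily ε Ψ) (η : VolumeForm n X) (L : JetBundle B → ℝ)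
    {x : X} (hx : ∀ t ∈ Ioo (-ε) ε, Ψ t =ᶠ[𝓝 x] Ψ 0) : firstVariation η L Ψ x = 0 := by
  have h1 : (fun t => actionDensity η L (Ψ t) x) =ᶠ[𝓝 0] fun _ => actionDensity η L (Ψ 0) x := by
    filter_upwards [Ioo_mem_nhds h.zero_mem.1 h.zero_mem.2] with t ht
    exact actionDensity_congr η L (hx t ht)
  rw [firstVariation, h1.deriv_eq, deriv_const]

theorem contDiffOn_localVar (h : IsSmoothFamily ε Ψ) (c : FiberedChart B) :
    ContDiffOn ℝ ∞ (localVar c Ψ) (localDomain c (Ψ 0)) := by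
  have h1 : ContDiffOn ℝ ∞ (fun s => fderiv ℝ (familyRep c Ψ) s (1, 0)) (familyDomain ε c Ψ) :=
    ((h.contDiffOn_familyRep c).fderiv_of_isOpen (h.isOpen_familyDomain c) (by simp)).clm_apply
      contDiffOn_const
  refine (h1.comp (f := fun u : Base n => ((0 : ℝ), u)) (by fun_prop)
    fun u hu => h.zero_mem_familyDomain hu).congr fun u hu => ?_
  exact (hasDerivAt_family ((h.contDiffAt_familyRep c
    (h.zero_mem_familyDomain hu)).differentiableAt (by simp))).deriv

theorem localVar_base (h : IsSmoothFamily ε Ψ) (c : FiberedChart B) {u : Base n}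
    (hu : u ∈ localDomain c (Ψ 0)) : (localVar c Ψ u).1.1 = 0 := by
  have hs := h.zero_mem_familyDomain hu
  have h1 : HasDerivAt (fun t => localRep c (Ψ t) u) (localVar c Ψ u) 0 :=
    (hasDerivAt_family ((h.contDiffAt_familyRep c hs).differentiableAt
      (by simp))).differentiableAt.hasDerivAt
  let P : PontryaginModel n N →L[ℝ] Base n :=
    (ContinuousLinearMap.fst ℝ (Base n) (Fib N)).comp (ContinuousLinearMap.fst ℝ _ _)
  have h2 : HasDerivAt (fun t => (localRep c (Ψ t) u).1.1) (localVar c Ψ u).1.1 0 :=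
    P.hasFDerivAt.comp_hasDerivAt (0 : ℝ) h1
  have ht : Filter.Tendsto (fun t : ℝ => (t, u)) (𝓝 0) (𝓝 (0, u)) :=
    (Continuous.prodMk continuous_id continuous_const).tendsto 0
  have h3 : (fun t => (localRep c (Ψ t) u).1.1) =ᶠ[𝓝 0] fun _ => u := by
    filter_upwards [ht.eventually ((h.isOpen_familyDomain c).mem_nhds hs)] with t ht'
    exact base_localRep (h.toX t ht'.1) ht'.2
  exact h2.unique ((hasDerivAt_const (0 : ℝ) u).congr_of_eventuallyEq h3)

theorem localVar_eq_zero (h : IsSmoothFamily ε Ψ) (c : FiberedChart B) {u : Base n}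
    (hu : ∀ t ∈ Ioo (-ε) ε, Ψ t (c.base.symm u) = Ψ 0 (c.base.symm u)) : localVar c Ψ u = 0 := by
  have h1 : (fun t => localRep c (Ψ t) u) =ᶠ[𝓝 0] fun _ => localRep c (Ψ 0) u := by
    filter_upwards [Ioo_mem_nhds h.zero_mem.1 h.zero_mem.2] with t ht
    rw [localRep, hu t ht, localRep]
  rw [localVar, h1.deriv_eq, deriv_const]

theorem contDiffOn_flux (h : IsSmoothFamily ε Ψ) (c : FiberedChart B) (μ : Fin (n + 1)) :
    ContDiffOn ℝ ∞ (fun u => flux (localRep c (Ψ 0) u) (localVar c Ψ u) μ)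
      (localDomain c (Ψ 0)) :=
  ContDiffOn.sum fun A _ =>
    ((coordP A μ).contDiff.comp_contDiffOn (contDiffOn_localRep c (h.contMDiff h.zero_mem))).mul
      ((coordY n A).contDiff.comp_contDiffOn (h.contDiffOn_localVar c))

end IsSmoothFamily

theorem flux_zero (r : PontryaginModel n N) (μ : Fin (n + 1)) : flux r 0 μ = 0 := by
  simp [flux]

theorem flux_smul (r δ : PontryaginModel n N) (a : ℝ) (μ : Fin (n + 1)) :
    flux r (a • δ) μ = a * flux r δ μ := by
  simp [flux, Finset.mul_sum, mul_left_comm]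

theorem modelEulerLagrange_smul (Lc : JetModel n N → ℝ) (r : PontryaginModel n N)
    (D : Base n →L[ℝ] PontryaginModel n N) (a : ℝ) (v : PontryaginModel n N) :
    modelEulerLagrange Lc r D (a • v) = a * modelEulerLagrange Lc r D v := by
  simp only [modelEulerLagrange_coord, map_smul, smul_eq_mul, mul_sub, mul_add, Finset.mul_sum]
  refine congrArg₂ _ (congrArg₂ _ (congrArg₂ _ ?_ ?_) ?_) rfl <;>
    exact Finset.sum_congr rfl fun A _ => Finset.sum_congr rfl fun μ _ => by ring

theorem modelEulerLagrange_zero (Lc : JetModel n N → ℝ) (r : PontryaginModel n N)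
    (D : Base n →L[ℝ] PontryaginModel n N) : modelEulerLagrange Lc r D 0 = 0 := by
  simp [modelEulerLagrange_coord]

theorem continuousOn_modelEulerLagrange (c : FiberedChart B) (η : VolumeForm n X)
    {L : JetBundle B → ℝ} (hL : ContMDiff 𝓘(ℝ, JetModel n N) 𝓘(ℝ, ℝ) ∞ L)
    {σ : X → PontryaginBundle B} (hσ : ContMDiff (baseModel n) 𝓘(ℝ, PontryaginModel n N) ∞ σ)
    {δ : Base n → PontryaginModel n N} {D : Set (Base n)} (hD : D ⊆ localDomain c σ)
    (hδ : ContinuousOn δ D) :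
    ContinuousOn (fun u => modelEulerLagrange (localLagrangian c η L) (localRep c σ u)
      (fderiv ℝ (localRep c σ) u) (δ u)) D := by
  have h1 := (contDiffOn_localRep c hσ).continuousOn.mono hD
  have h2 : ContinuousOn (fderiv ℝ (localRep c σ)) D :=
    ((contDiffOn_localRep c hσ).continuousOn_fderiv_of_isOpen
      (isOpen_localDomain c hσ.continuous) (by simp)).mono hD
  have h3 : ContinuousOn (fderiv ℝ (localLagrangian c η L)) (c.total.target ×ˢ univ) :=
    (contDiffOn_localLagrangian c η hL).continuousOn_fderiv_of_isOpen
      (c.total.open_target.prod isOpen_univ) (by simp)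
  simp only [modelEulerLagrange_coord]
  refine ContinuousOn.sub (ContinuousOn.add (ContinuousOn.add ?_ ?_) ?_) ?_
  · refine continuousOn_finsetSum _ fun A _ => continuousOn_finsetSum _ fun μ _ => ?_
    exact ((coordP A μ).continuous.comp_continuousOn hδ).mul
      (((coordV A μ).continuous.comp_continuousOn h1).sub
        ((coordY n A).continuous.comp_continuousOn (h2.clm_apply continuousOn_const)))
  · refine continuousOn_finsetSum _ fun A _ => continuousOn_finsetSum _ fun μ _ => ?_
    exact ((coordP A μ).continuous.comp_continuousOn (h2.clm_apply continuousOn_const)).mul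
      ((coordY n A).continuous.comp_continuousOn hδ)
  · refine continuousOn_finsetSum _ fun A _ => continuousOn_finsetSum _ fun μ _ => ?_
    exact ((coordP A μ).continuous.comp_continuousOn h1).mul
      ((coordV A μ).continuous.comp_continuousOn hδ)
  · exact (h3.comp ((coordJet n N).continuous.comp_continuousOn h1) fun u hu =>
      ⟨c.total.map_source (hD hu).2, mem_univ _⟩).clm_apply
        ((coordJet n N).continuous.comp_continuousOn hδ)

end Families

/-! ### Critical points and the equations -/

section Criticality

open MeasureTheory

variable [IsManifold (baseModel n) ∞ X] [IsManifold (𝓡 N) ∞ F] [T2Space X] [SigmaCompactSpace X]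
  {B : SmoothFiberBundle n N X Y F} {ε : ℝ} {Ψ : ℝ → X → PontryaginBundle B}

/-- The first variation of the action along a family which is constant outside a compact subset
`K` of the domain of a fibred chart: the divergence of the flux integrates to zero. The number `s`
is the orientation of the chart along `K`. -/
theorem IsSmoothFamily.integralDensity_firstVariation (h : IsSmoothFamily ε Ψ)
    (c : FiberedChart B) (η : VolumeForm n X) {L : JetBundle B → ℝ}
    (hL : ContMDiff 𝓘(ℝ, JetModel n N) 𝓘(ℝ, ℝ) ∞ L) {U K : Set X} (hU : IsCompact U)
    (hK : IsCompact K) (hKU : K ⊆ U) (hKc : K ⊆ c.base.source) {D : Set (Base n)} (hD : IsOpen D)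
    (hDc : D ⊆ localDomain c (Ψ 0)) (hKD : c.base '' K ⊆ D) {s : ℝ}
    (hs : ∀ u ∈ D, |volCoeff η c.base u| = s * volCoeff η c.base u)
    (hΨ : ∀ t ∈ Ioo (-ε) ε, ∀ x ∉ K, Ψ t x = Ψ 0 x) :
    integralDensity η U (firstVariation η L Ψ) = ∫ u, D.indicator (fun u =>
      -s * modelEulerLagrange (localLagrangian c η L) (localRep c (Ψ 0) u)
        (fderiv ℝ (localRep c (Ψ 0)) u) (localVar c Ψ u)) u := by
  have hf0 : ∀ x ∉ K, firstVariation η L Ψ x = 0 := fun x hx =>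
    h.firstVariation_eq_zero η L fun t ht => by
      filter_upwards [hK.isClosed.isOpen_compl.mem_nhds hx] with x' hx' using hΨ t ht x' hx'
  have hDt : D ⊆ c.base.target := fun u hu => (hDc hu).1
  have hout : ∀ u ∈ c.base.target \ c.base '' K, c.base.symm u ∉ K := fun u hu hx =>
    hu.2 ⟨_, hx, c.base.right_inv hu.1⟩
  have hv0 : ∀ u ∈ D \ c.base '' K, localVar c Ψ u = 0 := fun u hu =>
    h.localVar_eq_zero c fun t ht => hΨ t ht _ (hout u ⟨hDt hu.1, hu.2⟩)
  rw [integralDensity_eq_chart η hU hK (IsSmoothChart.base c) hKc hKU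
    (h.continuous_firstVariation η hL) hf0]
  refine setIntegral_add_divergence hD (hK.image_of_continuousOn (c.base.continuousOn.mono hKc))
    hKD hDt c.base.open_target.measurableSet
    (W := fun μ u => s * flux (localRep c (Ψ 0) u) (localVar c Ψ u) μ) ?_ ?_ ?_ ?_ ?_ ?_
  · exact continuousOn_const.mul (continuousOn_modelEulerLagrange c η hL (h.contMDiff h.zero_mem)
      hDc ((h.contDiffOn_localVar c).continuousOn.mono hDc))
  · intro u hu
    simp only [hv0 u hu, modelEulerLagrange_zero, mul_zero]
  · exact fun μ => contDiffOn_const.mul (((h.contDiffOn_flux c μ).mono hDc).of_le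
      (by exact_mod_cast le_top))
  · intro μ u hu
    simp only [hv0 u hu, flux_zero, mul_zero]
  · intro u hu
    have hflux : ∀ μ, DifferentiableAt ℝ
        (fun u => flux (localRep c (Ψ 0) u) (localVar c Ψ u) μ) u := fun μ =>
      (((h.contDiffOn_flux c μ).mono hDc).contDiffAt (hD.mem_nhds hu)).differentiableAt (by simp)
    have h1 := h.firstVariation_coord c η hL (hDc hu)
    have h2 : ∀ μ, fderiv ℝ (fun u => s * flux (localRep c (Ψ 0) u) (localVar c Ψ u) μ) u (eX μ) =
        s * fderiv ℝ (fun u => flux (localRep c (Ψ 0) u) (localVar c Ψ u) μ) u (eX μ) := by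
      intro μ
      rw [fderiv_const_mul (hflux μ)]
      rfl
    simp only [h2, ← Finset.mul_sum]
    rw [hs u hu, mul_left_comm, h1]
    ring
  · intro u hu
    rw [hf0 _ (hout u ⟨hu.1, fun hx => hu.2 (hKD hx)⟩), zero_mul]

theorem abs_eq_sign_mul {a b : ℝ} (h : 0 < a * b) : |a| = (SignType.sign b : ℝ) * a := by
  rcases pos_and_pos_or_neg_and_neg_of_mul_pos h with ⟨ha, hb⟩ | ⟨ha, hb⟩
  · simp [abs_of_pos ha, sign_pos hb]
  · simp [abs_of_neg ha, sign_neg hb]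

/-- The localization `(t, x) ↦ Ψ_{t χ(x)}(x)` of a family by a cutoff function `χ`. Unlike a
product with `χ`, it makes sense in the absence of a linear structure on the fibres. -/
def localize (χ : X → ℝ) (Ψ : ℝ → X → PontryaginBundle B) (t : ℝ) (x : X) : PontryaginBundle B :=
  Ψ (t * χ x) x

theorem mul_mem_Ioo {t a : ℝ} (ht : t ∈ Ioo (-ε) ε) (h0 : 0 ≤ a) (h1 : a ≤ 1) :
    t * a ∈ Ioo (-ε) ε := by
  rw [mem_Ioo, ← abs_lt] at ht ⊢
  rw [abs_mul, abs_of_nonneg h0]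
  exact (mul_le_of_le_one_right (abs_nonneg t) h1).trans_lt ht

theorem localize_zero (χ : X → ℝ) (Ψ : ℝ → X → PontryaginBundle B) : localize χ Ψ 0 = Ψ 0 := by
  funext x
  rw [localize, zero_mul]

theorem IsSmoothFamily.localize (h : IsSmoothFamily ε Ψ) {χ : X → ℝ}
    (hχ : ContMDiff (baseModel n) 𝓘(ℝ, ℝ) ∞ χ) (h0 : ∀ x, 0 ≤ χ x) (h1 : ∀ x, χ x ≤ 1) :
    IsSmoothFamily ε (localize χ Ψ) where
  pos := h.pos
  smooth := by
    have hm : ContMDiff (𝓘(ℝ, ℝ).prod (baseModel n)) 𝓘(ℝ, ℝ) ∞ fun s : ℝ × X => s.1 * χ s.2 :=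
      (contDiff_mul (𝕜 := ℝ) (𝔸 := ℝ)).contMDiff.comp
        (contMDiff_fst.prodMk_space (hχ.comp contMDiff_snd))
    exact h.smooth.comp (f := fun s : ℝ × X => (s.1 * χ s.2, s.2))
      (hm.prodMk contMDiff_snd).contMDiffOn
      fun s hs => ⟨mul_mem_Ioo hs.1 (h0 _) (h1 _), mem_univ _⟩
  toX t ht x := h.toX _ (mul_mem_Ioo ht (h0 _) (h1 _)) x

theorem localVar_localize (χ : X → ℝ) (c : FiberedChart B) (Ψ : ℝ → X → PontryaginBundle B)
    (u : Base n) : localVar c (localize χ Ψ) u = χ (c.base.symm u) • localVar c Ψ u := by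
  have h1 := deriv_comp_mul_left (χ (c.base.symm u)) (fun t => localRep c (Ψ t) u) 0
  rw [mul_zero] at h1
  rw [localVar, localVar, ← h1]
  refine congrArg (fun f => deriv f 0) (funext fun t => ?_)
  rw [mul_comm]
  rfl

/-- If the weak equations hold in a chart around each point, then each variation is a sum of
variations supported in the domains of these charts, along which the action is stationary. -/
theorem isCriticalPoint_of_weakEulerLagrange (η : VolumeForm n X) {L : JetBundle B → ℝ}
    (hL : ContMDiff 𝓘(ℝ, JetModel n N) 𝓘(ℝ, ℝ) ∞ L) {ψ : X → PontryaginBundle B}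
    (hψ : IsSection ψ)
    (hc : ∀ x, ∃ c : FiberedChart B, (ψ x).pt ∈ c.total.source ∧ WeakEulerLagrange c η L ψ) :
    IsCriticalPoint η L ψ := by
  rintro U Ψ ⟨hU, hΨ0, ε, hε, hsmooth, hΨ⟩
  have h : IsSmoothFamily ε Ψ := ⟨hε, hsmooth, fun t ht => (hΨ t ht).1⟩
  suffices hz : integralDensity η U (firstVariation η L Ψ) = 0 by
    have := h.hasDerivAt_action η hL hU
    rwa [hz] at this
  choose c hcs hcw using hc
  have hcb : ∀ x, x ∈ (c x).base.source := fun x => by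
    have h1 := (c x).proj_mem _ (hcs x)
    rwa [show B.proj (ψ x).pt = x from hψ.2 x] at h1
  -- the domain of the chart around `x`, restricted so that the orientation is constant
  set D : X → Set (Base n) := fun x => localDomain (c x) ψ ∩
    {u | 0 < volCoeff η (c x).base u * volCoeff η (c x).base ((c x).base x)} with hD
  have hDo : ∀ x, IsOpen (D x) := fun x => by
    have h1 : ContinuousOn (fun u => volCoeff η (c x).base u *
        volCoeff η (c x).base ((c x).base x)) (localDomain (c x) ψ) :=
      ((contDiffOn_volCoeff η (IsSmoothChart.base (c x))).continuousOn.mono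
        fun u hu => hu.1).mul continuousOn_const
    exact h1.isOpen_inter_preimage (isOpen_localDomain (c x) hψ.1.continuous) isOpen_Ioi
  have hDx : ∀ x, (c x).base x ∈ D x := fun x =>
    ⟨⟨(c x).base.map_source (hcb x), by rw [(c x).base.left_inv (hcb x)]; exact hcs x⟩,
      mul_self_pos.2 (volCoeff_ne_zero η (IsSmoothChart.base (c x))
        ((c x).base.map_source (hcb x)))⟩
  obtain ⟨ρ, hρ⟩ := SmoothPartitionOfUnity.exists_isSubordinate (baseModel n) isClosed_univ
    (fun x : X => (c x).base.source ∩ (c x).base ⁻¹' D x)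
    (fun x => (c x).base.isOpen_inter_preimage (hDo x))
    (fun x _ => mem_iUnion.2 ⟨x, hcb x, hDx x⟩)
  have hfin : {j | (tsupport (ρ j) ∩ U).Nonempty}.Finite :=
    ρ.locallyFinite.closure.finite_nonempty_inter_compact hU
  set J := hfin.toFinset with hJ
  have hloc : ∀ j, IsSmoothFamily ε (localize (ρ j) Ψ) := fun j =>
    h.localize (ρ j).contMDiff (ρ.nonneg j) (ρ.le_one j)
  have hloc0 : ∀ j, localize (ρ j) Ψ 0 = ψ := fun j => (localize_zero _ _).trans hΨ0
  have hconst : ∀ j, ∀ t ∈ Ioo (-ε) ε, ∀ x ∉ U, localize (ρ j) Ψ t x = ψ x := fun j t ht x hx =>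
    (hΨ _ (mul_mem_Ioo ht (ρ.nonneg j x) (ρ.le_one j x))).2 x hx
  have hsum : firstVariation η L Ψ = fun x => ∑ j ∈ J, firstVariation η L (localize (ρ j) Ψ) x := by
    funext x
    by_cases hx : x ∈ U
    -- near `x` the variations add up, and the first variation is a divergence in each of them
    · have hu : (c x).base x ∈ localDomain (c x) ψ := (hDx x).1
      have hxs := (c x).base.left_inv (hcb x)
      have hh := volCoeff_ne_zero η (IsSmoothChart.base (c x)) hu.1
      have h1 := h.firstVariation_coord (c x) η hL (by rwa [hΨ0])
      have h2 := fun j => (hloc j).firstVariation_coord (c x) η hL (u := (c x).base x)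
        (by rwa [hloc0 j])
      simp only [hloc0, hΨ0, hxs] at h1 h2
      rw [hcw x _ hu _ (h.localVar_base (c x) (by rwa [hΨ0])), neg_zero, zero_add] at h1
      have h3 : ∀ j, modelEulerLagrange (localLagrangian (c x) η L)
          (localRep (c x) ψ ((c x).base x)) (fderiv ℝ (localRep (c x) ψ) ((c x).base x))
          (localVar (c x) (localize (ρ j) Ψ) ((c x).base x)) = 0 := fun j =>
        hcw x _ hu _ ((hloc j).localVar_base (c x) (by rwa [hloc0 j]))
      simp only [h3, neg_zero, zero_add] at h2
      refine mul_right_cancel₀ hh ?_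
      rw [h1, Finset.sum_mul, Finset.sum_congr rfl fun j _ => h2 j, Finset.sum_comm]
      refine Finset.sum_congr rfl fun μ _ => ?_
      have hd : ∀ j ∈ J, DifferentiableAt ℝ (fun u => flux (localRep (c x) ψ u)
          (localVar (c x) (localize (ρ j) Ψ) u) μ) ((c x).base x) := fun j _ => by
        have h4 := (hloc j).contDiffOn_flux (c x) μ
        rw [hloc0 j] at h4
        exact (h4.contDiffAt ((isOpen_localDomain (c x) hψ.1.continuous).mem_nhds
          hu)).differentiableAt (by simp)
      rw [← sum_apply, ← fderiv_fun_sum hd]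
      refine congrArg (fun A : Base n →L[ℝ] ℝ => A (eX μ)) (Filter.EventuallyEq.fderiv_eq ?_)
      have h5 : Filter.Tendsto (c x).base.symm (𝓝 ((c x).base x)) (𝓝 x) :=
        (c x).base.tendsto_symm (hcb x)
      filter_upwards [h5.eventually (ρ.eventually_finsupport_subset x)] with u' hu'
      simp only [localVar_localize, flux_smul]
      rw [← Finset.sum_mul, ρ.sum_finsupport' _ (mem_univ _), one_mul]
      intro i hi
      exact hfin.mem_toFinset.2 ⟨x, (ρ.mem_fintsupport_iff x i).1 (hu' hi), hx⟩
    · have hx' := hU.isClosed.isOpen_compl.mem_nhds hx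
      rw [h.firstVariation_eq_zero η L fun t ht => by
        filter_upwards [hx'] with x' hx'' using ((hΨ t ht).2 x' hx'').trans (by rw [hΨ0])]
      refine (Finset.sum_eq_zero fun j _ => ?_).symm
      refine (hloc j).firstVariation_eq_zero η L fun t ht => ?_
      filter_upwards [hx'] with x' hx'' using (hconst j t ht x' hx'').trans (by rw [hloc0])
  rw [hsum, integralDensity_finset_sum η hU J fun j _ => (hloc j).continuous_firstVariation η hL]
  refine Finset.sum_eq_zero fun j _ => ?_
  have hsub : U ∩ tsupport (ρ j) ⊆ (c j).base.source ∩ (c j).base ⁻¹' D j := fun x hx => hρ j hx.2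
  rw [(hloc j).integralDensity_firstVariation (c j) η hL hU
    (hU.inter_right (isClosed_tsupport (ρ j))) inter_subset_left (fun x hx => (hsub hx).1)
    (hDo j) (by rw [hloc0]; exact inter_subset_left)
    (by rintro _ ⟨x, hx, rfl⟩; exact (hsub hx).2) (fun u hu => abs_eq_sign_mul hu.2) ?_]
  · refine integral_eq_zero_of_ae (Filter.Eventually.of_forall fun u => ?_)
    by_cases hu : u ∈ D j
    · rw [indicator_of_mem hu, hloc0 j, hcw j u hu.1 _
        ((hloc j).localVar_base (c j) (by rw [hloc0]; exact hu.1)), mul_zero]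
      rfl
    · rw [indicator_of_notMem hu]
      rfl
  · intro t ht x hx
    rw [hloc0]
    by_cases hxU : x ∈ U
    · have h6 : ρ j x = 0 := image_eq_zero_of_notMem_tsupport fun h => hx ⟨hxU, h⟩
      rw [HamiltonPontryagin.localize, h6, mul_zero, hΨ0]
    · exact hconst j t ht x hxU

end Criticality

/-! ### Variations supported in a fibred chart -/

section BumpVariation

open MeasureTheory

variable [IsManifold (baseModel n) ∞ X] [IsManifold (𝓡 N) ∞ F]
  {B : SmoothFiberBundle n N X Y F}

open Classical in
/-- The variation of `ψ` which, in a fibred chart and over the subset `D` of the base coordinates,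
adds `t χ(x) v` to the coordinates. -/
def bumpVariation (c : FiberedChart B) (ψ : X → PontryaginBundle B) (D : Set (Base n))
    (χ : Base n → ℝ) (v : PontryaginModel n N) (t : ℝ) (x : X) : PontryaginBundle B :=
  if x ∈ c.base.source ∩ c.base ⁻¹' D then
    ((pontryaginData B).homeoOf c).symm (localRep c ψ (c.base x) + (t * χ (c.base x)) • v)
  else ψ x

theorem add_zero_smul (r v : PontryaginModel n N) : r + (0 : ℝ) • v = r :=
  (congrArg (r + ·) (zero_smul ℝ v)).trans (add_zero r)

variable {c : FiberedChart B} {ψ : X → PontryaginBundle B} {D : Set (Base n)} {χ : Base n → ℝ}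
  {v : PontryaginModel n N} {ε : ℝ}

theorem bumpVariation_eq_of_zero (hDc : D ⊆ localDomain c ψ) {t : ℝ} {x : X}
    (h : x ∈ c.base.source ∩ c.base ⁻¹' D → t * χ (c.base x) = 0) :
    bumpVariation c ψ D χ v t x = ψ x := by
  by_cases hx : x ∈ c.base.source ∩ c.base ⁻¹' D
  · have h1 := (hDc hx.2).2
    rw [bumpVariation, if_pos hx, h hx, add_zero_smul, localRep]
    rw [c.base.left_inv hx.1] at h1 ⊢
    exact ((pontryaginData B).homeoOf c).left_inv h1
  · rw [bumpVariation, if_neg hx]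

theorem bumpVariation_zero (hDc : D ⊆ localDomain c ψ) : bumpVariation c ψ D χ v 0 = ψ :=
  funext fun _ => bumpVariation_eq_of_zero hDc fun _ => zero_mul _

/-- The bump variation is a smooth family of sections for `|t| < ε`, if `χ` vanishes outside a
closed subset of the domain of the chart and the perturbed coordinates do not leave the chart. -/
theorem isSmoothFamily_bumpVariation (hψ : IsSection ψ) (hD : IsOpen D)
    (hDc : D ⊆ localDomain c ψ) (hχ : ContDiff ℝ ∞ χ) {K : Set X} (hK : IsClosed K)
    (hKD : K ⊆ c.base.source ∩ c.base ⁻¹' D) (hχK : ∀ x ∈ c.base.source, x ∉ K → χ (c.base x) = 0)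
    (hv : v.1.1 = 0) (hε : 0 < ε) (hεt : ∀ t ∈ Ioo (-ε) ε, ∀ u ∈ D,
      (localRep c ψ u + (t * χ u) • v).1 ∈ c.total.target) :
    IsSmoothFamily ε (bumpVariation c ψ D χ v) where
  pos := hε
  smooth := by
    set W := c.base.source ∩ c.base ⁻¹' D with hW
    have hWo : IsOpen W := c.base.isOpen_inter_preimage hD
    rintro ⟨t, x⟩ ⟨ht : t ∈ Ioo (-ε) ε, -⟩
    by_cases hx : x ∈ W
    · have hmem : Ioo (-ε) ε ×ˢ W ∈ 𝓝 (t, x) := (isOpen_Ioo.prod hWo).mem_nhds ⟨ht, hx⟩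
      refine ContMDiffAt.contMDiffWithinAt ?_
      have hb : ContMDiffOn (𝓘(ℝ, ℝ).prod (baseModel n)) 𝓘(ℝ, Base n) ∞
          (fun s : ℝ × X => c.base s.2) (Ioo (-ε) ε ×ˢ W) :=
        c.smooth_base.comp contMDiffOn_snd fun s hs => hs.2.1
      have hr : ContDiffOn ℝ ∞ (fun s : ℝ × Base n => localRep c ψ s.2 + (s.1 * χ s.2) • v)
          (univ ×ˢ D) :=
        (((contDiffOn_localRep c hψ.1).mono hDc).comp contDiffOn_snd fun s hs => hs.2).add
          (ContDiffOn.smul (f := fun s : ℝ × Base n => s.1 * χ s.2) (g := fun _ => v)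
            (contDiffOn_fst.mul (hχ.comp_contDiffOn contDiffOn_snd)) contDiffOn_const)
      have hr' : ContMDiffOn (𝓘(ℝ, ℝ).prod (baseModel n)) 𝓘(ℝ, PontryaginModel n N) ∞
          (fun s : ℝ × X => localRep c ψ (c.base s.2) + (s.1 * χ (c.base s.2)) • v)
          (Ioo (-ε) ε ×ˢ W) :=
        hr.contMDiffOn.comp (f := fun s : ℝ × X => (s.1, c.base s.2))
          (contMDiffOn_fst.prodMk_space hb) fun s hs => ⟨mem_univ _, hs.2.2⟩
      have hall := ((pontryaginData B).contMDiffOn_homeoOf_symm c).comp hr'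
        fun s hs => ⟨hεt s.1 hs.1 _ hs.2.2, mem_univ _⟩
      refine (hall.contMDiffAt hmem).congr_of_eventuallyEq ?_
      filter_upwards [hmem] with s hs using if_pos hs.2
    · have hmem : {s : ℝ × X | s.2 ∉ K} ∈ 𝓝 (t, x) :=
        (hK.isOpen_compl.preimage continuous_snd).mem_nhds fun h => hx (hKD h)
      refine ContMDiffAt.contMDiffWithinAt ?_
      refine ((hψ.1.comp contMDiff_snd).contMDiffAt (x := (t, x))).congr_of_eventuallyEq ?_
      filter_upwards [hmem] with s hs
      exact bumpVariation_eq_of_zero hDc fun h => by rw [hχK _ h.1 hs, mul_zero]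
  toX t ht x := by
    by_cases hx : x ∈ c.base.source ∩ c.base ⁻¹' D
    · have h1 := hεt t ht _ hx.2
      rw [bumpVariation, if_pos hx]
      change B.proj (c.total.symm (localRep c ψ (c.base x) + (t * χ (c.base x)) • v).1) = x
      refine c.base.injOn (c.proj_mem _ (c.total.map_target h1)) hx.1 ?_
      rw [← c.fst_total _ (c.total.map_target h1), c.total.right_inv h1]
      change (localRep c ψ (c.base x)).1.1 + (t * χ (c.base x)) • v.1.1 = _
      rw [hv, smul_zero, add_zero, base_localRep hψ.2 (hDc hx.2)]
    · rw [bumpVariation, if_neg hx]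
      exact hψ.2 x

theorem localVar_bumpVariation (hDc : D ⊆ localDomain c ψ) {u : Base n} (hu : u ∈ D) (hε : 0 < ε)
    (hεt : ∀ t ∈ Ioo (-ε) ε, ∀ u ∈ D, (localRep c ψ u + (t * χ u) • v).1 ∈ c.total.target) :
    localVar c (bumpVariation c ψ D χ v) u = χ u • v := by
  have hut := (hDc hu).1
  have h1 : (fun t => localRep c (bumpVariation c ψ D χ v t) u) =ᶠ[𝓝 0]
      fun t => localRep c ψ u + (t * χ u) • v := by
    filter_upwards [Ioo_mem_nhds (neg_lt_zero.2 hε) hε] with t ht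
    have h2 : c.base.symm u ∈ c.base.source ∩ c.base ⁻¹' D :=
      ⟨c.base.map_target hut, by rwa [mem_preimage, c.base.right_inv hut]⟩
    rw [localRep, bumpVariation, if_pos h2, c.base.right_inv hut]
    exact ((pontryaginData B).homeoOf c).right_inv ⟨hεt t ht u hu, mem_univ _⟩
  rw [localVar, h1.deriv_eq]
  have h3 : HasDerivAt (fun t : ℝ => localRep c ψ u + (t * χ u) • v) ((1 * χ u) • v) 0 :=
    (((hasDerivAt_id (0 : ℝ)).mul_const (χ u)).smul_const v).const_add _
  rw [h3.deriv, one_mul]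

/-- The fundamental lemma of the calculus of variations for the action: a bump function
localizes a nonzero value of the Euler–Lagrange expression. -/
theorem weakEulerLagrange_of_isCriticalPoint [T2Space X] [SigmaCompactSpace X] (η : VolumeForm n X)
    {L : JetBundle B → ℝ} (hL : ContMDiff 𝓘(ℝ, JetModel n N) 𝓘(ℝ, ℝ) ∞ L)
    (hψ : IsSection ψ) (hcrit : IsCriticalPoint η L ψ) (c : FiberedChart B) :
    WeakEulerLagrange c η L ψ := by
  intro u₀ hu₀ v hv
  by_contra hne
  set a : Base n → ℝ := fun u => modelEulerLagrange (localLagrangian c η L) (localRep c ψ u)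
    (fderiv ℝ (localRep c ψ) u) v with ha
  have hac : ContinuousOn a (localDomain c ψ) :=
    continuousOn_modelEulerLagrange c η hL hψ.1 Subset.rfl continuousOn_const
  have hvc : ContinuousOn (volCoeff η c.base) (localDomain c ψ) :=
    (contDiffOn_volCoeff η (IsSmoothChart.base c)).continuousOn.mono fun u hu => hu.1
  -- on `D` neither the Euler–Lagrange expression nor the orientation of the chart changes sign
  set D : Set (Base n) := localDomain c ψ ∩
    {u | 0 < a u * a u₀ ∧ 0 < volCoeff η c.base u * volCoeff η c.base u₀} with hDdef
  have hDc : D ⊆ localDomain c ψ := inter_subset_left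
  have hD : IsOpen D :=
    ((hac.mul continuousOn_const).prodMk (hvc.mul continuousOn_const)).isOpen_inter_preimage
      (isOpen_localDomain c hψ.1.continuous) (isOpen_Ioi.prod isOpen_Ioi)
  have hu₀D : u₀ ∈ D := ⟨hu₀, mul_self_pos.2 hne,
    mul_self_pos.2 (volCoeff_ne_zero η (IsSmoothChart.base c) hu₀.1)⟩
  obtain ⟨r, hr, hrD⟩ := Metric.nhds_basis_closedBall.mem_iff.1 (hD.mem_nhds hu₀D)
  let χ : ContDiffBump u₀ := ⟨r / 2, r, half_pos hr, half_lt_self hr⟩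
  have hχ0 : ∀ u, u ∉ Metric.closedBall u₀ r → χ u = 0 := fun u hu =>
    χ.zero_of_le_dist (le_of_lt (not_le.1 hu))
  set K : Set X := c.base.symm '' Metric.closedBall u₀ r with hKdef
  have hrt : Metric.closedBall u₀ r ⊆ c.base.target := fun u hu => (hDc (hrD hu)).1
  have hK : IsCompact K :=
    (isCompact_closedBall u₀ r).image_of_continuousOn (c.base.continuousOn_symm.mono hrt)
  have hKD : K ⊆ c.base.source ∩ c.base ⁻¹' D := by
    rintro _ ⟨u, hu, rfl⟩
    refine ⟨c.base.map_target (hrt hu), ?_⟩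
    rw [mem_preimage, c.base.right_inv (hrt hu)]
    exact hrD hu
  have hχK : ∀ x ∈ c.base.source, x ∉ K → χ (c.base x) = 0 := fun x hx hxK =>
    hχ0 _ fun h => hxK ⟨_, h, c.base.left_inv hx⟩
  -- the variation stays in the chart for small values of the parameter, by compactness
  have hev : ∀ᶠ t in 𝓝 (0 : ℝ), ∀ u ∈ Metric.closedBall u₀ r,
      (localRep c ψ u + (t * χ u) • v).1 ∈ c.total.target := by
    refine (isCompact_closedBall u₀ r).eventually_forall_of_forall_eventually fun u hu => ?_
    have h1 : ContinuousAt (fun s : ℝ × Base n => (localRep c ψ s.2 + (s.1 * χ s.2) • v).1)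
        (0, u) := by
      have h2 : ContinuousAt (localRep c ψ) u :=
        (contDiffOn_localRep c hψ.1).continuousOn.continuousAt
        ((isOpen_localDomain c hψ.1.continuous).mem_nhds (hDc (hrD hu)))
      refine ContinuousAt.fst (ContinuousAt.add (ContinuousAt.comp (f := Prod.snd)
        (x := ((0 : ℝ), u)) h2 continuousAt_snd) ?_)
      exact ((continuous_fst.mul (χ.continuous.comp continuous_snd)).smul
        continuous_const).continuousAt
    refine h1.eventually_mem (c.total.open_target.mem_nhds ?_)
    change (localRep c ψ u + ((0 : ℝ) * χ u) • v).1 ∈ c.total.target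
    rw [zero_mul, add_zero_smul]
    exact c.total.map_source (hDc (hrD hu)).2
  obtain ⟨ε, hε, hεball⟩ := Metric.eventually_nhds_iff_ball.1 hev
  have hεt : ∀ t ∈ Ioo (-ε) ε, ∀ u ∈ D, (localRep c ψ u + (t * χ u) • v).1 ∈ c.total.target := by
    intro t ht u hu
    by_cases hur : u ∈ Metric.closedBall u₀ r
    · exact hεball t (by rwa [Real.ball_eq_Ioo, zero_sub, zero_add]) u hur
    · rw [hχ0 u hur, mul_zero, add_zero_smul]
      exact c.total.map_source (hDc hu).2
  set Ψ := bumpVariation c ψ D χ v with hΨ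
  have h : IsSmoothFamily ε Ψ := isSmoothFamily_bumpVariation hψ hD hDc χ.contDiff hK.isClosed hKD
    hχK hv hε hεt
  have hΨ0 : Ψ 0 = ψ := bumpVariation_zero hDc
  have hout : ∀ t, ∀ x ∉ K, Ψ t x = ψ x := fun t x hx =>
    bumpVariation_eq_of_zero hDc fun hx' => by rw [hχK x hx'.1 hx, mul_zero]
  have hvar : IsVerticalVariation ψ K Ψ :=
    ⟨hK, hΨ0, ε, hε, h.smooth, fun t ht => ⟨h.toX t ht, hout t⟩⟩
  have hint := (h.hasDerivAt_action η hL hK).unique (hcrit K Ψ hvar)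
  have hKb : c.base '' K ⊆ D := by
    rintro _ ⟨x, hx, rfl⟩
    exact (hKD hx).2
  rw [h.integralDensity_firstVariation c η hL hK hK Subset.rfl (fun x hx => (hKD hx).1) hD
    (by rwa [hΨ0]) hKb (s := (SignType.sign (volCoeff η c.base u₀) : ℝ))
    (fun u hu => abs_eq_sign_mul hu.2.2) (fun t _ x hx => by rw [hΨ0, hout t x hx])] at hint
  set s : ℝ := (SignType.sign (volCoeff η c.base u₀) : ℝ) with hs
  have hs0 : s ≠ 0 := by
    intro h0
    have h1 := sign_mul_self (volCoeff η c.base u₀)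
    rw [← hs, h0, zero_mul] at h1
    exact volCoeff_ne_zero η (IsSmoothChart.base c) hu₀.1 (abs_eq_zero.1 h1.symm)
  -- the integrand is a nonzero constant multiple of the nonnegative function `g`
  set g : Base n → ℝ := D.indicator fun u => χ u * (a u * a u₀) with hg
  have hχD : ∀ u ∈ D \ Metric.closedBall u₀ r, χ u * (a u * a u₀) = 0 := fun u hu => by
    rw [hχ0 u hu.2, zero_mul]
  have hgc : Continuous g := contDiff_zero.1 (contDiff_indicator hD Metric.isClosed_closedBall hrD
    (contDiffOn_zero.2 (χ.continuous.continuousOn.mul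
      ((hac.mono hDc).mul continuousOn_const))) hχD)
  have hgs : HasCompactSupport g := hasCompactSupport_indicator (isCompact_closedBall u₀ r) hχD
  have hg0 : ∀ u, 0 ≤ g u := indicator_nonneg fun u hu => mul_nonneg χ.nonneg hu.2.1.le
  have hgu : g u₀ ≠ 0 := by
    rw [hg, indicator_of_mem hu₀D, χ.one_of_mem_closedBall (Metric.mem_closedBall_self
      (half_pos hr).le), one_mul]
    exact hu₀D.2.1.ne'
  have hpos : 0 < ∫ u, g u := hgc.integral_pos_of_hasCompactSupport_nonneg_nonzero hgs hg0 hgu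
  have heq : ∀ u, D.indicator (fun u => -s * modelEulerLagrange (localLagrangian c η L)
      (localRep c (Ψ 0) u) (fderiv ℝ (localRep c (Ψ 0)) u) (localVar c Ψ u)) u =
      (-s / a u₀) * g u := by
    intro u
    by_cases hu : u ∈ D
    · rw [hg, indicator_of_mem hu, indicator_of_mem hu, hΨ0, hΨ,
        localVar_bumpVariation hDc hu hε hεt, modelEulerLagrange_smul]
      change -s * (χ u * a u) = -s / a u₀ * (χ u * (a u * a u₀))
      have ha0 : a u₀ ≠ 0 := hne
      field_simp
    · rw [hg, indicator_of_notMem hu, indicator_of_notMem hu, mul_zero]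
  simp only [heq] at hint
  rw [integral_const_mul] at hint
  rcases mul_eq_zero.1 hint with h1 | h1
  · exact div_ne_zero (neg_ne_zero.2 hs0) hne h1
  · exact hpos.ne' h1

end BumpVariation

end HamiltonPontryagin

end

open HamiltonPontryagin

theorem mainTheorem2 {n N : ℕ} {X Y F : Type*}
    [TopologicalSpace X] [ChartedSpace (Base n) X] [IsManifold (baseModel n) ∞ X]
    [T2Space X] [SigmaCompactSpace X]
    [TopologicalSpace Y] [ChartedSpace (ModelProd (Base n) (Fib N)) Y]
    [IsManifold (totalModel n N) ∞ Y] [T2Space Y]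
    [TopologicalSpace F] [ChartedSpace (Fib N) F] [IsManifold (𝓡 N) ∞ F]
    (B : SmoothFiberBundle n N X Y F) (η : VolumeForm n X)
    (L : JetBundle B → ℝ) (hL : ContMDiff 𝓘(ℝ, JetModel n N) 𝓘(ℝ, ℝ) ∞ L)
    (ψ : X → PontryaginBundle B) (hψ : IsSection ψ)
    (hE : ∀ x, generalizedEnergy η L (ψ x) = 0) :
    List.TFAE [
      IsCriticalPoint η L ψ,
      ∀ V, IsVerticalField V → DiffForm.pullback (E := Base n) ψ (DiffForm.contract V (omegaE η L)) = 0,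
      ∀ c : FiberedChart B, ImplicitEulerLagrange c η L ψ ∧ CovariantLegendre c η L ψ,
      ∀ x : X, ∃ c : FiberedChart B, (ψ x).pt ∈ c.total.source ∧
        ImplicitEulerLagrange c η L ψ ∧ CovariantLegendre c η L ψ] := by
  tfae_have 1 → 3 := fun h c =>
    (weakEulerLagrange_iff c η L hψ hE).1 (weakEulerLagrange_of_isCriticalPoint η hL hψ h c)
  tfae_have 3 → 4 := fun h x => ⟨B.chart (ψ x).pt, B.mem_chart _, h _⟩
  tfae_have 4 → 1 := fun h => isCriticalPoint_of_weakEulerLagrange η hL hψ fun x =>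
    (h x).imp fun c hc => ⟨hc.1, (weakEulerLagrange_iff c η L hψ hE).2 hc.2⟩
  tfae_have 2 → 3 := fun h c =>
    (weakEulerLagrange_iff c η L hψ hE).1 (weakEulerLagrange_of_pullback_contract η hL hψ c h)
  tfae_have 4 → 2 := fun h V hV => pullback_contract_eq_zero η hL hψ
    (fun x => (h x).imp fun c hc => ⟨hc.1, (weakEulerLagrange_iff c η L hψ hE).2 hc.2⟩) hV
  tfae_finish
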